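/- Let $N\ge 2$, $0\le r\le 1$, $E\in\mathbb R$, $\epsilon>0$, and put $E_\epsilon=E-i\epsilon$. Let $H$ be an $N\times N$ random Hermitian matrix from the interpolating ensemble with parameter $r$: the entries of $H$ are jointly Gaussian and centered, with \[ \langle H_{ij}H_{kl}\rangle=\frac1N\big(\delta(jk)\delta(il)+(1-r)\,\delta(ik)\delta(jl)\big), \] where $\langle\cdot\rangle$ is the expectation and $\delta$ is the Kronecker delta. Let $G(z)=(z-H)^{-1}$. For $s,t>0$, $\alpha\in(-1,1)$ and $z\in\mathbb C\setminus\{0\}$ let \[ B(s,t,\alpha,z)=\frac1N+(z-iE_\epsilon)^2-(2-r)(z-iE_\epsilon)(s+t)+4(1-r)st(1-\alpha^2), \] \[ \begin{aligned} W(s,t,\alpha,z)={}&\exp\Big[-N\Big(iE_\epsilon(s+t)+\big(1-\tfrac r2\big)(s^2+t^2)+rst-\tfrac12\ln s-\tfrac12\ln t\Big)\Big]\\ &\times\exp\Big[-N\Big(iE_\epsilon z-\tfrac12z^2+\ln z\Big)\Big]\exp\Big[-N\Big(2(1-r)st\alpha^2-\tfrac12\ln(1-\alpha^2)\Big)\Big]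 \end{aligned} \] (the branch of $\ln z$ is immaterial, as it is multiplied by the integer $N$). Then \[ \frac1N\langle\mathrm{tr}\,G(E_\epsilon)\rangle=\frac{(-1)^N2^NN^2}{8\pi^2}\int_0^\infty ds\int_0^\infty dt\int_{-1}^1d\alpha\oint dz\; z\,\frac{s+t}{st}\,(1-\alpha^2)^{-3/2}\,B(s,t,\alpha,z)\,W(s,t,\alpha,z), \] whereas \[ i=\frac{(-1)^N2^NN^2}{8\pi^2}\int_0^\infty ds\int_0^\infty dt\int_{-1}^1d\alpha\oint dz\; z\,\frac{1}{st}\,(1-\alpha^2)^{-3/2}\,B(s,t,\alpha,z)\,W(s,t,\alpha,z). \] Here $\oint dz$ is the integral along any counterclockwise contour about zero (a piecewise smooth closed curve in $\mathbb C\setminus\{0\}$ with winding number one about $0$); the expectation exists and both four-fold integrals converge absolutely. -/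

import Mathlib

open MeasureTheory ProbabilityTheory

noncomputable section

/-- The Kronecker delta, as a complex number. -/
def kron {N : ℕ} (i j : Fin N) : ℂ := if i = j then 1 else 0

/-- `H` is a random matrix from the interpolating ensemble with parameter `r`: an `N × N` Hermitian
random matrix whose entries are jointly Gaussian, centred, and have covariance
`⟨H i j * H k l⟩ = (1 / N) * (δ(jk) δ(il) + (1 - r) δ(ik) δ(jl))`. -/
structure IsInterpolatingEnsemble {Ω : Type*} [MeasurableSpace Ω] (N : ℕ) (r : ℝ)
    (μ : Measure Ω) (H : Ω → Matrix (Fin N) (Fin N) ℂ) : Prop where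
  hermitian : ∀ᵐ ω ∂μ, (H ω).IsHermitian
  gaussian : HasGaussianLaw (fun ω (p : Fin N × Fin N) => H ω p.1 p.2) μ
  centered : ∀ i j, ∫ ω, H ω i j ∂μ = 0
  covariance : ∀ i j k l, ∫ ω, H ω i j * H ω k l ∂μ =
    (1 / (N : ℂ)) * (kron j k * kron i l + (1 - (r : ℂ)) * (kron i k * kron j l))

/-- The spectral parameter `E - i ε`. -/
def specParam (E ε : ℝ) : ℂ := (E : ℂ) - Complex.I * (ε : ℂ)

/-- The resolvent `G(z) = (z - H)⁻¹`. -/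
def resolventMatrix {N : ℕ} (H : Matrix (Fin N) (Fin N) ℂ) (z : ℂ) : Matrix (Fin N) (Fin N) ℂ :=
  (z • (1 : Matrix (Fin N) (Fin N) ℂ) - H)⁻¹

/-- The path `γ`, parametrized by `[0, 1]`, is a counterclockwise contour about zero: a closed
curve, differentiable off finitely many points with integrable derivative (in particular any
piecewise continuously differentiable closed curve), that avoids zero and has winding number one
about it. -/
structure IsContourAboutZero (γ : ℝ → ℂ) : Prop where
  continuousOn : ContinuousOn γ (Set.Icc 0 1)
  closed : γ 0 = γ 1
  differentiable : ∃ P : Finset ℝ, ∀ u ∈ Set.Ioo (0 : ℝ) 1, u ∉ P → DifferentiableAt ℝ γ u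
  integrable_deriv : IntervalIntegrable (deriv γ) volume 0 1
  ne_zero : ∀ u ∈ Set.Icc (0 : ℝ) 1, γ u ≠ 0
  winding : (2 * (Real.pi : ℂ) * Complex.I)⁻¹ * ∫ u in (0 : ℝ)..1, deriv γ u / γ u = 1

/-- The polynomial factor
`1/N + (z - i a)² - (2 - r) (z - i a) (s + t) + 4 (1 - r) s t (1 - α²)`. -/
def bracketFactor (N : ℕ) (r : ℝ) (a : ℂ) (s t α : ℝ) (z : ℂ) : ℂ :=
  1 / (N : ℂ) + (z - Complex.I * a) ^ 2
    - (2 - (r : ℂ)) * (z - Complex.I * a) * ((s : ℂ) + (t : ℂ))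
    + 4 * (1 - (r : ℂ)) * (s : ℂ) * (t : ℂ) * (1 - (α : ℂ) ^ 2)

/-- The product of the three exponentials in the integrand. The choice of the branch of `log z` is
immaterial, since it is multiplied by the integer `N` in the exponent. -/
def expFactor (N : ℕ) (r : ℝ) (a : ℂ) (s t α : ℝ) (z : ℂ) : ℂ :=
  Complex.exp (-(N : ℂ) * (Complex.I * a * ((s : ℂ) + (t : ℂ))
      + (1 - (r : ℂ) / 2) * ((s : ℂ) ^ 2 + (t : ℂ) ^ 2) + (r : ℂ) * (s : ℂ) * (t : ℂ)
      - (1 / 2) * (Real.log s : ℂ) - (1 / 2) * (Real.log t : ℂ)))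
    * Complex.exp (-(N : ℂ) * (Complex.I * a * z - (1 / 2) * z ^ 2 + Complex.log z))
    * Complex.exp (-(N : ℂ) * (2 * (1 - (r : ℂ)) * (s : ℂ) * (t : ℂ) * (α : ℂ) ^ 2
      - (1 / 2) * (Real.log (1 - α ^ 2) : ℂ)))

/-- The integrand of the formula for the normalized trace of the resolvent. -/
def traceIntegrand (N : ℕ) (r : ℝ) (a : ℂ) (s t α : ℝ) (z : ℂ) : ℂ :=
  z * (((s : ℂ) + (t : ℂ)) / ((s : ℂ) * (t : ℂ))) * (((1 - α ^ 2) ^ (-(3 / 2) : ℝ) : ℝ) : ℂ)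
    * bracketFactor N r a s t α z * expFactor N r a s t α z

/-- The integrand of the companion formula. -/
def unitIntegrand (N : ℕ) (r : ℝ) (a : ℂ) (s t α : ℝ) (z : ℂ) : ℂ :=
  z * (1 / ((s : ℂ) * (t : ℂ))) * (((1 - α ^ 2) ^ (-(3 / 2) : ℝ) : ℝ) : ℂ)
    * bracketFactor N r a s t α z * expFactor N r a s t α z

/-- `∫_0^∞ ds ∫_0^∞ dt ∫_{-1}^1 dα ∮ dz F(s, t, α, z)`, the contour being `γ`. -/
def fourfoldIntegral (γ : ℝ → ℂ) (F : ℝ → ℝ → ℝ → ℂ → ℂ) : ℂ :=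
  ∫ s in Set.Ioi (0 : ℝ), ∫ t in Set.Ioi (0 : ℝ), ∫ α in (-1 : ℝ)..1, ∫ u in (0 : ℝ)..1,
    F s t α (γ u) * deriv γ u

/-- The four-fold integral of `F` converges absolutely. -/
def FourfoldIntegrable (γ : ℝ → ℂ) (F : ℝ → ℝ → ℝ → ℂ → ℂ) : Prop :=
  IntegrableOn
    (fun p : ℝ × ℝ × ℝ × ℝ => F p.1 p.2.1 p.2.2.1 (γ p.2.2.2) * deriv γ p.2.2.2)
    (Set.Ioi (0 : ℝ) ×ˢ Set.Ioi (0 : ℝ) ×ˢ Set.Ioo (-1 : ℝ) 1 ×ˢ Set.Ioo (0 : ℝ) 1) volume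

/-- The constant `(-1)^N 2^N N² / (8 π²)`. -/
def prefactor (N : ℕ) : ℂ :=
  ((-1) ^ N * 2 ^ N * (N : ℂ) ^ 2) / (8 * (Real.pi : ℂ) ^ 2)

end

/-! Write `a` for the spectral parameter, so that `Im a < 0`. For Hermitian `H` the eigenvalues of
`i(a - H)` have positive real part. Hence the complex Gaussian integral of `exp(-iN φ†(a - H)φ)`
over `φ ∈ ℂ^N` is `(π/N)^N / det(i(a - H))`, and inserting `φ†φ` multiplies it by `-(i/N) tr (a -
H)⁻¹` (`det_mul_integral_quadWeight`, `det_mul_integral_sqNorm_mul_quadWeight`). After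
multiplication by the determinant, the first integral is a deterministic constant and the second a
constant times the trace. Averaging these two identities over `H` gives the companion formula and
the trace formula.

The average is moved inside the `φ`-integral by Fubini (`IsEnsembleLaw.average_exchange`), which
leaves the mean of `det(i(a - H)) exp(iN φ†Hφ)` at fixed `φ`. The character contributes its own
mean, a Gaussian weight in `φ`, and shifts `-iH` by the rank-two matrix `φφ† + (1-r) φ̄φᵀ`. In the
determinant only covariances between different rows matter, so the `δ(ik)δ(jl)` part of the
covariance drops out. The other part acts, after exchanging two rows, exactly like a random scalar
matrix `g·1` with `g` Gaussian of variance `1/N` (`integral_det_rowPerturb`). What remains is the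
determinant of a rank-two perturbation of `(ia + g)·1`, which needs only the moments of `ia + g` of
orders `N`, `N-1`, `N-2`.

Those moments are Hermite-type polynomials and obey the same recurrence as the contour integrals of
`exp(-N(cz - z²/2)) / z^k` with `c = ia` (`contourMoment_eq`). Integration by parts along the
contour assembles them into the quadratic factor `B` (`contourMoment_quadratic`).

Finally, for `φ = x + iy` the averaged integrand depends only on `s = |x|²`, `t = |y|²` and the
cosine `α` of the angle between `x` and `y`. Lebesgue measure pushes forward to a constant times
`(st)^(N/2-1) (1-α²)^((N-3)/2) ds dt dα` (`map_gramTriple`), the constant being evaluated by the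
duplication formula for the Gamma function. Absolute convergence is checked separately, by
comparison with products of one-variable integrable functions. -/

set_option linter.unusedSectionVars false

/-! ### Gaussian integration by parts in the presence of a character. -/

section GaussianMoments

variable {V : Type*} [NormedAddCommGroup V] [NormedSpace ℝ V]

/-- A continuous function growing at most polynomially. -/
def HasPolyGrowth (f : V → ℂ) : Prop :=
  Continuous f ∧ ∃ (C : ℝ) (n : ℕ), ∀ x, ‖f x‖ ≤ C * (1 + ‖x‖) ^ n

namespace HasPolyGrowth

lemma const (c : ℂ) : HasPolyGrowth (fun _ : V => c) :=
  ⟨continuous_const, ‖c‖, 0, fun x => by simp⟩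

lemma clm (X : V →L[ℝ] ℂ) : HasPolyGrowth (fun x => X x) := by
  refine ⟨X.continuous, ‖X‖, 1, fun x => (X.le_opNorm x).trans ?_⟩
  have := norm_nonneg X
  nlinarith [norm_nonneg x]

lemma clm_real (X : V →L[ℝ] ℝ) : HasPolyGrowth (fun x => ((X x : ℝ) : ℂ)) :=
  clm (Complex.ofRealCLM.comp X)

lemma mul {f g : V → ℂ} (hf : HasPolyGrowth f) (hg : HasPolyGrowth g) :
    HasPolyGrowth (fun x => f x * g x) := by
  obtain ⟨hf, C, n, hC⟩ := hf
  obtain ⟨hg, D, m, hD⟩ := hg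
  refine ⟨hf.mul hg, C * D, n + m, fun x => ?_⟩
  rw [norm_mul, pow_add]
  calc ‖f x‖ * ‖g x‖ ≤ (C * (1 + ‖x‖) ^ n) * (D * (1 + ‖x‖) ^ m) :=
        mul_le_mul (hC x) (hD x) (norm_nonneg _) ((norm_nonneg _).trans (hC x))
    _ = _ := by ring

lemma add {f g : V → ℂ} (hf : HasPolyGrowth f) (hg : HasPolyGrowth g) :
    HasPolyGrowth (fun x => f x + g x) := by
  obtain ⟨hf, C, n, hC⟩ := hf
  obtain ⟨hg, D, m, hD⟩ := hg
  refine ⟨hf.add hg, |C| + |D|, n + m, fun x => ?_⟩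
  have h1 : (1 : ℝ) ≤ 1 + ‖x‖ := by linarith [norm_nonneg x]
  have hn : (1 + ‖x‖) ^ n ≤ (1 + ‖x‖) ^ (n + m) := pow_le_pow_right₀ h1 (by omega)
  have hm : (1 + ‖x‖) ^ m ≤ (1 + ‖x‖) ^ (n + m) := pow_le_pow_right₀ h1 (by omega)
  calc ‖f x + g x‖ ≤ ‖f x‖ + ‖g x‖ := norm_add_le _ _
    _ ≤ C * (1 + ‖x‖) ^ n + D * (1 + ‖x‖) ^ m := add_le_add (hC x) (hD x)
    _ ≤ |C| * (1 + ‖x‖) ^ (n + m) + |D| * (1 + ‖x‖) ^ (n + m) := by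
        gcongr <;> exact le_abs_self _
    _ = _ := by ring

lemma sum {ι : Type*} (T : Finset ι) {f : ι → V → ℂ} (hf : ∀ i ∈ T, HasPolyGrowth (f i)) :
    HasPolyGrowth (fun x => ∑ i ∈ T, f i x) := by
  classical
  induction T using Finset.induction_on with
  | empty => simpa using const 0
  | insert a T ha ih =>
    simp only [Finset.sum_insert ha]
    exact (hf a (Finset.mem_insert_self _ _)).add
      (ih fun i hi => hf i (Finset.mem_insert_of_mem hi))

lemma prod {ι : Type*} (T : Finset ι) {f : ι → V → ℂ} (hf : ∀ i ∈ T, HasPolyGrowth (f i)) :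
    HasPolyGrowth (fun x => ∏ i ∈ T, f i x) := by
  classical
  induction T using Finset.induction_on with
  | empty => simpa using const 1
  | insert a T ha ih =>
    simp only [Finset.prod_insert ha]
    exact (hf a (Finset.mem_insert_self _ _)).mul
      (ih fun i hi => hf i (Finset.mem_insert_of_mem hi))

lemma det {n : Type*} [Fintype n] [DecidableEq n] {M : V → Matrix n n ℂ}
    (hM : ∀ i j, HasPolyGrowth (fun x => M x i j)) : HasPolyGrowth (fun x => (M x).det) := by
  simp only [Matrix.det_apply']
  exact sum _ fun σ _ => (const _).mul (prod _ fun i _ => hM _ _)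

lemma cexp (L : V →L[ℝ] ℝ) : HasPolyGrowth (fun x => Complex.exp (Complex.I * (L x : ℂ))) := by
  refine ⟨by fun_prop, 1, 0, fun x => ?_⟩
  simp only [pow_zero, mul_one]
  rw [mul_comm, Complex.norm_exp_ofReal_mul_I]

variable [MeasurableSpace V] [BorelSpace V] [CompleteSpace V] [SecondCountableTopology V]

lemma integrable {f : V → ℂ} (hf : HasPolyGrowth f) (ν : Measure V) [IsGaussian ν] :
    Integrable f ν := by
  obtain ⟨hc, C, n, hC⟩ := hf
  have h0 : MemLp (fun x : V => ‖x‖) (n : ENNReal) ν :=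
    (IsGaussian.memLp_id ν (n : ENNReal) (ENNReal.natCast_ne_top n)).norm
  have h1 : MemLp (fun x : V => (1 : ℝ) + ‖x‖) (n : ENNReal) ν := (memLp_const (1 : ℝ)).add h0
  have h2 : Integrable (fun x : V => (1 + ‖x‖) ^ n) ν := by
    refine h1.integrable_norm_pow'.congr (Filter.Eventually.of_forall fun x => ?_)
    have : (0 : ℝ) ≤ 1 + ‖x‖ := by positivity
    simp only [Real.norm_of_nonneg this]
  have h3 : Integrable (fun x : V => C * (1 + ‖x‖) ^ n) ν := h2.const_mul C
  exact h3.mono' hc.aestronglyMeasurable (Filter.Eventually.of_forall hC)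

end HasPolyGrowth

variable [MeasurableSpace V] [BorelSpace V] [CompleteSpace V] [SecondCountableTopology V]

/-- Moving the frequency in direction `U` brings down a factor `iU`, which is how new linear factors
are produced. Since characters are unimodular, `|U f|` dominates the derivative uniformly in `t`. -/
lemma hasDerivAt_integral_mul_cexp (ν : Measure V) [IsGaussian ν] {f : V → ℂ}
    (hf : HasPolyGrowth f) (L U : V →L[ℝ] ℝ) :
    HasDerivAt (fun t : ℝ => ∫ x, f x * Complex.exp (Complex.I * ((L + t • U) x : ℝ)) ∂ν)
      (Complex.I * ∫ x, (U x : ℂ) * f x * Complex.exp (Complex.I * (L x : ℂ)) ∂ν) 0 := by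
  have hU := HasPolyGrowth.clm_real U
  have key := hasDerivAt_integral_of_dominated_loc_of_deriv_le (μ := ν) (x₀ := (0 : ℝ))
    (s := Set.univ) (F := fun t x => f x * Complex.exp (Complex.I * ((L + t • U) x : ℝ)))
    (F' := fun t x => f x * (Complex.exp (Complex.I * ((L + t • U) x : ℝ)) *
      (Complex.I * (U x : ℂ))))
    (bound := fun x => ‖(U x : ℂ) * f x‖) Filter.univ_mem
    (Filter.Eventually.of_forall fun t =>
      ((hf.mul (HasPolyGrowth.cexp _)).integrable ν).aestronglyMeasurable)
    ((hf.mul (HasPolyGrowth.cexp _)).integrable ν)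
    ((hf.mul ((HasPolyGrowth.cexp _).mul ((HasPolyGrowth.const _).mul hU))).integrable
      ν).aestronglyMeasurable
    (Filter.Eventually.of_forall fun x t _ => by
      rw [norm_mul, norm_mul, norm_mul, norm_mul, mul_comm Complex.I,
        Complex.norm_exp_ofReal_mul_I, Complex.norm_I]
      simp [mul_comm])
    ((hU.mul hf).integrable ν).norm
    (Filter.Eventually.of_forall fun x t _ => by
      refine HasDerivAt.const_mul _ (HasDerivAt.cexp (HasDerivAt.const_mul _ ?_))
      simp only [add_apply, smul_apply, smul_eq_mul]
      have : HasDerivAt (fun t : ℝ => L x + t * U x) (U x) t := by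
        simpa using ((hasDerivAt_id t).mul_const (U x)).const_add (L x)
      exact this.ofReal_comp)
  have h2 : Complex.I * ∫ x, (U x : ℂ) * f x * Complex.exp (Complex.I * (L x : ℂ)) ∂ν =
      ∫ x, f x * (Complex.exp (Complex.I * ((L + (0 : ℝ) • U) x : ℝ)) *
        (Complex.I * (U x : ℂ))) ∂ν := by
    rw [← integral_const_mul]
    refine integral_congr_ae (Filter.Eventually.of_forall fun x => ?_)
    simp only [zero_smul, add_zero]
    ring
  rw [h2]
  exact key.2

lemma integral_cexp_of_isGaussian (ν : Measure V) [IsGaussian ν]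
    (h0 : ∀ L : V →L[ℝ] ℝ, ∫ x, L x ∂ν = 0) (L : V →L[ℝ] ℝ) :
    ∫ x, Complex.exp (Complex.I * (L x : ℂ)) ∂ν
      = Complex.exp (-(1 / 2) * ∫ x, (L x : ℂ) * (L x : ℂ) ∂ν) := by
  have h1 := IsGaussian.charFunDual_eq_of_forall_strongDual_eq_zero (μ := ν) h0 L
  rw [charFunDual_apply] at h1
  have h2 : Var[L; ν] = ∫ x, L x * L x ∂ν := by
    rw [variance_of_integral_eq_zero (by fun_prop) (h0 L)]
    simp [sq]
  rw [h2] at h1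
  have h3 : (∫ x, (L x : ℂ) * (L x : ℂ) ∂ν) = ((∫ x, L x * L x ∂ν : ℝ) : ℂ) := by
    rw [← integral_complex_ofReal]
    congr 1
    ext x
    push_cast
    ring
  rw [h3]
  rw [show (fun x => Complex.exp (Complex.I * (L x : ℂ)))
    = fun x => Complex.exp ((L x : ℂ) * Complex.I) from by ext x; rw [mul_comm], h1]
  congr 1
  ring

/-- Linear functionals on complex-valued real-linear maps are determined by real-valued maps. -/
lemma linearMap_ext_of_real {F G : (V →L[ℝ] ℂ) →ₗ[ℂ] ℂ}
    (h : ∀ U : V →L[ℝ] ℝ, F (Complex.ofRealCLM.comp U) = G (Complex.ofRealCLM.comp U)) :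
    F = G := by
  ext Y
  have hY : Y = Complex.ofRealCLM.comp (Complex.reCLM.comp Y)
      + Complex.I • Complex.ofRealCLM.comp (Complex.imCLM.comp Y) := by
    ext x
    simp only [add_apply, smul_apply, ContinuousLinearMap.comp_apply, Complex.ofRealCLM_apply,
      Complex.reCLM_apply, Complex.imCLM_apply, smul_eq_mul]
    rw [mul_comm, Complex.re_add_im]
  rw [hY]
  simp only [map_add, map_smul, h]

/-- The linear functional `Y ↦ ∫ Y x * f x`. -/
noncomputable def momentMap (ν : Measure V) [IsGaussian ν] {f : V → ℂ} (hf : HasPolyGrowth f) :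
    (V →L[ℝ] ℂ) →ₗ[ℂ] ℂ where
  toFun Y := ∫ x, Y x * f x ∂ν
  map_add' Y Z := by
    rw [← integral_add (((HasPolyGrowth.clm Y).mul hf).integrable ν)
      (((HasPolyGrowth.clm Z).mul hf).integrable ν)]
    simp only [add_apply, add_mul]
  map_smul' c Y := by
    rw [RingHom.id_apply, smul_eq_mul, ← integral_const_mul]
    simp only [smul_apply, smul_eq_mul, mul_assoc]

lemma momentMap_apply (ν : Measure V) [IsGaussian ν] {f : V → ℂ} (hf : HasPolyGrowth f)
    (Y : V →L[ℝ] ℂ) : momentMap ν hf Y = ∫ x, Y x * f x ∂ν := rfl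

/-- For a real functional `U`, this is the derivative at `t = 0` of the characteristic function
along `L + tU`, whose exponent is quadratic in `t`. Complex linearity then gives every `W`. -/
lemma integral_mul_cexp_of_isGaussian (ν : Measure V) [IsGaussian ν]
    (h0 : ∀ L : V →L[ℝ] ℝ, ∫ x, L x ∂ν = 0) (W : V →L[ℝ] ℂ) (L : V →L[ℝ] ℝ) :
    ∫ x, W x * Complex.exp (Complex.I * (L x : ℂ)) ∂ν
      = Complex.I * (∫ x, W x * (L x : ℂ) ∂ν)
        * ∫ x, Complex.exp (Complex.I * (L x : ℂ)) ∂ν := by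
  have key : momentMap ν (HasPolyGrowth.cexp L) =
      (Complex.I * ∫ x, Complex.exp (Complex.I * (L x : ℂ)) ∂ν) •
        momentMap ν (HasPolyGrowth.clm_real L) := by
    refine linearMap_ext_of_real fun U => ?_
    have h1 := hasDerivAt_integral_mul_cexp ν (HasPolyGrowth.const 1) L U
    simp only [one_mul, mul_one] at h1
    have hU := HasPolyGrowth.clm_real U
    have hL := HasPolyGrowth.clm_real L
    have hexp : ∀ t : ℝ, (∫ x, ((L + t • U) x : ℂ) * ((L + t • U) x : ℂ) ∂ν) =
        (∫ x, (L x : ℂ) * (L x : ℂ) ∂ν) + (2 * ∫ x, (U x : ℂ) * (L x : ℂ) ∂ν) * t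
          + (∫ x, (U x : ℂ) * (U x : ℂ) ∂ν) * t ^ 2 := by
      intro t
      rw [← integral_const_mul, ← integral_mul_const, ← integral_mul_const,
        ← integral_add ((hL.mul hL).integrable ν)
          (((HasPolyGrowth.const 2).mul (hU.mul hL)).mul (HasPolyGrowth.const _) |>.integrable ν),
        ← integral_add (((hL.mul hL).add
          (((HasPolyGrowth.const 2).mul (hU.mul hL)).mul (HasPolyGrowth.const _))).integrable ν)
          ((hU.mul hU).mul (HasPolyGrowth.const _) |>.integrable ν)]
      refine integral_congr_ae (Filter.Eventually.of_forall fun x => ?_)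
      simp only [add_apply, smul_apply, smul_eq_mul, Complex.ofReal_add, Complex.ofReal_mul]
      ring
    have h2 : HasDerivAt (fun t : ℝ => ∫ x, Complex.exp (Complex.I * ((L + t • U) x : ℝ)) ∂ν)
        (Complex.exp (-(1 / 2) * ∫ x, (L x : ℂ) * (L x : ℂ) ∂ν) *
          (-(∫ x, (U x : ℂ) * (L x : ℂ) ∂ν))) 0 := by
      simp_rw [integral_cexp_of_isGaussian ν h0, hexp]
      generalize (∫ x, (L x : ℂ) * (L x : ℂ) ∂ν) = p
      generalize (∫ x, (U x : ℂ) * (L x : ℂ) ∂ν) = q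
      generalize (∫ x, (U x : ℂ) * (U x : ℂ) ∂ν) = s
      have hp : HasDerivAt (fun z : ℂ => Complex.exp (-(1 / 2) * (p + 2 * q * z + s * z ^ 2)))
          (Complex.exp (-(1 / 2) * p) * (-q)) ((0 : ℝ) : ℂ) := by
        have := ((((hasDerivAt_id (((0 : ℝ) : ℂ))).const_mul (2 * q)).const_add p).add
          (((hasDerivAt_id (((0 : ℝ) : ℂ))).pow 2).const_mul s)).const_mul (-(1 / 2) : ℂ) |>.cexp
        refine this.congr_deriv ?_
        simp
      exact hp.comp_ofReal
    have h3 := h1.unique h2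
    rw [← integral_cexp_of_isGaussian ν h0] at h3
    rw [LinearMap.smul_apply, momentMap_apply, momentMap_apply, smul_eq_mul]
    simp only [ContinuousLinearMap.comp_apply, Complex.ofRealCLM_apply]
    linear_combination (-Complex.I) * h3 + (∫ x, (U x : ℂ) *
      Complex.exp (Complex.I * (L x : ℂ)) ∂ν) * Complex.I_mul_I
  have := LinearMap.congr_fun key W
  rw [LinearMap.smul_apply, momentMap_apply, momentMap_apply, smul_eq_mul] at this
  rw [this]
  ring

lemma HasPolyGrowth.affineProd {ι : Type*} (T : Finset ι) (b : ι → ℂ) (X : ι → V →L[ℝ] ℂ) :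
    HasPolyGrowth (fun x => ∏ k ∈ T, (b k + X k x)) :=
  HasPolyGrowth.prod _ fun k _ => (HasPolyGrowth.const (b k)).add (HasPolyGrowth.clm (X k))

/-- Gaussian integration by parts for a product of affine functions and a character. -/
theorem integral_mul_prod_mul_cexp (ν : Measure V) [IsGaussian ν]
    (h0 : ∀ L : V →L[ℝ] ℝ, ∫ x, L x ∂ν = 0) {ι : Type*} [DecidableEq ι]
    (b : ι → ℂ) (X : ι → V →L[ℝ] ℂ) (T : Finset ι) :
    ∀ (W : V →L[ℝ] ℂ) (L : V →L[ℝ] ℝ),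
    ∫ x, W x * ((∏ k ∈ T, (b k + X k x)) * Complex.exp (Complex.I * (L x : ℂ))) ∂ν
      = ∑ k ∈ T, (∫ x, W x * X k x ∂ν) *
          (∫ x, (∏ j ∈ T.erase k, (b j + X j x)) * Complex.exp (Complex.I * (L x : ℂ)) ∂ν)
        + Complex.I * (∫ x, W x * (L x : ℂ) ∂ν) *
          ∫ x, (∏ k ∈ T, (b k + X k x)) * Complex.exp (Complex.I * (L x : ℂ)) ∂ν := by
  induction T using Finset.induction_on with
  | empty =>
    intro W L
    simpa using integral_mul_cexp_of_isGaussian ν h0 W L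
  | insert m T hm ih =>
    intro W L
    have hP : ∀ S : Finset ι, HasPolyGrowth
        (fun x => (∏ k ∈ S, (b k + X k x)) * Complex.exp (Complex.I * (L x : ℂ))) :=
      fun S => (HasPolyGrowth.affineProd S b X).mul (HasPolyGrowth.cexp L)
    have hW := HasPolyGrowth.clm W
    -- The induction hypothesis holds for every frequency. Differentiating it along `L + tU` inserts
    -- an extra factor `U`, and complex linearity allows `U` to be replaced by the new factor `X m`.
    have key : momentMap ν (hW.mul (hP T)) =
        ∑ k ∈ T, (∫ x, W x * X k x ∂ν) • momentMap ν (hP (T.erase k))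
        + (∫ x, (∏ k ∈ T, (b k + X k x)) * Complex.exp (Complex.I * (L x : ℂ)) ∂ν) •
          momentMap ν hW
        + (Complex.I * (∫ x, W x * (L x : ℂ) ∂ν)) • momentMap ν (hP T) := by
      refine linearMap_ext_of_real fun U => ?_
      simp only [LinearMap.add_apply, LinearMap.smul_apply, LinearMap.sum_apply, momentMap_apply,
        smul_eq_mul, ContinuousLinearMap.comp_apply, Complex.ofRealCLM_apply]
      have hd := fun S : Finset ι =>
        hasDerivAt_integral_mul_cexp ν (HasPolyGrowth.affineProd S b X) L U
      have hl := hasDerivAt_integral_mul_cexp ν (hW.mul (HasPolyGrowth.affineProd T b X)) L U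
      have hc : HasDerivAt (fun t : ℝ => ∫ x, W x * ((L + t • U) x : ℂ) ∂ν)
          (∫ x, W x * (U x : ℂ) ∂ν) 0 := by
        have : ∀ t : ℝ, (∫ x, W x * ((L + t • U) x : ℂ) ∂ν) =
            (∫ x, W x * (L x : ℂ) ∂ν) + t * ∫ x, W x * (U x : ℂ) ∂ν := by
          intro t
          rw [← integral_const_mul, ← integral_add
            ((hW.mul (HasPolyGrowth.clm_real L)).integrable ν)
            (((HasPolyGrowth.const _).mul (hW.mul (HasPolyGrowth.clm_real U))).integrable ν)]
          refine integral_congr_ae (Filter.Eventually.of_forall fun x => ?_)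
          simp only [add_apply, smul_apply, smul_eq_mul, Complex.ofReal_add, Complex.ofReal_mul]
          ring
        rw [funext this]
        simpa using ((hasDerivAt_id (0 : ℝ)).ofReal_comp.mul_const
          (∫ x, W x * (U x : ℂ) ∂ν)).const_add (∫ x, W x * (L x : ℂ) ∂ν)
      have hr := (HasDerivAt.fun_sum fun k (_ : k ∈ T) =>
        (hd (T.erase k)).const_mul (∫ x, W x * X k x ∂ν)).add
        ((hc.const_mul Complex.I).mul (hd T))
      have he : (fun t : ℝ => ∫ x, W x * (∏ k ∈ T, (b k + X k x)) *
          Complex.exp (Complex.I * ((L + t • U) x : ℝ)) ∂ν) = _ :=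
        funext fun t => by
          simp only [mul_assoc]
          exact ih W (L + t • U)
      rw [he] at hl
      have h3 := hl.unique hr
      simp only [zero_smul, add_zero, mul_left_comm _ Complex.I, ← Finset.mul_sum] at h3
      have h4 : ∀ p q : ℂ, Complex.I * p = Complex.I * q → p = q := fun p q h =>
        mul_left_cancel₀ Complex.I_ne_zero h
      apply h4
      simp only [mul_assoc, mul_comm, mul_left_comm] at h3 ⊢
      rw [h3]
      ring
    have hK := LinearMap.congr_fun key (X m)
    simp only [LinearMap.add_apply, LinearMap.smul_apply, LinearMap.sum_apply, momentMap_apply,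
        smul_eq_mul] at hK
    have hI := ih W L
    have hsplit : ∀ S : Finset ι, m ∉ S →
        ∫ x, (∏ k ∈ insert m S, (b k + X k x)) * Complex.exp (Complex.I * (L x : ℂ)) ∂ν =
        b m * (∫ x, (∏ k ∈ S, (b k + X k x)) * Complex.exp (Complex.I * (L x : ℂ)) ∂ν) +
        ∫ x, X m x * ((∏ k ∈ S, (b k + X k x)) * Complex.exp (Complex.I * (L x : ℂ))) ∂ν := by
      intro S hS
      rw [← integral_const_mul, ← integral_add
        (((HasPolyGrowth.const _).mul (hP S)).integrable ν)
        (((HasPolyGrowth.clm (X m)).mul (hP S)).integrable ν)]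
      refine integral_congr_ae (Filter.Eventually.of_forall fun x => ?_)
      simp only [Finset.prod_insert hS]
      ring
    have hlhs : ∫ x, W x * ((∏ k ∈ insert m T, (b k + X k x)) *
        Complex.exp (Complex.I * (L x : ℂ))) ∂ν =
        b m * (∫ x, W x * ((∏ k ∈ T, (b k + X k x)) * Complex.exp (Complex.I * (L x : ℂ))) ∂ν) +
        ∫ x, X m x * (W x * ((∏ k ∈ T, (b k + X k x)) *
          Complex.exp (Complex.I * (L x : ℂ)))) ∂ν := by
      rw [← integral_const_mul, ← integral_add
        (((HasPolyGrowth.const _).mul (hW.mul (hP T))).integrable ν)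
        (((HasPolyGrowth.clm (X m)).mul (hW.mul (hP T))).integrable ν)]
      refine integral_congr_ae (Filter.Eventually.of_forall fun x => ?_)
      simp only [Finset.prod_insert hm]
      ring
    rw [hlhs, hK, hI, Finset.sum_insert hm, Finset.erase_insert hm, hsplit T hm]
    have hs : ∀ k ∈ T, (∫ x, W x * X k x ∂ν) * (∫ x, (∏ j ∈ (insert m T).erase k,
        (b j + X j x)) * Complex.exp (Complex.I * (L x : ℂ)) ∂ν) =
        b m * ((∫ x, W x * X k x ∂ν) * (∫ x, (∏ j ∈ T.erase k,
        (b j + X j x)) * Complex.exp (Complex.I * (L x : ℂ)) ∂ν)) +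
        (∫ x, W x * X k x ∂ν) * ∫ x, X m x * ((∏ k ∈ T.erase k, (b k + X k x)) *
          Complex.exp (Complex.I * (L x : ℂ))) ∂ν := by
      intro k hk
      have hmk : m ≠ k := fun h => hm (h ▸ hk)
      rw [Finset.erase_insert_of_ne hmk, hsplit _ (fun h => hm (Finset.mem_of_mem_erase h))]
      ring
    rw [Finset.sum_congr rfl hs, Finset.sum_add_distrib, ← Finset.mul_sum]
    have hsym : ∫ x, X m x * W x ∂ν = ∫ x, W x * X m x ∂ν := by simp only [mul_comm]
    rw [hsym]
    ring

end GaussianMoments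

/-! ### Averaging a determinant with jointly Gaussian entries. -/

section DetAverage

variable {n : Type*} [Fintype n] [DecidableEq n]

/-- Add the rows of `Y` indexed by `S` to the corresponding rows of `A`. -/
def rowPerturb (S : Finset n) (A Y : Matrix n n ℂ) : Matrix n n ℂ :=
  Matrix.of fun i j => A i j + if i ∈ S then Y i j else 0

lemma rowPerturb_empty (A Y : Matrix n n ℂ) : rowPerturb ∅ A Y = A := by
  ext i j
  simp [rowPerturb]

lemma rowPerturb_univ (A Y : Matrix n n ℂ) : rowPerturb Finset.univ A Y = A + Y := by
  ext i j
  simp [rowPerturb]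

lemma updateRow_rowPerturb (S : Finset n) (A Y : Matrix n n ℂ) (k : n) (v : n → ℂ) :
    (rowPerturb S A Y).updateRow k v = rowPerturb (S.erase k) (A.updateRow k v) Y := by
  ext i j
  by_cases h : i = k
  · subst h
    simp [rowPerturb]
  · simp [rowPerturb, h]

lemma det_rowPerturb_updateRow_smul (S : Finset n) (A Y : Matrix n n ℂ) (k : n) (c : ℂ)
    (v : n → ℂ) : (rowPerturb (S.erase k) (A.updateRow k (c • v)) Y).det =
      c * (rowPerturb (S.erase k) (A.updateRow k v) Y).det := by
  rw [← updateRow_rowPerturb, ← updateRow_rowPerturb, Matrix.det_updateRow_smul]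

lemma rowPerturb_eq_updateRow {S : Finset n} {m : n} (hm : m ∈ S) (A Y : Matrix n n ℂ) :
    rowPerturb S A Y = (rowPerturb (S.erase m) A Y).updateRow m (A m + Y m) := by
  ext i j
  by_cases h : i = m
  · subst h
    simp [rowPerturb, hm]
  · simp [rowPerturb, h]

lemma det_updateRow_eq_sum (M : Matrix n n ℂ) (m : n) (v : n → ℂ) :
    (M.updateRow m v).det = ∑ j, v j * (M.updateRow m (Pi.single j 1)).det := by
  simp only [← Matrix.cramer_transpose_apply]
  have h := LinearMap.pi_apply_eq_sum_univ ((LinearMap.proj m).comp (Matrix.cramer M.transpose)) v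
  simp only [LinearMap.comp_apply, LinearMap.proj_apply, smul_eq_mul] at h
  rw [h]
  refine Finset.sum_congr rfl fun j _ => ?_
  rw [show (fun i => if j = i then (1 : ℂ) else 0) = Pi.single j 1 from by
    ext k
    simp [Pi.single_apply, eq_comm]]

/-- Multilinearity in row `m` pulls one random entry out of the determinant; the cofactors are
random only in the rows `S.erase m`, which makes induction on `S` possible. -/
lemma det_rowPerturb_of_mem {S : Finset n} {m : n} (hm : m ∈ S) (A Y : Matrix n n ℂ) :
    (rowPerturb S A Y).det = (rowPerturb (S.erase m) A Y).det +
      ∑ j, Y m j * (rowPerturb (S.erase m) (A.updateRow m (Pi.single j 1)) Y).det := by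
  rw [rowPerturb_eq_updateRow hm, Matrix.det_updateRow_add]
  congr 1
  · rw [updateRow_rowPerturb, Matrix.updateRow_eq_self, Finset.erase_idem]
  · rw [det_updateRow_eq_sum]
    refine Finset.sum_congr rfl fun j _ => ?_
    rw [updateRow_rowPerturb, Finset.erase_idem]

lemma det_updateRow_swap (M : Matrix n n ℂ) {m j : n} (h : m ≠ j) (u w : n → ℂ) :
    ((M.updateRow m u).updateRow j w).det = -((M.updateRow m w).updateRow j u).det := by
  have := (Matrix.detRowAlternating (n := n) (R := ℂ)).map_swap
    ((M.updateRow m w).updateRow j u) h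
  refine Eq.trans ?_ this
  change _ = Matrix.det _
  congr 1
  ext i l
  change _ = ((M.updateRow m w).updateRow j u) (Equiv.swap m j i) l
  rcases eq_or_ne i m with rfl | him
  · simp [Matrix.updateRow_ne h]
  · rcases eq_or_ne i j with rfl | hij
    · simp [Matrix.updateRow_ne h]
    · simp [Equiv.swap_apply_of_ne_of_ne him hij, Matrix.updateRow_ne, him, hij]

lemma det_eq_sum_prod_row (M : Matrix n n ℂ) :
    M.det = ∑ σ : Equiv.Perm n, ((Equiv.Perm.sign σ : ℤ) : ℂ) * ∏ i, M i (σ i) := by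
  rw [← Matrix.det_transpose, Matrix.det_apply']
  rfl

lemma det_updateRow_eq_sum_prod (M : Matrix n n ℂ) (k : n) (v : n → ℂ) :
    (M.updateRow k v).det = ∑ σ : Equiv.Perm n, ((Equiv.Perm.sign σ : ℤ) : ℂ) *
      (v (σ k) * ∏ i ∈ Finset.univ.erase k, M i (σ i)) := by
  rw [det_eq_sum_prod_row]
  refine Finset.sum_congr rfl fun σ _ => ?_
  rw [← Finset.mul_prod_erase _ _ (Finset.mem_univ k), Matrix.updateRow_self]
  congr 2
  refine Finset.prod_congr rfl fun i hi => ?_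
  rw [Matrix.updateRow_ne (Finset.ne_of_mem_erase hi)]

variable {V : Type*} [NormedAddCommGroup V] [NormedSpace ℝ V]
  [MeasurableSpace V] [BorelSpace V] [CompleteSpace V] [SecondCountableTopology V]

/-- Each Leibniz term is a product of affine functions, so integration by parts applies to it.
Contracting `W` with the factor from row `k` and summing over permutations gives a determinant
again, with row `k` replaced by a vector of covariances. -/
lemma integral_mul_det_mul_cexp (ν : Measure V) [IsGaussian ν]
    (h0 : ∀ L : V →L[ℝ] ℝ, ∫ x, L x ∂ν = 0) (P : V → Matrix n n ℂ) (B : Matrix n n ℂ)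
    (X : n → n → V →L[ℝ] ℂ) (hP : ∀ x i j, P x i j = B i j + X i j x)
    (W : V →L[ℝ] ℂ) (L : V →L[ℝ] ℝ) :
    ∫ x, W x * ((P x).det * Complex.exp (Complex.I * (L x : ℂ))) ∂ν =
      ∑ k, ∫ x, ((P x).updateRow k fun l => ∫ y, W y * X k l y ∂ν).det *
          Complex.exp (Complex.I * (L x : ℂ)) ∂ν
        + Complex.I * (∫ x, W x * (L x : ℂ) ∂ν) *
          ∫ x, (P x).det * Complex.exp (Complex.I * (L x : ℂ)) ∂ν := by
  have hT : ∀ (σ : Equiv.Perm n) (T : Finset n), HasPolyGrowth (fun x : V =>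
      (∏ i ∈ T, (B i (σ i) + X i (σ i) x)) * Complex.exp (Complex.I * (L x : ℂ))) := fun σ T =>
    (HasPolyGrowth.affineProd T (fun i => B i (σ i)) (fun i => X i (σ i))).mul
      (HasPolyGrowth.cexp L)
  have hW := HasPolyGrowth.clm W
  have h1 : ∫ x, W x * ((P x).det * Complex.exp (Complex.I * (L x : ℂ))) ∂ν =
      ∑ σ : Equiv.Perm n, ((Equiv.Perm.sign σ : ℤ) : ℂ) *
        ∫ x, W x * ((∏ i, (B i (σ i) + X i (σ i) x)) *
          Complex.exp (Complex.I * (L x : ℂ))) ∂ν := by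
    simp_rw [← integral_const_mul]
    rw [← integral_finsetSum _ fun σ _ =>
      ((HasPolyGrowth.const _).mul (hW.mul (hT σ _))).integrable ν]
    refine integral_congr_ae (Filter.Eventually.of_forall fun x => ?_)
    simp only [det_eq_sum_prod_row, hP, Finset.sum_mul, Finset.mul_sum]
    exact Finset.sum_congr rfl fun σ _ => by ring
  have h2 : ∫ x, (P x).det * Complex.exp (Complex.I * (L x : ℂ)) ∂ν =
      ∑ σ : Equiv.Perm n, ((Equiv.Perm.sign σ : ℤ) : ℂ) *
        ∫ x, ((∏ i, (B i (σ i) + X i (σ i) x)) *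
          Complex.exp (Complex.I * (L x : ℂ))) ∂ν := by
    simp_rw [← integral_const_mul]
    rw [← integral_finsetSum _ fun σ _ => ((HasPolyGrowth.const _).mul (hT σ _)).integrable ν]
    refine integral_congr_ae (Filter.Eventually.of_forall fun x => ?_)
    simp only [det_eq_sum_prod_row, hP, Finset.sum_mul]
    exact Finset.sum_congr rfl fun σ _ => by ring
  have h3 : ∀ k, ∫ x, ((P x).updateRow k fun l => ∫ y, W y * X k l y ∂ν).det *
          Complex.exp (Complex.I * (L x : ℂ)) ∂ν =
      ∑ σ : Equiv.Perm n, ((Equiv.Perm.sign σ : ℤ) : ℂ) * ((∫ y, W y * X k (σ k) y ∂ν) *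
        ∫ x, ((∏ i ∈ Finset.univ.erase k, (B i (σ i) + X i (σ i) x)) *
          Complex.exp (Complex.I * (L x : ℂ))) ∂ν) := by
    intro k
    simp_rw [← integral_const_mul]
    rw [← integral_finsetSum _ fun σ _ => ((HasPolyGrowth.const _).mul
      ((HasPolyGrowth.const _).mul (hT σ _))).integrable ν]
    refine integral_congr_ae (Filter.Eventually.of_forall fun x => ?_)
    simp only [det_updateRow_eq_sum_prod, hP, Finset.sum_mul]
    exact Finset.sum_congr rfl fun σ _ => by ring
  rw [h1, h2]
  simp_rw [h3]
  rw [Finset.sum_comm, Finset.mul_sum, ← Finset.sum_add_distrib]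
  refine Finset.sum_congr rfl fun σ _ => ?_
  rw [integral_mul_prod_mul_cexp ν h0 (fun i => B i (σ i)) (fun i => X i (σ i)), ← Finset.mul_sum]
  ring

lemma HasPolyGrowth.det_rowPerturb (S : Finset n) (A : Matrix n n ℂ) {Y : V → Matrix n n ℂ}
    (hY : ∀ i j, HasPolyGrowth fun x => Y x i j) :
    HasPolyGrowth fun x => (rowPerturb S A (Y x)).det := by
  refine HasPolyGrowth.det fun i j => ?_
  by_cases h : i ∈ S
  · simpa [rowPerturb, h] using (HasPolyGrowth.const (A i j)).add (hY i j)
  · simpa [rowPerturb, h] using HasPolyGrowth.const (V := V) (A i j)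

lemma integral_clm_gaussianReal (v : NNReal) (L : ℝ →L[ℝ] ℝ) :
    ∫ x, L x ∂(gaussianReal 0 v) = 0 := by
  have : (fun x => L x) = fun x => x * L 1 := by
    ext x
    rw [← smul_eq_mul, ← map_smul, smul_eq_mul, mul_one]
  rw [this, integral_mul_const, integral_id_gaussianReal, zero_mul]

lemma integral_mul_self_gaussianReal (v : NNReal) :
    ∫ g : ℝ, (g : ℂ) * (g : ℂ) ∂(gaussianReal 0 v) = (v : ℂ) := by
  have h := variance_of_integral_eq_zero (μ := gaussianReal 0 v) (X := fun x => x)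
    (by fun_prop) (by simp)
  rw [variance_fun_id_gaussianReal] at h
  have : ((v : ℝ) : ℂ) = ((∫ g : ℝ, g ^ 2 ∂(gaussianReal 0 v) : ℝ) : ℂ) := by rw [h]
  refine Eq.trans ?_ this.symm
  rw [← integral_complex_ofReal]
  simp [sq]

lemma hasPolyGrowth_add_smul_one (K : Matrix n n ℂ) (i j : n) :
    HasPolyGrowth fun g : ℝ => (K + (g : ℂ) • (1 : Matrix n n ℂ)) i j := by
  simp only [Matrix.add_apply, Matrix.smul_apply, smul_eq_mul]
  exact (HasPolyGrowth.const _).add ((HasPolyGrowth.clm Complex.ofRealCLM).mul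
    (HasPolyGrowth.const _))

/-- Integration by parts in a random row, for a matrix with jointly Gaussian perturbation. -/
lemma integral_mul_det_rowPerturb (ν : Measure V) [IsGaussian ν]
    (h0 : ∀ L : V →L[ℝ] ℝ, ∫ x, L x ∂ν = 0) (X : n → n → V →L[ℝ] ℂ)
    (K : Matrix n n ℂ) (W : V →L[ℝ] ℂ) (L : V →L[ℝ] ℝ) (S : Finset n) (A : Matrix n n ℂ) :
    ∫ x, W x * ((rowPerturb S A (K + Matrix.of fun i j => X i j x)).det *
        Complex.exp (Complex.I * (L x : ℂ))) ∂ν =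
      ∑ k ∈ S, ∫ x, (rowPerturb (S.erase k) (A.updateRow k fun l => ∫ y, W y * X k l y ∂ν)
          (K + Matrix.of fun i j => X i j x)).det * Complex.exp (Complex.I * (L x : ℂ)) ∂ν
        + Complex.I * (∫ x, W x * (L x : ℂ) ∂ν) *
          ∫ x, (rowPerturb S A (K + Matrix.of fun i j => X i j x)).det *
            Complex.exp (Complex.I * (L x : ℂ)) ∂ν := by
  rw [integral_mul_det_mul_cexp ν h0 (fun x => rowPerturb S A (K + Matrix.of fun i j => X i j x))
    (rowPerturb S A K) (fun i j => if i ∈ S then X i j else 0)]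
  · congr 1
    rw [← Finset.sum_subset (Finset.subset_univ S)]
    · refine Finset.sum_congr rfl fun k hk => ?_
      simp only [hk, if_true, updateRow_rowPerturb]
    · intro k _ hk
      simp only [hk, if_false]
      refine (integral_congr_ae (Filter.Eventually.of_forall fun x => ?_)).trans
        (integral_zero V ℂ)
      simp only [zero_apply, mul_zero, integral_zero]
      rw [Matrix.det_eq_zero_of_row_eq_zero k (fun j => by simp), zero_mul]
  · intro x i j
    by_cases h : i ∈ S
    · simp [rowPerturb, h, add_assoc]
    · simp [rowPerturb, h]

/-- The Gaussian average of a determinant against a character: the matrix may be replaced by a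
random multiple of the identity. -/
theorem integral_det_rowPerturb (ν : Measure V) [IsGaussian ν]
    (h0 : ∀ L : V →L[ℝ] ℝ, ∫ x, L x ∂ν = 0) (X : n → n → V →L[ℝ] ℂ) (v : NNReal)
    (hcov : ∀ i j k l, i ≠ k → ∫ x, X i j x * X k l x ∂ν =
      if j = k ∧ i = l then -(v : ℂ) else 0)
    (L : V →L[ℝ] ℝ) (K : Matrix n n ℂ)
    (hK : ∀ i j, Complex.I * ∫ x, X i j x * (L x : ℂ) ∂ν = K i j)
    (S : Finset n) : ∀ A : Matrix n n ℂ,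
    ∫ x, (rowPerturb S A (Matrix.of fun i j => X i j x)).det *
        Complex.exp (Complex.I * (L x : ℂ)) ∂ν =
      (∫ x, Complex.exp (Complex.I * (L x : ℂ)) ∂ν) *
        ∫ g : ℝ, (rowPerturb S A (K + (g : ℂ) • 1)).det ∂(gaussianReal 0 v) := by
  induction S using Finset.strongInduction with
  | H S ih =>
  intro A
  rcases S.eq_empty_or_nonempty with rfl | ⟨m, hm⟩
  · simp only [rowPerturb_empty, integral_const_mul]
    simp [mul_comm]
  -- Both sides are expanded along one random row `m` of `S` and integrated by parts, leaving
  -- determinants with fewer random rows. The terms agree except that the two rows involved in a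
  -- contraction are exchanged.
  set Z := ∫ x, Complex.exp (Complex.I * (L x : ℂ)) ∂ν with hZ
  set G : Finset n → Matrix n n ℂ → ℂ := fun S A =>
    ∫ g : ℝ, (rowPerturb S A (K + (g : ℂ) • 1)).det ∂(gaussianReal 0 v) with hG
  set S' := S.erase m with hS'
  have hss : S' ⊂ S := Finset.erase_ssubset hm
  have hmS' : m ∉ S' := Finset.notMem_erase m S
  let e : n → n → ℂ := fun j => Pi.single j 1
  have hpg : ∀ S A, HasPolyGrowth fun x => (rowPerturb S A (Matrix.of fun i j => X i j x)).det *
        Complex.exp (Complex.I * (L x : ℂ)) := fun S A =>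
    (HasPolyGrowth.det_rowPerturb S A fun i j => HasPolyGrowth.clm (X i j)).mul
      (HasPolyGrowth.cexp L)
  have hpgg : ∀ S A, HasPolyGrowth fun g : ℝ => (rowPerturb S A (K + (g : ℂ) • 1)).det :=
    fun S A => HasPolyGrowth.det_rowPerturb S A (hasPolyGrowth_add_smul_one K)
  have hL : ∫ x, (rowPerturb S A (Matrix.of fun i j => X i j x)).det *
        Complex.exp (Complex.I * (L x : ℂ)) ∂ν =
      Z * G S' A + ∑ j, ((∑ k ∈ S', if j = k then
        -(v : ℂ) * (Z * G (S'.erase k) ((A.updateRow m (e k)).updateRow k (e m))) else 0) +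
        K m j * (Z * G S' (A.updateRow m (e j)))) := by
    have h1 : ∫ x, (rowPerturb S A (Matrix.of fun i j => X i j x)).det *
        Complex.exp (Complex.I * (L x : ℂ)) ∂ν =
        ∫ x, (rowPerturb S' A (Matrix.of fun i j => X i j x)).det *
          Complex.exp (Complex.I * (L x : ℂ)) ∂ν +
        ∑ j, ∫ x, X m j x * ((rowPerturb S' (A.updateRow m (e j))
          (Matrix.of fun i j => X i j x)).det * Complex.exp (Complex.I * (L x : ℂ))) ∂ν := by
      rw [← integral_finsetSum _ fun j _ =>
          ((HasPolyGrowth.clm (X m j)).mul (hpg _ _)).integrable ν,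
        ← integral_add ((hpg _ _).integrable ν) ((HasPolyGrowth.sum _ fun j _ =>
          (HasPolyGrowth.clm (X m j)).mul (hpg _ _)).integrable ν)]
      refine integral_congr_ae (Filter.Eventually.of_forall fun x => ?_)
      simp only [det_rowPerturb_of_mem hm, add_mul, Finset.sum_mul, Matrix.of_apply, mul_assoc]
      rfl
    rw [h1, ih S' hss A]
    congr 1
    refine Finset.sum_congr rfl fun j _ => ?_
    have h2 := integral_mul_det_rowPerturb ν h0 X 0 (X m j) L S' (A.updateRow m (e j))
    simp only [zero_add] at h2
    rw [h2, hK, ih S' hss]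
    congr 1
    refine Finset.sum_congr rfl fun k hk => ?_
    have hmk : m ≠ k := fun h => hmS' (h ▸ hk)
    have hrow : (fun l => ∫ y, X m j y * X k l y ∂ν) = (if j = k then -(v : ℂ) else 0) • e m := by
      ext l
      rw [hcov m j k l hmk]
      by_cases h1 : j = k <;> by_cases h2 : m = l <;>
        simp [e, h1, h2, eq_comm]
    have h3 : ∀ x, (rowPerturb (S'.erase k) ((A.updateRow m (e j)).updateRow k
        ((if j = k then -(v : ℂ) else 0) • e m)) (Matrix.of fun i j => X i j x)).det =
        (if j = k then -(v : ℂ) else 0) * (rowPerturb (S'.erase k) ((A.updateRow m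
          (e j)).updateRow k (e m)) (Matrix.of fun i j => X i j x)).det := by
      intro x
      rw [det_rowPerturb_updateRow_smul]
    simp only [hrow, h3, mul_assoc]
    rw [integral_const_mul, ih (S'.erase k) ((Finset.erase_subset k S').trans_ssubset hss)]
    split_ifs with hjk
    · rw [hjk]
    · simp
  have hR : G S A = G S' A + (∑ j, K m j * G S' (A.updateRow m (e j)) +
      ∑ k ∈ S', (v : ℂ) * G (S'.erase k) ((A.updateRow m (e m)).updateRow k (e k))) := by
    have h1 : G S A = G S' A + (∑ j, K m j * G S' (A.updateRow m (e j)) +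
        ∫ g : ℝ, (g : ℂ) * (rowPerturb S' (A.updateRow m (e m))
          (K + (g : ℂ) • 1)).det ∂(gaussianReal 0 v)) := by
      simp only [hG, ← integral_const_mul]
      have hg1 : HasPolyGrowth fun g : ℝ => (g : ℂ) * (rowPerturb S' (A.updateRow m (e m))
          (K + (g : ℂ) • 1)).det := (HasPolyGrowth.clm Complex.ofRealCLM).mul (hpgg _ _)
      have hg2 : ∀ j ∈ Finset.univ, HasPolyGrowth fun g : ℝ => K m j * (rowPerturb S'
          (A.updateRow m (e j)) (K + (g : ℂ) • 1)).det := fun j _ =>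
        (HasPolyGrowth.const _).mul (hpgg _ _)
      rw [← integral_finsetSum _ fun j hj => (hg2 j hj).integrable _,
        ← integral_add ((HasPolyGrowth.sum _ hg2).integrable _) (hg1.integrable _),
        ← integral_add ((hpgg _ _).integrable _)
          (((HasPolyGrowth.sum _ hg2).add hg1).integrable _)]
      refine integral_congr_ae (Filter.Eventually.of_forall fun g => ?_)
      simp only [det_rowPerturb_of_mem hm, Matrix.add_apply, Matrix.smul_apply, smul_eq_mul,
        add_mul, Finset.sum_add_distrib, Matrix.one_apply, mul_ite, mul_one, mul_zero, ite_mul,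
        zero_mul, Finset.sum_ite_eq, Finset.mem_univ, if_true]
      rfl
    rw [h1]
    congr 2
    have h2 := integral_mul_det_rowPerturb (gaussianReal 0 v) (integral_clm_gaussianReal v)
      (fun i j => (1 : Matrix n n ℂ) i j • Complex.ofRealCLM) K Complex.ofRealCLM 0 S'
      (A.updateRow m (e m))
    have h3 : ∀ g : ℝ, (Matrix.of fun i j => ((1 : Matrix n n ℂ) i j • Complex.ofRealCLM) g) =
        (g : ℂ) • (1 : Matrix n n ℂ) := by
      intro g
      ext i j
      simp [mul_comm]
    simp only [h3, zero_apply, Complex.ofReal_zero, mul_zero, Complex.exp_zero, mul_one,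
      integral_zero, zero_mul, add_zero, Complex.ofRealCLM_apply] at h2
    rw [h2]
    refine Finset.sum_congr rfl fun k hk => ?_
    have hrow : (fun l => ∫ y : ℝ, (y : ℂ) * ((1 : Matrix n n ℂ) k l • Complex.ofRealCLM) y
        ∂(gaussianReal 0 v)) = (v : ℂ) • e k := by
      ext l
      simp only [smul_apply, Complex.ofRealCLM_apply, smul_eq_mul]
      rw [show (fun y : ℝ => (y : ℂ) * ((1 : Matrix n n ℂ) k l * (y : ℂ))) =
          fun y : ℝ => (1 : Matrix n n ℂ) k l * ((y : ℂ) * (y : ℂ)) from by ext y; ring,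
        integral_const_mul, integral_mul_self_gaussianReal]
      simp [e, Pi.single_apply, Matrix.one_apply, mul_comm, eq_comm]
    simp only [hrow, hG]
    rw [← integral_const_mul]
    refine integral_congr_ae (Filter.Eventually.of_forall fun g => ?_)
    simp only
    rw [det_rowPerturb_updateRow_smul]
  rw [hL]
  change _ = Z * G S A
  rw [hR, Finset.sum_add_distrib, Finset.sum_comm]
  -- The matrix contraction puts `e k`, `e m` into rows `m`, `k`, while the scalar matrix puts `e
  -- m`, `e k`. The sign of this exchange absorbs the minus sign in the covariance `-v`.
  have hswap : ∀ k ∈ S', G (S'.erase k) ((A.updateRow m (e k)).updateRow k (e m)) =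
      -G (S'.erase k) ((A.updateRow m (e m)).updateRow k (e k)) := by
    intro k hk
    have hmk : m ≠ k := fun h => hmS' (h ▸ hk)
    simp only [hG]
    rw [← integral_neg]
    refine integral_congr_ae (Filter.Eventually.of_forall fun g => ?_)
    simp only
    have : ∀ u w, rowPerturb (S'.erase k) ((A.updateRow m u).updateRow k w) (K + (g : ℂ) • 1) =
        ((rowPerturb S' A (K + (g : ℂ) • 1)).updateRow m u).updateRow k w := by
      intro u w
      rw [updateRow_rowPerturb, updateRow_rowPerturb, Finset.erase_eq_of_notMem hmS']
    rw [this, this, det_updateRow_swap _ hmk]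
  simp only [Finset.sum_ite_eq', Finset.mem_univ, if_true]
  rw [Finset.sum_congr rfl fun k hk => by rw [hswap k hk]]
  simp only [mul_add, Finset.mul_sum]
  rw [add_comm (∑ k ∈ S', _)]
  refine congrArg₂ _ rfl (congrArg₂ _ ?_ ?_) <;>
    exact Finset.sum_congr rfl fun k _ => by ring

end DetAverage

/-! ### Rank-two perturbations of a scalar matrix. -/

section RankTwo

/-- The determinant of a rank-two perturbation of a multiple of the identity. -/
lemma det_smul_one_add_vecMulVec_add {n : Type*} [Fintype n] [DecidableEq n]
    (hn : 2 ≤ Fintype.card n) (w : ℂ) (a b c d : n → ℂ) :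
    (w • (1 : Matrix n n ℂ) + Matrix.vecMulVec a b + Matrix.vecMulVec c d).det =
      w ^ (Fintype.card n - 2) * ((w + b ⬝ᵥ a) * (w + d ⬝ᵥ c) - (b ⬝ᵥ c) * (d ⬝ᵥ a)) := by
  let U : Matrix n (Fin 2) ℂ := Matrix.of fun i => ![-a i, -c i]
  let W : Matrix (Fin 2) n ℂ := Matrix.of ![b, d]
  -- The characteristic polynomials of `U * W` and of the 2 × 2 matrix `W * U` differ by a power of
  -- the variable. The signs in `U` turn the sum into `w - U * W`.
  have h := congrArg (Polynomial.eval w)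
    (Matrix.charpoly_mul_comm_of_le U W (by simpa using hn))
  rw [Matrix.eval_charpoly, Polynomial.eval_mul, Matrix.eval_charpoly, Matrix.det_fin_two] at h
  have h1 : w • (1 : Matrix n n ℂ) + Matrix.vecMulVec a b + Matrix.vecMulVec c d =
      Matrix.scalar n w - U * W := by
    ext i j
    simp [U, W, Matrix.mul_apply, Matrix.vecMulVec_apply, Matrix.smul_one_eq_diagonal]
    ring
  rw [h1, h]
  simp [U, W, Matrix.vecMul, dotProduct]

end RankTwo

/-! ### Moments of a shifted Gaussian variable. -/

section GaussianPowers

/-- The moments `∫ (c + g) ^ m` of a shifted centred Gaussian variable of variance `v`. -/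
noncomputable def shiftedMoment (v : NNReal) (c : ℂ) (m : ℕ) : ℂ :=
  ∫ g : ℝ, (c + (g : ℂ)) ^ m ∂(gaussianReal 0 v)

lemma hasPolyGrowth_shift_pow (c : ℂ) (m : ℕ) :
    HasPolyGrowth fun g : ℝ => (c + (g : ℂ)) ^ m := by
  simpa using HasPolyGrowth.affineProd (Finset.range m) (fun _ => c) (fun _ => Complex.ofRealCLM)

lemma shiftedMoment_zero (v : NNReal) (c : ℂ) : shiftedMoment v c 0 = 1 := by
  simp [shiftedMoment]

lemma integral_mul_shift_pow (v : NNReal) (c : ℂ) (m : ℕ) :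
    ∫ g : ℝ, (g : ℂ) * (c + (g : ℂ)) ^ m ∂(gaussianReal 0 v) =
      m * v * shiftedMoment v c (m - 1) := by
  have h := integral_mul_prod_mul_cexp (gaussianReal 0 v) (integral_clm_gaussianReal v)
    (fun _ => c) (fun _ => Complex.ofRealCLM) (Finset.range m) Complex.ofRealCLM 0
  simp only [Complex.ofRealCLM_apply, Finset.prod_const, Finset.card_range, zero_apply,
    Complex.ofReal_zero, mul_zero, Complex.exp_zero, mul_one, integral_zero, zero_mul, add_zero,
    integral_mul_self_gaussianReal] at h
  rw [h, Finset.sum_congr rfl fun k hk => by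
    rw [Finset.card_erase_of_mem hk, Finset.card_range]]
  simp [shiftedMoment, mul_assoc]

/-- The Hermite three-term recurrence: split off one factor `c + g` and integrate the `g` part by
parts. For `m = 0` the truncated index `m - 1` is harmless because its coefficient vanishes. -/
lemma shiftedMoment_succ (v : NNReal) (c : ℂ) (m : ℕ) :
    shiftedMoment v c (m + 1) = c * shiftedMoment v c m + m * v * shiftedMoment v c (m - 1) := by
  have h1 : HasPolyGrowth fun g : ℝ => (g : ℂ) * (c + (g : ℂ)) ^ m :=
    (HasPolyGrowth.clm Complex.ofRealCLM).mul (hasPolyGrowth_shift_pow c m)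
  rw [← integral_mul_shift_pow, shiftedMoment, shiftedMoment, ← integral_const_mul,
    ← integral_add (((HasPolyGrowth.const _).mul (hasPolyGrowth_shift_pow c m)).integrable _)
      (h1.integrable _)]
  refine integral_congr_ae (Filter.Eventually.of_forall fun g => ?_)
  simp only
  ring

end GaussianPowers

/-! ### Cauchy's theorem and a residue formula for contours about zero. -/

namespace IsContourAboutZero

variable {γ : ℝ → ℂ}

lemma intervalIntegrable (hγ : IsContourAboutZero γ) {f : ℂ → ℂ} (hf : ContinuousOn f {0}ᶜ) :
    IntervalIntegrable (fun u => f (γ u) * deriv γ u) volume 0 1 := by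
  refine hγ.integrable_deriv.continuousOn_mul ?_
  rw [Set.uIcc_of_le zero_le_one]
  exact hf.comp hγ.continuousOn fun u hu => hγ.ne_zero u hu

lemma integral_eq_zero_of_hasDerivAt (hγ : IsContourAboutZero γ) {f F : ℂ → ℂ} (hf : ContinuousOn f {0}ᶜ)
    (hF : ∀ z, z ≠ 0 → HasDerivAt F (f z) z) :
    ∫ u in (0 : ℝ)..1, f (γ u) * deriv γ u = 0 := by
  obtain ⟨P, hP⟩ := hγ.differentiable
  rw [integral_eq_of_hasDerivAt_off_countable_of_le (fun u => F (γ u)) _ zero_le_one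
    P.finite_toSet.countable]
  · simp [hγ.closed]
  · exact ContinuousOn.comp (t := {0}ᶜ)
      (fun z hz => (hF z hz).continuousAt.continuousWithinAt) hγ.continuousOn
      fun u hu => hγ.ne_zero u hu
  · intro u hu
    exact (hF _ (hγ.ne_zero u (Set.Ioo_subset_Icc_self hu.1))).comp u
      (hP u hu.1 (by simpa using hu.2)).hasDerivAt
  · exact hγ.intervalIntegrable hf

lemma integral_eq_zero_of_differentiable (hγ : IsContourAboutZero γ) {f : ℂ → ℂ} (hf : Differentiable ℂ f) :
    ∫ u in (0 : ℝ)..1, f (γ u) * deriv γ u = 0 := by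
  obtain ⟨F, hF⟩ := hf.isExactOn_univ
  exact hγ.integral_eq_zero_of_hasDerivAt hf.continuous.continuousOn fun z _ => hF z trivial

/-- The quotient `f z / z` is the entire function `dslope f 0` plus `f 0 / z`. The first part has a
primitive, and the second is the winding number integral. -/
lemma integral_div_eq (hγ : IsContourAboutZero γ) {f : ℂ → ℂ} (hf : Differentiable ℂ f) :
    ∫ u in (0 : ℝ)..1, f (γ u) / γ u * deriv γ u = 2 * Real.pi * Complex.I * f 0 := by
  have hd : Differentiable ℂ (dslope f 0) := by
    rw [← differentiableOn_univ, Complex.differentiableOn_dslope Filter.univ_mem]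
    exact hf.differentiableOn
  have hw : ∫ u in (0 : ℝ)..1, deriv γ u / γ u = 2 * Real.pi * Complex.I := by
    have h := hγ.winding
    have h2 : (2 * (Real.pi : ℂ) * Complex.I) ≠ 0 := by
      simp [Real.pi_ne_zero]
    field_simp at h
    linear_combination h
  have h1 : ∫ u in (0 : ℝ)..1, f (γ u) / γ u * deriv γ u =
      ∫ u in (0 : ℝ)..1, (dslope f 0 (γ u) * deriv γ u + f 0 * (deriv γ u / γ u)) := by
    refine intervalIntegral.integral_congr fun u hu => ?_
    rw [Set.uIcc_of_le zero_le_one] at hu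
    have h0 := hγ.ne_zero u hu
    rw [dslope_of_ne _ h0, slope_def_field]
    field_simp
    ring
  rw [h1, intervalIntegral.integral_add (hγ.intervalIntegrable hd.continuous.continuousOn),
    hγ.integral_eq_zero_of_differentiable hd, intervalIntegral.integral_const_mul, hw]
  · ring
  · refine IntervalIntegrable.const_mul ?_ _
    have := hγ.intervalIntegrable (f := fun z => z⁻¹) (continuousOn_inv₀)
    simpa [div_eq_mul_inv, mul_comm] using this

end IsContourAboutZero

/-! ### Contour integrals as Gaussian moments. -/

section ContourMoments

/-- The entire function `exp (-N (c z - z² / 2))`. -/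
noncomputable def contourWeight (N : ℕ) (c z : ℂ) : ℂ :=
  Complex.exp (-(N : ℂ) * (c * z - (1 / 2) * z ^ 2))

lemma hasDerivAt_contourWeight (N : ℕ) (c z : ℂ) :
    HasDerivAt (contourWeight N c) (N * (z - c) * contourWeight N c z) z := by
  have := ((((hasDerivAt_id z).const_mul c).sub
    (((hasDerivAt_id z).pow 2).const_mul (1 / 2))).const_mul (-(N : ℂ))).cexp
  refine this.congr_deriv ?_
  simp [contourWeight]
  ring

lemma differentiable_contourWeight (N : ℕ) (c : ℂ) : Differentiable ℂ (contourWeight N c) :=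
  fun z => (hasDerivAt_contourWeight N c z).differentiableAt

variable {γ : ℝ → ℂ}

/-- The contour integral of `P(z) exp (-N (c z - z² / 2)) / z ^ k`. -/
noncomputable def contourMoment (γ : ℝ → ℂ) (N : ℕ) (c : ℂ) (P : ℂ → ℂ) (k : ℕ) : ℂ :=
  ∫ u in (0 : ℝ)..1, P (γ u) * contourWeight N c (γ u) / (γ u) ^ k * deriv γ u

lemma continuousOn_contourMoment (N : ℕ) (c : ℂ) {P : ℂ → ℂ} (hP : Continuous P) (k : ℕ) :
    ContinuousOn (fun z => P z * contourWeight N c z / z ^ k) {0}ᶜ :=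
  (hP.mul (differentiable_contourWeight N c).continuous).continuousOn.div
    (continuous_pow k).continuousOn fun _ hz => pow_ne_zero k hz

lemma contourMoment_add (hγ : IsContourAboutZero γ) (N : ℕ) (c : ℂ) {P Q : ℂ → ℂ} (hP : Continuous P) (hQ : Continuous Q)
    (k : ℕ) : contourMoment γ N c (fun z => P z + Q z) k =
      contourMoment γ N c P k + contourMoment γ N c Q k := by
  rw [contourMoment, contourMoment, contourMoment, ← intervalIntegral.integral_add
    (hγ.intervalIntegrable (continuousOn_contourMoment N c hP k))
    (hγ.intervalIntegrable (continuousOn_contourMoment N c hQ k))]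
  exact intervalIntegral.integral_congr fun u _ => by ring

lemma contourMoment_const_mul (N : ℕ) (c a : ℂ) (P : ℂ → ℂ) (k : ℕ) :
    contourMoment γ N c (fun z => a * P z) k = a * contourMoment γ N c P k := by
  rw [contourMoment, contourMoment, ← intervalIntegral.integral_const_mul]
  exact intervalIntegral.integral_congr fun u _ => by ring

lemma contourMoment_one (hγ : IsContourAboutZero γ) (N : ℕ) (c : ℂ) :
    contourMoment γ N c (fun _ => 1) 1 = 2 * Real.pi * Complex.I := by
  have := hγ.integral_div_eq (differentiable_contourWeight N c)
  simpa [contourMoment, contourWeight] using this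

lemma contourMoment_zero (hγ : IsContourAboutZero γ) (N : ℕ) (c : ℂ) : contourMoment γ N c (fun _ => 1) 0 = 0 := by
  have := hγ.integral_eq_zero_of_differentiable (differentiable_contourWeight N c)
  simpa [contourMoment] using this

/-- Integration by parts along the contour. -/
lemma contourMoment_by_parts (hγ : IsContourAboutZero γ) (N : ℕ) (c : ℂ) {P P' : ℂ → ℂ} (hP : ∀ z, HasDerivAt P (P' z) z)
    (hP' : Continuous P') (p : ℕ) :
    N * contourMoment γ N c (fun z => (z - c) * P z) p + contourMoment γ N c P' p =
      p * contourMoment γ N c P (p + 1) := by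
  have hPc : Continuous P := continuous_iff_continuousAt.2 fun z => (hP z).continuousAt
  have h1 := hγ.intervalIntegrable (continuousOn_contourMoment N c
    (P := fun z => (z - c) * P z) (by fun_prop) p)
  have h2 := hγ.intervalIntegrable (continuousOn_contourMoment N c hP' p)
  have h3 := hγ.intervalIntegrable (continuousOn_contourMoment N c hPc (p + 1))
  rw [← sub_eq_zero, contourMoment, contourMoment, contourMoment,
    ← intervalIntegral.integral_const_mul, ← intervalIntegral.integral_const_mul,
    ← intervalIntegral.integral_add (h1.const_mul _) h2,
    ← intervalIntegral.integral_sub ((h1.const_mul _).add h2) (h3.const_mul _)]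
  have key := hγ.integral_eq_zero_of_hasDerivAt
    (F := fun z => P z * contourWeight N c z / z ^ p)
    (f := fun z => N * ((z - c) * P z * contourWeight N c z / z ^ p)
      + P' z * contourWeight N c z / z ^ p - p * (P z * contourWeight N c z / z ^ (p + 1)))
    ((((continuousOn_contourMoment N c (P := fun z => (z - c) * P z) (by fun_prop)
      p).const_smul (N : ℂ)).add (continuousOn_contourMoment N c hP' p)).sub
      ((continuousOn_contourMoment N c hPc (p + 1)).const_smul (p : ℂ))) (by
    intro z hz
    have := ((hP z).mul (hasDerivAt_contourWeight N c z)).div (hasDerivAt_pow p z)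
      (pow_ne_zero p hz)
    refine this.congr_deriv ?_
    -- The derivative of `z ^ p` contains the truncated exponent `p - 1`, so `p = 0` is separate.
    rcases p with _ | p
    · simp
      ring
    · simp only [Nat.add_sub_cancel, Pi.mul_apply]
      field_simp
      push_cast
      ring)
  rw [← key]
  exact intervalIntegral.integral_congr fun u _ => by ring

/-- Integration by parts with constant `P` gives the Hermite recurrence, up to the normalization
`(-N)^m / m!`. The initial data come from the residue at pole order one and from the vanishing of
the integral of an entire function at pole order zero. -/
lemma contourMoment_eq (hγ : IsContourAboutZero γ) {N : ℕ} (hN : N ≠ 0) (c : ℂ) (m : ℕ) :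
    contourMoment γ N c (fun _ => 1) (m + 1) =
      2 * Real.pi * Complex.I * ((-(N : ℂ)) ^ m / (m.factorial : ℂ)
        * shiftedMoment (N : NNReal)⁻¹ c m) := by
  have hN' : (N : ℂ) ≠ 0 := by exact_mod_cast hN
  have hrec : ∀ p : ℕ, (p : ℂ) * contourMoment γ N c (fun _ => 1) (p + 1) =
      N * ∫ u in (0 : ℝ)..1, (γ u - c) * contourWeight N c (γ u) / (γ u) ^ p * deriv γ u := by
    intro p
    have := contourMoment_by_parts hγ N c (P := fun _ => 1) (P' := fun _ => 0)
      (fun z => hasDerivAt_const z 1) continuous_const p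
    rw [← this]
    simp [contourMoment]
  have hstep : ∀ p : ℕ, ((p : ℂ) + 1) * contourMoment γ N c (fun _ => 1) (p + 2) =
      N * (contourMoment γ N c (fun _ => 1) p - c * contourMoment γ N c (fun _ => 1) (p + 1)) := by
    intro p
    have h := hrec (p + 1)
    push_cast at h
    rw [h, ← contourMoment_const_mul]
    congr 1
    simp only [contourMoment]
    rw [← intervalIntegral.integral_sub
      (hγ.intervalIntegrable (continuousOn_contourMoment N c continuous_const p))
      (hγ.intervalIntegrable (continuousOn_contourMoment N c continuous_const (p + 1)))]
    refine intervalIntegral.integral_congr fun u hu => ?_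
    rw [Set.uIcc_of_le zero_le_one] at hu
    have h0 := hγ.ne_zero u hu
    field_simp
    ring
  induction m using Nat.strong_induction_on with
  | _ m ih =>
  rcases m with _ | m
  · simp [contourMoment_one hγ, shiftedMoment_zero]
  · have h := hstep m
    have hm : ((m : ℂ) + 1) ≠ 0 := Nat.cast_add_one_ne_zero m
    rw [ih m (by omega)] at h
    rw [shiftedMoment_succ]
    apply mul_left_cancel₀ hm
    rw [h]
    have hf : ((m.factorial : ℕ) : ℂ) ≠ 0 := by exact_mod_cast m.factorial_ne_zero
    rcases m with _ | m
    · rw [contourMoment_zero hγ]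
      simp
      ring
    · rw [ih m (by omega)]
      have hf' : ((m.factorial : ℕ) : ℂ) ≠ 0 := by exact_mod_cast m.factorial_ne_zero
      simp only [Nat.factorial_succ, Nat.add_sub_cancel]
      push_cast
      have hm' : ((m : ℂ) + 1) ≠ 0 := Nat.cast_add_one_ne_zero m
      have hm2 : ((m : ℂ) + 1 + 1) ≠ 0 := by exact_mod_cast (Nat.succ_ne_zero (m + 1))
      field_simp
      ring

/-- The contour integral in the formula, in terms of Gaussian moments. -/
theorem contourMoment_quadratic (hγ : IsContourAboutZero γ) {N : ℕ} (hN : 2 ≤ N) (c b d : ℂ) :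
    contourMoment γ N c (fun z => 1 / (N : ℂ) + (z - c) ^ 2 - b * (z - c) + d) (N - 1) =
      2 * Real.pi * Complex.I * ((-(N : ℂ)) ^ (N - 2) / ((N - 2).factorial : ℂ)) *
        (shiftedMoment (N : NNReal)⁻¹ c N + b * shiftedMoment (N : NNReal)⁻¹ c (N - 1)
          + d * shiftedMoment (N : NNReal)⁻¹ c (N - 2)) := by
  obtain ⟨k, rfl⟩ : ∃ k, N = k + 2 := ⟨N - 2, by omega⟩
  set N := k + 2 with hNk
  have hN' : (N : ℂ) ≠ 0 := by exact_mod_cast (by omega : N ≠ 0)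
  have h1 := contourMoment_by_parts hγ N c (P := fun _ => 1) (P' := fun _ => 0)
      (fun z => hasDerivAt_const z 1) continuous_const (k + 1)
  have h2 := contourMoment_by_parts hγ N c (P := fun _ => 1) (P' := fun _ => 0)
      (fun z => hasDerivAt_const z 1) continuous_const (k + 2)
  have h3 := contourMoment_by_parts hγ N c (P := fun z => z - c) (P' := fun _ => 1)
      (fun z => (hasDerivAt_id z).sub_const c) continuous_const (k + 1)
  have h0 : ∀ p, contourMoment γ N c (fun _ => 0) p = 0 := fun p => by simp [contourMoment]
  simp only [mul_one, h0, add_zero] at h1 h2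
  have e1 : (fun z => 1 / (N : ℂ) + (z - c) ^ 2 - b * (z - c) + d) = fun z =>
    ((1 / (N : ℂ)) * 1 + (z - c) * (z - c)) + ((-b) * (z - c) + d * 1) := by
    ext z
    ring
  rw [e1, contourMoment_add hγ _ _ (by fun_prop) (by fun_prop),
    contourMoment_add hγ _ _ (by fun_prop) (by fun_prop),
    contourMoment_add hγ _ _ (by fun_prop) (by fun_prop), contourMoment_const_mul,
    contourMoment_const_mul, contourMoment_const_mul]
  have hm := fun m => contourMoment_eq hγ (show N ≠ 0 by omega) c m
  have j1 := hm k
  have j2 := hm (k + 1)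
  have j3 := hm (k + 2)
  have s1 : N - 1 = k + 1 := by omega
  have s2 : N - 2 = k := by omega
  rw [s1, s2]
  generalize contourMoment γ N c (fun _ => 1) (k + 1) = J1 at *
  generalize contourMoment γ N c (fun _ => 1) (k + 1 + 1) = J2 at *
  generalize contourMoment γ N c (fun _ => 1) (k + 2 + 1) = J3 at *
  generalize contourMoment γ N c (fun z => z - c) (k + 1) = A at *
  generalize contourMoment γ N c (fun z => z - c) (k + 1 + 1) = B at *
  generalize contourMoment γ N c (fun z => (z - c) * (z - c)) (k + 1) = D at *
  have hkN : (N : ℂ) = k + 2 := by rw [hNk]; push_cast; ring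
  have hf : ((k.factorial : ℕ) : ℂ) ≠ 0 := by exact_mod_cast k.factorial_ne_zero
  have hk1 : ((k : ℂ) + 1) ≠ 0 := Nat.cast_add_one_ne_zero k
  have hk2 : ((k : ℂ) + 2) ≠ 0 := hkN ▸ hN'
  set F : ℂ := 2 * Real.pi * Complex.I * ((-(N : ℂ)) ^ k / (k.factorial : ℂ)) with hF
  have j1' : J1 = F * shiftedMoment (N : NNReal)⁻¹ c k := by rw [j1, hF]; ring
  have j2' : ((k : ℂ) + 1) * J2 = -N * F * shiftedMoment (N : NNReal)⁻¹ c (k + 1) := by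
    rw [j2, hF, Nat.factorial_succ]
    push_cast
    field_simp
    ring
  have j3' : ((k : ℂ) + 2) * ((k + 1) * J3) = N ^ 2 * F * shiftedMoment (N : NNReal)⁻¹ c N := by
    rw [j3, hF, Nat.factorial_succ, Nat.factorial_succ, hNk]
    push_cast
    have hk3 : ((k : ℂ) + 1 + 1) ≠ 0 := by convert hk2 using 1; ring
    field_simp
    ring
  apply mul_left_cancel₀ (pow_ne_zero 2 hN')
  push_cast at h1 h2 h3
  have e2 : (N : ℂ) ^ 2 * (1 / (N : ℂ)) = N := by field_simp
  -- The summand `1/N` is exactly what `h3` needs: `N * D + J1 = (k + 1) * B`. Then `h2` turns `B`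
  -- into the top moment, and `h1` treats the term linear in `z - c`.
  linear_combination J1 * e2 + N * h3 - (b * N) * h1 + ((k : ℂ) + 1) * h2 + d * N ^ 2 * j1'
    - b * N * j2' + j3'

end ContourMoments

/-! ### Determinant and resolvent trace from complex Gaussian integrals. -/

section ComplexGaussian

lemma integral_cexp_neg_mul_normSq {d : ℂ} (hd : 0 < d.re) :
    ∫ z : ℂ, Complex.exp (-d * (Complex.normSq z : ℂ)) = Real.pi / d := by
  have h := integral_fun_norm_addHaar (volume : Measure ℂ)
    (fun r : ℝ => Complex.exp (-d * (r : ℂ) ^ 2))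
  have h2 := integral_mul_cexp_neg_mul_sq hd
  have hd0 : d ≠ 0 := fun h => by simp [h] at hd
  have h3 : ∫ y : ℝ in Set.Ioi 0, y ^ (2 - 1) • Complex.exp (-d * (y : ℂ) ^ 2) = (2 * d)⁻¹ := by
    simpa using h2
  rw [Complex.finrank_real_complex, h3] at h
  simp only [Complex.normSq_eq_norm_sq, Complex.ofReal_pow]
  rw [h]
  simp [Measure.real, Complex.volume_ball]
  field_simp

lemma integrable_pow_mul_cexp {d : ℂ} (hd : 0 < d.re) (k : ℕ) :
    Integrable (fun r : ℝ => (r : ℂ) ^ k * Complex.exp (-d * (r : ℂ) ^ 2)) := by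
  have h := integrable_rpow_mul_exp_neg_mul_sq hd (s := k) (by
    have : (0 : ℝ) ≤ k := k.cast_nonneg
    linarith)
  refine h.norm.mono' (by fun_prop) (Filter.Eventually.of_forall fun r => le_of_eq ?_)
  rw [norm_mul, norm_cexp_neg_mul_sq, norm_mul, Real.norm_of_nonneg (Real.exp_pos _).le,
    Real.rpow_natCast, norm_pow, norm_pow, Complex.norm_real]

lemma integral_pow_three_mul_cexp {d : ℂ} (hd : 0 < d.re) :
    ∫ r : ℝ in Set.Ioi 0, (r : ℂ) ^ 3 * Complex.exp (-d * (r : ℂ) ^ 2) = (2 * d ^ 2)⁻¹ := by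
  have hd0 : d ≠ 0 := fun h => by simp [h] at hd
  have A : ∀ x : ℂ, HasDerivAt
      (fun x => -(x ^ 2 / (2 * d) + (2 * d ^ 2)⁻¹) * Complex.exp (-d * x ^ 2))
      (x ^ 3 * Complex.exp (-d * x ^ 2)) x := by
    intro x
    have := ((((hasDerivAt_pow 2 x).div_const (2 * d)).add_const ((2 * d ^ 2)⁻¹)).neg).mul
      (((hasDerivAt_pow 2 x).const_mul (-d)).cexp)
    refine this.congr_deriv ?_
    simp only [Pi.neg_apply]
    field_simp
    push_cast
    ring
  -- The primitive and its derivative are both integrable, which forces the primitive to vanish at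
  -- infinity.
  have B : Filter.Tendsto (fun x : ℝ => -((x : ℂ) ^ 2 / (2 * d) + (2 * d ^ 2)⁻¹) *
      Complex.exp (-d * (x : ℂ) ^ 2)) Filter.atTop (nhds 0) := by
    refine tendsto_zero_of_hasDerivAt_of_integrableOn_Ioi (a := 0)
      (fun x _ => (A (x : ℂ)).comp_ofReal) (integrable_pow_mul_cexp hd 3).integrableOn
      (Integrable.integrableOn ?_)
    have := ((integrable_pow_mul_cexp hd 2).const_mul (-(1 / (2 * d)))).add
      ((integrable_pow_mul_cexp hd 0).const_mul (-(2 * d ^ 2)⁻¹))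
    refine this.congr (Filter.Eventually.of_forall fun x => ?_)
    simp only [Pi.add_apply]
    ring
  have := integral_Ioi_of_hasDerivAt_of_tendsto' (a := 0) (fun x _ => (A (x : ℂ)).comp_ofReal)
    (integrable_pow_mul_cexp hd 3).integrableOn B
  rw [this]
  simp

lemma integral_normSq_mul_cexp {d : ℂ} (hd : 0 < d.re) :
    ∫ z : ℂ, (Complex.normSq z : ℂ) * Complex.exp (-d * (Complex.normSq z : ℂ)) =
      Real.pi / d ^ 2 := by
  have h := integral_fun_norm_addHaar (volume : Measure ℂ)
    (fun r : ℝ => (r : ℂ) ^ 2 * Complex.exp (-d * (r : ℂ) ^ 2))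
  have h2 := integral_pow_three_mul_cexp hd
  have hd0 : d ≠ 0 := fun h => by simp [h] at hd
  have h3 : ∫ y : ℝ in Set.Ioi 0, y ^ (2 - 1) • ((y : ℂ) ^ 2 * Complex.exp (-d * (y : ℂ) ^ 2)) =
      (2 * d ^ 2)⁻¹ := by
    rw [← h2]
    refine setIntegral_congr_fun measurableSet_Ioi fun y _ => ?_
    simp only [Complex.real_smul]
    push_cast
    ring
  rw [Complex.finrank_real_complex, h3] at h
  simp only [Complex.normSq_eq_norm_sq, Complex.ofReal_pow]
  rw [h]
  simp [Measure.real, Complex.volume_ball]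
  field_simp

variable {n : Type*} [Fintype n] [DecidableEq n]

/-- The real determinant of a complex-linear map is `|det|²`, which is one for a unitary matrix. -/
lemma integral_comp_unitary_mulVec {U : Matrix n n ℂ} (hU : U ∈ Matrix.unitaryGroup n ℂ)
    {f : (n → ℂ) → ℂ} (hf : Continuous f) :
    ∫ x, f (U.mulVec x) = ∫ x, f x := by
  have hdet : ‖U.det‖ = 1 := by
    have h := Matrix.det_of_mem_unitary hU
    exact CStarRing.norm_of_mem_unitary h
  let g : (n → ℂ) →ₗ[ℝ] (n → ℂ) := (Matrix.toLin' U).restrictScalars ℝ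
  have hg : LinearMap.det g = 1 := by
    rw [LinearMap.det_restrictScalars, LinearMap.det_toLin', Algebra.norm_complex_apply,
      Complex.normSq_eq_norm_sq, hdet, one_pow]
  have hmap := Measure.map_linearMap_addHaar_eq_smul_addHaar (volume : Measure (n → ℂ))
    (f := g) (by rw [hg]; exact one_ne_zero)
  rw [hg] at hmap
  simp only [inv_one, abs_one, ENNReal.ofReal_one, one_smul] at hmap
  conv_rhs => rw [← hmap]
  rw [integral_map (g.continuous_of_finiteDimensional.aemeasurable) hf.aestronglyMeasurable]
  rfl

/-- The oscillatory Gaussian weight `exp (-b i φ† M φ)`. -/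
noncomputable def quadWeight (b : ℝ) (M : Matrix n n ℂ) (φ : n → ℂ) : ℂ :=
  Complex.exp (-((b : ℂ) * Complex.I * (star φ ⬝ᵥ M.mulVec φ)))

lemma continuous_quadWeight (b : ℝ) (M : Matrix n n ℂ) : Continuous (quadWeight b M) := by
  unfold quadWeight
  simp only [dotProduct, Matrix.mulVec, Pi.star_apply]
  fun_prop

/-- The squared norm `φ† φ`. -/
noncomputable def sqNorm (φ : n → ℂ) : ℂ := ∑ k, (Complex.normSq (φ k) : ℂ)

lemma sqNorm_eq (φ : n → ℂ) : sqNorm φ = star φ ⬝ᵥ φ := by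
  simp [sqNorm, dotProduct, Complex.normSq_eq_conj_mul_self]

lemma continuous_sqNorm : Continuous (sqNorm : (n → ℂ) → ℂ) := by
  unfold sqNorm
  fun_prop

lemma prod_cexp_integral {d : n → ℂ} (hd : ∀ k, 0 < (d k).re) :
    ∫ φ : n → ℂ, ∏ k, Complex.exp (-d k * (Complex.normSq (φ k) : ℂ)) = ∏ k, (Real.pi / d k) := by
  rw [integral_fintype_prod_volume_eq_prod
    (fun k (z : ℂ) => Complex.exp (-d k * (Complex.normSq z : ℂ)))]
  exact Finset.prod_congr rfl fun k _ => integral_cexp_neg_mul_normSq (hd k)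

lemma integrable_cexp_neg_mul_normSq {d : ℂ} (hd : 0 < d.re) :
    Integrable fun z : ℂ => Complex.exp (-d * (Complex.normSq z : ℂ)) := by
  -- A non-integrable function has integral zero by convention, so the nonzero value already
  -- computed proves integrability.
  refine Integrable.of_integral_ne_zero ?_
  rw [integral_cexp_neg_mul_normSq hd]
  have hd0 : d ≠ 0 := fun h => by simp [h] at hd
  simp [Real.pi_ne_zero, hd0]

lemma integrable_normSq_mul_cexp {d : ℂ} (hd : 0 < d.re) :
    Integrable fun z : ℂ => (Complex.normSq z : ℂ) *
      Complex.exp (-d * (Complex.normSq z : ℂ)) := by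
  refine Integrable.of_integral_ne_zero ?_
  rw [integral_normSq_mul_cexp hd]
  have hd0 : d ≠ 0 := fun h => by simp [h] at hd
  simp [Real.pi_ne_zero, hd0]

/-- The right-hand side is a product of one-variable functions, the form required by Fubini on a
finite product. -/
lemma normSq_mul_prod_cexp_eq (d : n → ℂ) (k : n) (φ : n → ℂ) :
    (Complex.normSq (φ k) : ℂ) * ∏ j, Complex.exp (-d j * (Complex.normSq (φ j) : ℂ)) =
      ∏ j, (fun z : ℂ => (if j = k then (Complex.normSq z : ℂ) else 1) *
        Complex.exp (-d j * (Complex.normSq z : ℂ))) (φ j) := by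
  simp only [Finset.prod_mul_distrib]
  congr 1
  simp

lemma integrable_sqNorm_mul_prod_cexp {d : n → ℂ} (hd : ∀ k, 0 < (d k).re) :
    Integrable fun φ : n → ℂ =>
      sqNorm φ * ∏ j, Complex.exp (-d j * (Complex.normSq (φ j) : ℂ)) := by
  simp only [sqNorm, Finset.sum_mul, normSq_mul_prod_cexp_eq]
  refine integrable_finsetSum _ fun k _ => ?_
  refine Integrable.fintype_prod (f := fun j (z : ℂ) => (if j = k then (Complex.normSq z : ℂ)
    else 1) * Complex.exp (-d j * (Complex.normSq z : ℂ))) fun j => ?_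
  by_cases h : j = k
  · simpa [h] using integrable_normSq_mul_cexp (hd k)
  · simpa [h] using integrable_cexp_neg_mul_normSq (hd j)

lemma integrable_prod_cexp {d : n → ℂ} (hd : ∀ k, 0 < (d k).re) :
    Integrable fun φ : n → ℂ => ∏ j, Complex.exp (-d j * (Complex.normSq (φ j) : ℂ)) :=
  Integrable.fintype_prod (f := fun j (z : ℂ) => Complex.exp (-d j * (Complex.normSq z : ℂ)))
    fun j => integrable_cexp_neg_mul_normSq (hd j)

lemma sqNorm_mul_prod_cexp_integral {d : n → ℂ} (hd : ∀ k, 0 < (d k).re) :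
    ∫ φ : n → ℂ, sqNorm φ * ∏ j, Complex.exp (-d j * (Complex.normSq (φ j) : ℂ)) =
      (∑ k, (d k)⁻¹) * ∏ k, (Real.pi / d k) := by
  have hint : ∀ k, Integrable fun φ : n → ℂ => ∏ j, (fun z : ℂ => (if j = k then
      (Complex.normSq z : ℂ) else 1) * Complex.exp (-d j * (Complex.normSq z : ℂ))) (φ j) := by
    intro k
    refine Integrable.fintype_prod (f := fun j (z : ℂ) => (if j = k then (Complex.normSq z : ℂ)
      else 1) * Complex.exp (-d j * (Complex.normSq z : ℂ))) fun j => ?_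
    by_cases h : j = k
    · simpa [h] using integrable_normSq_mul_cexp (hd k)
    · simpa [h] using integrable_cexp_neg_mul_normSq (hd j)
  simp only [sqNorm, Finset.sum_mul, normSq_mul_prod_cexp_eq]
  rw [integral_finsetSum _ fun k _ => hint k]
  refine Finset.sum_congr rfl fun k _ => ?_
  rw [integral_fintype_prod_volume_eq_prod (fun j (z : ℂ) => (if j = k then (Complex.normSq z : ℂ)
    else 1) * Complex.exp (-d j * (Complex.normSq z : ℂ)))]
  have h1 : ∀ j, ∫ z : ℂ, (if j = k then (Complex.normSq z : ℂ) else 1) *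
      Complex.exp (-d j * (Complex.normSq z : ℂ)) =
      (if j = k then (d k)⁻¹ else 1) * (Real.pi / d j) := by
    intro j
    by_cases h : j = k
    · subst h
      simp only [if_true]
      rw [integral_normSq_mul_cexp (hd j)]
      have hd0 : d j ≠ 0 := fun h => by have := hd j; simp [h] at this
      field_simp
    · simp only [h, if_false, one_mul]
      exact integral_cexp_neg_mul_normSq (hd j)
  simp only [h1, Finset.prod_mul_distrib]
  congr 1
  simp

lemma sqNorm_unitary_mulVec {U : Matrix n n ℂ} (hU : U ∈ Matrix.unitaryGroup n ℂ) (φ : n → ℂ) :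
    sqNorm (U.mulVec φ) = sqNorm φ := by
  have h : U.conjTranspose * U = 1 := Matrix.mem_unitaryGroup_iff'.1 hU
  rw [sqNorm_eq, sqNorm_eq, Matrix.star_mulVec, ← Matrix.dotProduct_mulVec, Matrix.mulVec_mulVec,
    h, Matrix.one_mulVec]

lemma quadWeight_unitary_mulVec {U : Matrix n n ℂ} (hU : U ∈ Matrix.unitaryGroup n ℂ)
    (b : ℝ) (e : n → ℂ) (φ : n → ℂ) :
    quadWeight b (U * Matrix.diagonal e * U.conjTranspose) (U.mulVec φ) =
      ∏ k, Complex.exp (-(b * Complex.I * e k) * (Complex.normSq (φ k) : ℂ)) := by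
  have h : U.conjTranspose * U = 1 := Matrix.mem_unitaryGroup_iff'.1 hU
  rw [quadWeight, Matrix.star_mulVec, ← Matrix.dotProduct_mulVec, Matrix.mulVec_mulVec,
    Matrix.mulVec_mulVec, ← Complex.exp_sum]
  have h2 : U.conjTranspose * (U * Matrix.diagonal e * U.conjTranspose) * U =
      Matrix.diagonal e := by
    rw [Matrix.mul_assoc, Matrix.mul_assoc _ _ U, h, Matrix.mul_one, ← Matrix.mul_assoc, h,
      Matrix.one_mul]
  rw [h2]
  congr 1
  simp only [dotProduct, Matrix.mulVec_diagonal, Pi.star_apply, Finset.mul_sum,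
    Complex.normSq_eq_conj_mul_self, ← Finset.sum_neg_distrib]
  refine Finset.sum_congr rfl fun k _ => ?_
  simp only [RCLike.star_def]
  ring

/-- Subtracting a real eigenvalue does not affect `Re(i(a - λ)) = -Im a`, so all the one-dimensional
Gaussians converge. -/
lemma exists_diagonalization {H : Matrix n n ℂ} (hH : H.IsHermitian) {a : ℂ} (ha : a.im < 0) :
    ∃ U ∈ Matrix.unitaryGroup n ℂ, ∃ e : n → ℂ, (∀ k, 0 < (Complex.I * e k).re) ∧
      a • 1 - H = U * Matrix.diagonal e * U.conjTranspose := by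
  refine ⟨hH.eigenvectorUnitary, hH.eigenvectorUnitary.2, fun k => a - hH.eigenvalues k,
    fun k => ?_, ?_⟩
  · simpa using ha
  · have h1 := hH.spectral_theorem
    rw [Unitary.conjStarAlgAut_apply] at h1
    have h2 : (hH.eigenvectorUnitary : Matrix n n ℂ) *
        (hH.eigenvectorUnitary : Matrix n n ℂ).conjTranspose = 1 :=
      Matrix.mem_unitaryGroup_iff.1 hH.eigenvectorUnitary.2
    have h3 : Matrix.diagonal (fun k => a - (hH.eigenvalues k : ℂ)) =
        a • (1 : Matrix n n ℂ) - Matrix.diagonal (RCLike.ofReal ∘ hH.eigenvalues) := by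
      rw [Matrix.smul_one_eq_diagonal, Matrix.diagonal_sub]
      rfl
    rw [h3, Matrix.mul_sub, Matrix.sub_mul, Matrix.mul_smul, Matrix.mul_one, Matrix.smul_mul, h2]
    conv_lhs => rw [h1]
    rfl

lemma det_conj_diagonal {U : Matrix n n ℂ} (hU : U ∈ Matrix.unitaryGroup n ℂ) (e : n → ℂ) :
    (Complex.I • (U * Matrix.diagonal e * U.conjTranspose)).det = ∏ k, Complex.I * e k := by
  have h : U * U.conjTranspose = 1 := Matrix.mem_unitaryGroup_iff.1 hU
  have h2 := congrArg Matrix.det h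
  rw [Matrix.det_mul, Matrix.det_one] at h2
  rw [Matrix.det_smul, Matrix.det_mul, Matrix.det_mul, Matrix.det_diagonal,
    Finset.prod_mul_distrib, Finset.prod_const, Finset.card_univ]
  linear_combination (Complex.I ^ Fintype.card n * ∏ i, e i) * h2

lemma trace_inv_conj_diagonal {U : Matrix n n ℂ} (hU : U ∈ Matrix.unitaryGroup n ℂ) {e : n → ℂ}
    (he : ∀ k, e k ≠ 0) :
    ((U * Matrix.diagonal e * U.conjTranspose)⁻¹).trace = ∑ k, (e k)⁻¹ := by
  have h : U * U.conjTranspose = 1 := Matrix.mem_unitaryGroup_iff.1 hU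
  have h' : U.conjTranspose * U = 1 := Matrix.mem_unitaryGroup_iff'.1 hU
  have hi : (U * Matrix.diagonal e * U.conjTranspose) *
      (U * Matrix.diagonal (fun k => (e k)⁻¹) * U.conjTranspose) = 1 := by
    have hd : Matrix.diagonal e * Matrix.diagonal (fun k => (e k)⁻¹) = 1 := by
      rw [Matrix.diagonal_mul_diagonal, ← Matrix.diagonal_one]
      congr 1
      ext k
      exact mul_inv_cancel₀ (he k)
    calc _ = U * Matrix.diagonal e * (U.conjTranspose * U) *
          Matrix.diagonal (fun k => (e k)⁻¹) * U.conjTranspose := by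
          simp only [Matrix.mul_assoc]
      _ = U * (Matrix.diagonal e * Matrix.diagonal (fun k => (e k)⁻¹)) * U.conjTranspose := by
          rw [h', Matrix.mul_one]
          simp only [Matrix.mul_assoc]
      _ = 1 := by rw [hd, Matrix.mul_one, h]
  rw [Matrix.inv_eq_right_inv hi, Matrix.trace_mul_cycle, h', Matrix.one_mul,
    Matrix.trace_diagonal]

/-- The determinant as the inverse of a complex Gaussian integral. -/
theorem det_mul_integral_quadWeight {H : Matrix n n ℂ} (hH : H.IsHermitian) {a : ℂ}
    (ha : a.im < 0) {b : ℝ} (hb : 0 < b) :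
    (Complex.I • (a • 1 - H)).det * ∫ φ, quadWeight b (a • 1 - H) φ =
      ((Real.pi : ℂ) / b) ^ Fintype.card n := by
  obtain ⟨U, hU, e, he, hM⟩ := exists_diagonalization hH ha
  have hd : ∀ k, 0 < ((b : ℂ) * Complex.I * e k).re := fun k => by
    rw [mul_assoc, Complex.re_ofReal_mul]
    exact mul_pos hb (he k)
  rw [hM, det_conj_diagonal hU, ← integral_comp_unitary_mulVec hU (continuous_quadWeight b _)]
  simp only [quadWeight_unitary_mulVec hU]
  rw [prod_cexp_integral hd, ← Finset.prod_mul_distrib, ← Finset.card_univ, ← Finset.prod_const]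
  refine Finset.prod_congr rfl fun k _ => ?_
  have h0 : e k ≠ 0 := fun h => by have := he k; simp [h] at this
  have hb0 : (b : ℂ) ≠ 0 := by exact_mod_cast hb.ne'
  field_simp

/-- The trace of the resolvent as a second moment of a complex Gaussian integral. -/
theorem det_mul_integral_sqNorm_mul_quadWeight {H : Matrix n n ℂ} (hH : H.IsHermitian) {a : ℂ}
    (ha : a.im < 0) {b : ℝ} (hb : 0 < b) :
    (Complex.I • (a • 1 - H)).det * ∫ φ, sqNorm φ * quadWeight b (a • 1 - H) φ =
      ((Real.pi : ℂ) / b) ^ Fintype.card n * ((b : ℂ)⁻¹ * -Complex.I * ((a • 1 - H)⁻¹).trace) := by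
  obtain ⟨U, hU, e, he, hM⟩ := exists_diagonalization hH ha
  have hd : ∀ k, 0 < ((b : ℂ) * Complex.I * e k).re := fun k => by
    rw [mul_assoc, Complex.re_ofReal_mul]
    exact mul_pos hb (he k)
  have h0 : ∀ k, e k ≠ 0 := fun k h => by have := he k; simp [h] at this
  have hb0 : (b : ℂ) ≠ 0 := by exact_mod_cast hb.ne'
  rw [hM, det_conj_diagonal hU, trace_inv_conj_diagonal hU h0,
    ← integral_comp_unitary_mulVec hU (f := fun φ => sqNorm φ *
      quadWeight b (U * Matrix.diagonal e * U.conjTranspose) φ)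
      (continuous_sqNorm.mul (continuous_quadWeight b _))]
  simp only [quadWeight_unitary_mulVec hU, sqNorm_unitary_mulVec hU]
  rw [sqNorm_mul_prod_cexp_integral hd, mul_left_comm, ← Finset.prod_mul_distrib,
    mul_comm _ (_ * _ * _)]
  congr 1
  · rw [Finset.mul_sum]
    refine Finset.sum_congr rfl fun k _ => ?_
    have := h0 k
    rw [mul_inv, mul_inv, Complex.inv_I]
  · rw [← Finset.card_univ, ← Finset.prod_const]
    refine Finset.prod_congr rfl fun k _ => ?_
    have := h0 k
    field_simp

end ComplexGaussian

/-! ### The ensemble average at a fixed vector. -/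

section EnsembleAverage

variable {N : ℕ}

/-- The matrix with the given family of entries. -/
def entryMatrix (x : Fin N × Fin N → ℂ) : Matrix (Fin N) (Fin N) ℂ := Matrix.of fun i j => x (i, j)

/-- The entry `(i, j)` as a continuous real-linear map. -/
noncomputable def entryCLM (i j : Fin N) : (Fin N × Fin N → ℂ) →L[ℝ] ℂ :=
  ContinuousLinearMap.proj (R := ℝ) (φ := fun _ : Fin N × Fin N => ℂ) (i, j)

lemma entryCLM_apply (i j : Fin N) (x : Fin N × Fin N → ℂ) : entryCLM i j x = x (i, j) := rfl

/-- The real part of `N φ† H φ`, as a functional of the entries of `H`. -/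
noncomputable def formCLM (φ : Fin N → ℂ) : (Fin N × Fin N → ℂ) →L[ℝ] ℝ :=
  Complex.reCLM.comp (∑ p : Fin N × Fin N, ((N : ℂ) * (star (φ p.1) * φ p.2)) • entryCLM p.1 p.2)

lemma formCLM_apply (φ : Fin N → ℂ) (x : Fin N × Fin N → ℂ) :
    formCLM φ x = ((N : ℂ) * (star φ ⬝ᵥ (entryMatrix x).mulVec φ)).re := by
  simp only [formCLM, ContinuousLinearMap.comp_apply, Complex.reCLM_apply,
    sum_apply, smul_apply, entryCLM_apply, smul_eq_mul]
  congr 1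
  simp only [dotProduct, Matrix.mulVec, Finset.mul_sum, entryMatrix, Matrix.of_apply,
    Fintype.sum_prod_type, Pi.star_apply]
  exact Finset.sum_congr rfl fun i _ => Finset.sum_congr rfl fun j _ => by ring

lemma ofReal_formCLM {x : Fin N × Fin N → ℂ} (hx : (entryMatrix x).IsHermitian) (φ : Fin N → ℂ) :
    ((formCLM φ x : ℝ) : ℂ) = (N : ℂ) * (star φ ⬝ᵥ (entryMatrix x).mulVec φ) := by
  rw [formCLM_apply]
  apply Complex.conj_eq_iff_re.1
  rw [map_mul, Complex.conj_natCast]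
  congr 1
  rw [starRingEnd_apply, ← Matrix.star_dotProduct, Matrix.star_mulVec, hx.eq,
    ← Matrix.dotProduct_mulVec]

lemma ofReal_formCLM_eq_sum {x : Fin N × Fin N → ℂ} (hx : (entryMatrix x).IsHermitian)
    (φ : Fin N → ℂ) : ((formCLM φ x : ℝ) : ℂ) =
      ∑ p : Fin N × Fin N, (N : ℂ) * (star (φ p.1) * φ p.2) * x p := by
  rw [ofReal_formCLM hx]
  simp only [dotProduct, Matrix.mulVec, Finset.mul_sum, entryMatrix, Matrix.of_apply,
    Fintype.sum_prod_type, Pi.star_apply]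
  exact Finset.sum_congr rfl fun i _ => Finset.sum_congr rfl fun j _ => by ring

/-- The hypotheses of the ensemble, for the law of the family of entries. -/
structure IsEnsembleLaw (r : ℝ) (ν : Measure (Fin N × Fin N → ℂ)) : Prop where
  gaussian : IsGaussian ν
  hermitian : ∀ᵐ x ∂ν, (entryMatrix x).IsHermitian
  centered : ∀ p, ∫ x, x p ∂ν = 0
  covariance : ∀ i j k l, ∫ x, x (i, j) * x (k, l) ∂ν =
    (1 / (N : ℂ)) * (kron j k * kron i l + (1 - (r : ℂ)) * (kron i k * kron j l))

namespace IsEnsembleLaw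

variable {r : ℝ} {ν : Measure (Fin N × Fin N → ℂ)}

lemma integral_clm (h : IsEnsembleLaw r ν) (L : (Fin N × Fin N → ℂ) →L[ℝ] ℝ) :
    ∫ x, L x ∂ν = 0 := by
  have := h.gaussian
  rw [IsGaussian.integral_dual]
  have h0 : ∫ x, x ∂ν = 0 := by
    ext p
    rw [MeasureTheory.eval_integral (f := fun x => x)
      (fun p => (HasPolyGrowth.clm (entryCLM p.1 p.2)).integrable ν)]
    exact h.centered p
  rw [h0, map_zero]

/-- The mean of `N H_ij φ† H φ`. -/
noncomputable def _root_.shiftMatrix (r : ℝ) (φ : Fin N → ℂ) : Matrix (Fin N) (Fin N) ℂ :=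
  Matrix.vecMulVec φ (star φ) + Matrix.vecMulVec ((1 - (r : ℂ)) • star φ) φ

/-- Almost surely `H` is Hermitian, hence `φ†Hφ` is real and the real part in `formCLM` can be
dropped; the covariance then applies entry by entry. -/
lemma integral_entry_mul_form (h : IsEnsembleLaw r ν) (hN : N ≠ 0) (φ : Fin N → ℂ)
    (i j : Fin N) : ∫ x, x (i, j) * (formCLM φ x : ℂ) ∂ν = shiftMatrix r φ i j := by
  have := h.gaussian
  have h1 : ∫ x, x (i, j) * (formCLM φ x : ℂ) ∂ν =
      ∫ x, ∑ p : Fin N × Fin N, (N : ℂ) * (star (φ p.1) * φ p.2) * (x (i, j) * x p) ∂ν := by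
    refine integral_congr_ae (h.hermitian.mono fun x hx => ?_)
    simp only
    rw [ofReal_formCLM_eq_sum hx, Finset.mul_sum]
    exact Finset.sum_congr rfl fun p _ => by ring
  rw [h1, integral_finsetSum _ fun p _ => ((HasPolyGrowth.const _).mul
    ((HasPolyGrowth.clm (entryCLM i j)).mul (HasPolyGrowth.clm (entryCLM p.1 p.2)))).integrable ν]
  simp only [integral_const_mul, h.covariance, Fintype.sum_prod_type]
  have hN' : (N : ℂ) ≠ 0 := by exact_mod_cast hN
  have h2 : ∀ k l, (N : ℂ) * (star (φ k) * φ l) * ((1 / (N : ℂ)) *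
      (kron j k * kron i l + (1 - (r : ℂ)) * (kron i k * kron j l))) =
      (if j = k then (if i = l then star (φ k) * φ l else 0) else 0) +
      (if i = k then (if j = l then (1 - (r : ℂ)) * (star (φ k) * φ l) else 0) else 0) := by
    intro k l
    simp only [kron]
    split_ifs <;> field_simp <;> ring
  simp only [h2, Finset.sum_add_distrib, Finset.sum_ite_eq, Finset.sum_ite_irrel,
    Finset.sum_const_zero, Finset.mem_univ, if_true, shiftMatrix, Matrix.add_apply,
    Matrix.vecMulVec_apply, Pi.star_apply, Pi.smul_apply, smul_eq_mul]
  ring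

lemma integral_form_mul_form (h : IsEnsembleLaw r ν) (hN : N ≠ 0) (φ : Fin N → ℂ) :
    ∫ x, (formCLM φ x : ℂ) * (formCLM φ x : ℂ) ∂ν =
      N * (sqNorm φ ^ 2 + (1 - (r : ℂ)) * (star φ ⬝ᵥ star φ) * (φ ⬝ᵥ φ)) := by
  have := h.gaussian
  have h1 : ∫ x, (formCLM φ x : ℂ) * (formCLM φ x : ℂ) ∂ν =
      ∫ x, ∑ p : Fin N × Fin N, (N : ℂ) * (star (φ p.1) * φ p.2) *
        (x (p.1, p.2) * (formCLM φ x : ℂ)) ∂ν := by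
    refine integral_congr_ae (h.hermitian.mono fun x hx => ?_)
    simp only
    nth_rewrite 1 [ofReal_formCLM_eq_sum hx]
    rw [Finset.sum_mul]
    exact Finset.sum_congr rfl fun p _ => by ring
  rw [h1, integral_finsetSum _ fun p _ => ((HasPolyGrowth.const _).mul
    ((HasPolyGrowth.clm (entryCLM p.1 p.2)).mul (HasPolyGrowth.clm_real _))).integrable ν]
  simp only [integral_const_mul, h.integral_entry_mul_form hN, Fintype.sum_prod_type, shiftMatrix,
    Matrix.add_apply, Matrix.vecMulVec_apply, Pi.star_apply, Pi.smul_apply, smul_eq_mul]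
  have h2 : ∀ k l, (N : ℂ) * (star (φ k) * φ l) *
      (φ k * star (φ l) + (1 - (r : ℂ)) * star (φ k) * φ l) =
      N * ((star (φ k) * φ k) * (star (φ l) * φ l)) +
        N * (1 - (r : ℂ)) * ((star (φ k) * star (φ k)) * (φ l * φ l)) := fun k l => by ring
  simp only [h2, Finset.sum_add_distrib, ← Finset.mul_sum, ← Finset.sum_mul]
  simp only [sqNorm_eq, dotProduct, Pi.star_apply]
  ring

end IsEnsembleLaw

/-- The Gaussian average of the determinant. -/
noncomputable def averagedDet (N : ℕ) (c b d : ℂ) : ℂ :=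
  shiftedMoment (N : NNReal)⁻¹ c N + b * shiftedMoment (N : NNReal)⁻¹ c (N - 1)
    + d * shiftedMoment (N : NNReal)⁻¹ c (N - 2)

/-- The 2 × 2 determinant of the rank-two formula is quadratic in `c + g`. Its linear coefficient is
`2 - r` because the two rank-one parts have traces `φ†φ` and `(1-r) φ†φ`. -/
lemma integral_det_rank_two (hN : 2 ≤ N) (r : ℝ) (c : ℂ) (φ : Fin N → ℂ) :
    ∫ g : ℝ, (c • (1 : Matrix (Fin N) (Fin N) ℂ) + (shiftMatrix r φ + (g : ℂ) • 1)).det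
      ∂(gaussianReal 0 (N : NNReal)⁻¹) =
    averagedDet N c ((2 - (r : ℂ)) * sqNorm φ)
      ((1 - (r : ℂ)) * (sqNorm φ ^ 2 - (star φ ⬝ᵥ star φ) * (φ ⬝ᵥ φ))) := by
  have h1 : ∀ g : ℝ, (c • (1 : Matrix (Fin N) (Fin N) ℂ) + (shiftMatrix r φ + (g : ℂ) • 1)).det =
      (c + (g : ℂ)) ^ N + ((2 - (r : ℂ)) * sqNorm φ) * (c + (g : ℂ)) ^ (N - 1) +
        ((1 - (r : ℂ)) * (sqNorm φ ^ 2 - (star φ ⬝ᵥ star φ) * (φ ⬝ᵥ φ))) *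
          (c + (g : ℂ)) ^ (N - 2) := by
    intro g
    have h := det_smul_one_add_vecMulVec_add (n := Fin N) (by simpa using hN) (c + g) φ (star φ)
      ((1 - (r : ℂ)) • star φ) φ
    have e1 : c • (1 : Matrix (Fin N) (Fin N) ℂ) + (shiftMatrix r φ + (g : ℂ) • 1) =
        (c + (g : ℂ)) • 1 + Matrix.vecMulVec φ (star φ) +
          Matrix.vecMulVec ((1 - (r : ℂ)) • star φ) φ := by
      rw [shiftMatrix, add_smul]
      abel
    rw [e1, h, Fintype.card_fin, dotProduct_smul, dotProduct_smul, ← sqNorm_eq,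
      dotProduct_comm φ (star φ), ← sqNorm_eq]
    obtain ⟨k, rfl⟩ : ∃ k, N = k + 2 := ⟨N - 2, by omega⟩
    simp only [Nat.add_sub_cancel, smul_eq_mul, show k + 2 - 1 = k + 1 by omega]
    ring
  simp only [h1]
  have hp := hasPolyGrowth_shift_pow c
  rw [integral_add (((hp N).add ((HasPolyGrowth.const _).mul (hp (N - 1)))).integrable _)
      (((HasPolyGrowth.const _).mul (hp (N - 2))).integrable _),
    integral_add ((hp N).integrable _) (((HasPolyGrowth.const _).mul (hp (N - 1))).integrable _),
    integral_const_mul, integral_const_mul]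
  rfl

/-- The exponential weight obtained by averaging `exp (i N φ† H φ)`. -/
noncomputable def averagedWeight (N : ℕ) (r : ℝ) (φ : Fin N → ℂ) : ℂ :=
  Complex.exp (-((N : ℂ) / 2) *
    (sqNorm φ ^ 2 + (1 - (r : ℂ)) * (star φ ⬝ᵥ star φ) * (φ ⬝ᵥ φ)))

theorem IsEnsembleLaw.integral_det_mul_cexp_form {r : ℝ} {ν : Measure (Fin N × Fin N → ℂ)}
    (h : IsEnsembleLaw r ν) (hN : 2 ≤ N) (a : ℂ) (φ : Fin N → ℂ) :
    ∫ x, (Complex.I • (a • 1 - entryMatrix x)).det * Complex.exp (Complex.I * (formCLM φ x : ℂ)) ∂ν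
      = averagedWeight N r φ * averagedDet N (Complex.I * a) ((2 - (r : ℂ)) * sqNorm φ)
          ((1 - (r : ℂ)) * (sqNorm φ ^ 2 - (star φ ⬝ᵥ star φ) * (φ ⬝ᵥ φ))) := by
  have := h.gaussian
  have hN0 : N ≠ 0 := by omega
  -- The Gaussian matrix is `-iH`; the factor `(-i)² = -1` gives the covariance `-v` with `v = 1/N`.
  -- The part with coefficient `1 - r` couples only entries of the same row, which the hypothesis on
  -- distinct rows excludes.
  have key := integral_det_rowPerturb ν h.integral_clm
    (fun i j => -Complex.I • entryCLM i j) ((N : NNReal)⁻¹) ?_ (formCLM φ) (shiftMatrix r φ) ?_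
    Finset.univ ((Complex.I * a) • 1)
  · simp only [rowPerturb_univ] at key
    rw [integral_det_rank_two hN, integral_cexp_of_isGaussian ν h.integral_clm,
      h.integral_form_mul_form hN0] at key
    rw [averagedWeight, show ∀ y : ℂ, -((N : ℂ) / 2) * y = -(1 / 2) * (N * y) from fun y => by ring,
      ← key]
    refine integral_congr_ae (Filter.Eventually.of_forall fun x => ?_)
    simp only
    congr 2
    ext i j
    simp [entryMatrix, entryCLM_apply]
    ring
  · intro i j k l hik
    simp only [smul_apply, entryCLM_apply, smul_eq_mul]
    rw [show (fun x : Fin N × Fin N → ℂ => -Complex.I * x (i, j) * (-Complex.I * x (k, l))) =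
        fun x => -1 * (x (i, j) * x (k, l)) from by
      ext x
      linear_combination (x (i, j) * x (k, l)) * Complex.I_mul_I, integral_const_mul, h.covariance]
    have h0 : kron i k = 0 := if_neg hik
    rw [h0]
    by_cases h1 : j = k <;> by_cases h2 : i = l <;> simp [kron, h1, h2]
  · intro i j
    simp only [smul_apply, entryCLM_apply, smul_eq_mul, mul_assoc]
    rw [integral_const_mul, h.integral_entry_mul_form hN0]
    linear_combination (-shiftMatrix r φ i j) * Complex.I_mul_I

end EnsembleAverage

/-! ### Exchanging the ensemble average with the integral over `φ`. -/

section Fubini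

variable {N : ℕ}

/-- The function of `φ` obtained by averaging the determinant formula over the ensemble. -/
noncomputable def averagedIntegrand (N : ℕ) (r : ℝ) (a : ℂ) (φ : Fin N → ℂ) : ℂ :=
  Complex.exp (-((N : ℂ) * Complex.I * a) * sqNorm φ) *
    (averagedWeight N r φ * averagedDet N (Complex.I * a) ((2 - (r : ℂ)) * sqNorm φ)
      ((1 - (r : ℂ)) * (sqNorm φ ^ 2 - (star φ ⬝ᵥ star φ) * (φ ⬝ᵥ φ))))

lemma quadWeight_eq {x : Fin N × Fin N → ℂ} (hx : (entryMatrix x).IsHermitian) (a : ℂ)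
    (φ : Fin N → ℂ) : quadWeight N (a • 1 - entryMatrix x) φ =
      Complex.exp (-((N : ℂ) * Complex.I * a) * sqNorm φ) *
        Complex.exp (Complex.I * (formCLM φ x : ℂ)) := by
  rw [quadWeight, ← Complex.exp_add, ofReal_formCLM hx, Matrix.sub_mulVec, Matrix.smul_mulVec,
    Matrix.one_mulVec, dotProduct_sub, dotProduct_smul, ← sqNorm_eq, smul_eq_mul]
  congr 1
  push_cast
  ring

lemma continuous_formCLM_uncurry :
    Continuous fun q : (Fin N × Fin N → ℂ) × (Fin N → ℂ) => formCLM q.2 q.1 := by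
  simp only [formCLM_apply, dotProduct, Matrix.mulVec, Pi.star_apply, entryMatrix, Matrix.of_apply]
  fun_prop

lemma hasPolyGrowth_det_resolvent (a : ℂ) : HasPolyGrowth fun x : Fin N × Fin N → ℂ =>
    (Complex.I • (a • 1 - entryMatrix x)).det := by
  refine HasPolyGrowth.det fun i j => ?_
  have := (HasPolyGrowth.const (V := Fin N × Fin N → ℂ) (Complex.I * (a • (1 : Matrix (Fin N) (Fin N) ℂ)) i j)).add
    ((HasPolyGrowth.const (-Complex.I)).mul (HasPolyGrowth.clm (entryCLM i j)))
  convert this using 2 with x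
  simp only [Matrix.smul_apply, Matrix.sub_apply, smul_eq_mul, entryMatrix, Matrix.of_apply,
    entryCLM_apply]
  ring

/-- Exchange of the ensemble average and the Gaussian integral. -/
theorem IsEnsembleLaw.average_exchange {r : ℝ} {ν : Measure (Fin N × Fin N → ℂ)}
    (h : IsEnsembleLaw r ν) (hN : 2 ≤ N) (a : ℂ) {p : (Fin N → ℂ) → ℂ} 
    (hp : Integrable fun φ => p φ * Complex.exp (-((N : ℂ) * Complex.I * a) * sqNorm φ)) :
    Integrable (fun φ => p φ * averagedIntegrand N r a φ) ∧
    Integrable (fun x => (Complex.I • (a • 1 - entryMatrix x)).det *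
      ∫ φ, p φ * quadWeight N (a • 1 - entryMatrix x) φ) ν ∧
    ∫ x, (Complex.I • (a • 1 - entryMatrix x)).det *
      (∫ φ, p φ * quadWeight N (a • 1 - entryMatrix x) φ) ∂ν =
      ∫ φ, p φ * averagedIntegrand N r a φ := by
  have := h.gaussian
  set f : (Fin N × Fin N → ℂ) × (Fin N → ℂ) → ℂ := fun q =>
    (Complex.I • (a • 1 - entryMatrix q.1)).det *
      (p q.2 * Complex.exp (-((N : ℂ) * Complex.I * a) * sqNorm q.2)) *
      Complex.exp (Complex.I * (formCLM q.2 q.1 : ℂ)) with hf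
  have hg := ((hasPolyGrowth_det_resolvent (N := N) a).integrable ν).mul_prod hp
  have hfint : Integrable f (ν.prod volume) := by
    -- The factor coupling `H` and `φ` is unimodular, so integrability follows from that of a
    -- polynomial in `H` times a Gaussian in `φ`.
    refine hg.mono (hg.aestronglyMeasurable.mul ?_) (Filter.Eventually.of_forall fun q => ?_)
    · refine Continuous.aestronglyMeasurable ?_
      have := continuous_formCLM_uncurry (N := N)
      fun_prop
    · rw [hf, norm_mul, mul_comm Complex.I, Complex.norm_exp_ofReal_mul_I, mul_one]
  have hx : ∀ᵐ x ∂ν, ∫ φ, f (x, φ) = (Complex.I • (a • 1 - entryMatrix x)).det *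
      ∫ φ, p φ * quadWeight N (a • 1 - entryMatrix x) φ := by
    refine h.hermitian.mono fun x hx => ?_
    rw [← integral_const_mul]
    refine integral_congr_ae (Filter.Eventually.of_forall fun φ => ?_)
    simp only [hf, quadWeight_eq hx]
    ring
  have hφ : ∀ φ, ∫ x, f (x, φ) ∂ν = p φ * averagedIntegrand N r a φ := by
    intro φ
    rw [averagedIntegrand, ← h.integral_det_mul_cexp_form hN, ← mul_assoc, ← integral_const_mul]
    refine integral_congr_ae (Filter.Eventually.of_forall fun x => ?_)
    simp only [hf]
    ring
  refine ⟨?_, hfint.integral_prod_left.congr hx, ?_⟩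
  · simpa only [hφ] using hfint.integral_prod_right
  · rw [← integral_congr_ae hx, ← integral_prod _ hfint, integral_prod_symm _ hfint]
    simp only [hφ]

lemma cexp_neg_mul_sqNorm (d : ℂ) (φ : Fin N → ℂ) : Complex.exp (-d * sqNorm φ) =
    ∏ k, Complex.exp (-d * (Complex.normSq (φ k) : ℂ)) := by
  rw [← Complex.exp_sum, sqNorm, Finset.mul_sum]

/-- The averaged partition function. -/
theorem IsEnsembleLaw.integral_averagedIntegrand {r : ℝ} {ν : Measure (Fin N × Fin N → ℂ)}
    (h : IsEnsembleLaw r ν) (hN : 2 ≤ N) {a : ℂ} (ha : a.im < 0) :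
    Integrable (averagedIntegrand N r a) ∧
    ∫ φ, averagedIntegrand N r a φ = ((Real.pi : ℂ) / N) ^ N := by
  have hgs := h.gaussian
  have hN0 : (0 : ℝ) < N := by exact_mod_cast (by omega : 0 < N)
  have hd : 0 < ((N : ℂ) * Complex.I * a).re := by
    simpa using mul_neg_of_pos_of_neg hN0 ha
  have hp : Integrable fun φ : Fin N → ℂ =>
      (1 : ℂ) * Complex.exp (-((N : ℂ) * Complex.I * a) * sqNorm φ) := by
    simp only [cexp_neg_mul_sqNorm, one_mul]
    exact integrable_prod_cexp fun _ => hd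
  obtain ⟨h1, -, h3⟩ := h.average_exchange hN a (p := fun _ => 1) hp
  simp only [one_mul] at h1 h3
  refine ⟨h1, ?_⟩
  -- Determinant and Gaussian integral cancel for almost every `H`, so a constant is averaged over a
  -- probability measure.
  rw [← h3, integral_congr_ae (g := fun _ => ((Real.pi : ℂ) / N) ^ N)]
  · simp
  · refine h.hermitian.mono fun x hx => ?_
    have := det_mul_integral_quadWeight hx ha hN0
    simpa using this

/-- The averaged trace of the resolvent. -/
theorem IsEnsembleLaw.integral_trace_resolvent {r : ℝ} {ν : Measure (Fin N × Fin N → ℂ)}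
    (h : IsEnsembleLaw r ν) (hN : 2 ≤ N) {a : ℂ} (ha : a.im < 0) :
    Integrable (fun φ => sqNorm φ * averagedIntegrand N r a φ) ∧
    Integrable (fun x => ((a • 1 - entryMatrix x)⁻¹).trace) ν ∧
    ∫ φ, sqNorm φ * averagedIntegrand N r a φ = ((Real.pi : ℂ) / N) ^ N *
      ((N : ℂ)⁻¹ * -Complex.I * ∫ x, ((a • 1 - entryMatrix x)⁻¹).trace ∂ν) := by
  have hgs := h.gaussian
  have hN0 : (0 : ℝ) < N := by exact_mod_cast (by omega : 0 < N)
  have hNc : (N : ℂ) ≠ 0 := by exact_mod_cast hN0.ne'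
  have hd : 0 < ((N : ℂ) * Complex.I * a).re := by
    simpa using mul_neg_of_pos_of_neg hN0 ha
  have hp : Integrable fun φ : Fin N → ℂ =>
      sqNorm φ * Complex.exp (-((N : ℂ) * Complex.I * a) * sqNorm φ) := by
    simp only [cexp_neg_mul_sqNorm]
    exact integrable_sqNorm_mul_prod_cexp fun _ => hd
  obtain ⟨h1, h2, h3⟩ := h.average_exchange hN a hp
  have hx : ∀ᵐ x ∂ν, (Complex.I • (a • 1 - entryMatrix x)).det *
      (∫ φ, sqNorm φ * quadWeight N (a • 1 - entryMatrix x) φ) =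
      ((Real.pi : ℂ) / N) ^ N * ((N : ℂ)⁻¹ * -Complex.I) * ((a • 1 - entryMatrix x)⁻¹).trace :=
    h.hermitian.mono fun x hx => by
      have := det_mul_integral_sqNorm_mul_quadWeight hx ha hN0
      simpa [mul_assoc] using this
  -- Dividing by this constant transfers the integrability supplied by Fubini to the trace.
  have hc : ((Real.pi : ℂ) / N) ^ N * ((N : ℂ)⁻¹ * -Complex.I) ≠ 0 := by
    have : (Real.pi : ℂ) ≠ 0 := by exact_mod_cast Real.pi_ne_zero
    simp [this, hNc, Complex.I_ne_zero]
  refine ⟨h1, ?_, ?_⟩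
  · have := (h2.congr hx).const_mul (((Real.pi : ℂ) / N) ^ N * ((N : ℂ)⁻¹ * -Complex.I))⁻¹
    simpa only [inv_mul_cancel_left₀ hc] using this
  · rw [← h3, integral_congr_ae hx, integral_const_mul, mul_assoc]

end Fubini

/-! ### Polar coordinates for a pair of real vectors. -/

section PolarIntegration

open scoped ENNReal RealInnerProductSpace

/-- With nonnegative integrands the change of coordinates needs no integrability hypothesis, and it
can later identify a push-forward measure. -/
lemma lintegral_fun_norm_addHaar {E : Type*} [NormedAddCommGroup E] [NormedSpace ℝ E]
    [FiniteDimensional ℝ E] [Nontrivial E] [MeasurableSpace E] [BorelSpace E] (μ : Measure E)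
    [μ.IsAddHaarMeasure] {f : ℝ → ℝ≥0∞} (hf : Measurable f) :
    ∫⁻ x, f ‖x‖ ∂μ = (Module.finrank ℝ E * μ (Metric.ball 0 1)) *
      ∫⁻ r in Set.Ioi (0 : ℝ), ENNReal.ofReal (r ^ (Module.finrank ℝ E - 1)) * f r := by
  calc
    ∫⁻ x, f ‖x‖ ∂μ = ∫⁻ x : ({(0)}ᶜ : Set E), f (‖x.1‖) ∂(μ.comap (↑)) := by
      rw [lintegral_subtype_comap (measurableSet_singleton _).compl (fun x => f ‖x‖),
        restrict_compl_singleton]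
    _ = ∫⁻ x, f x.2 ∂μ.toSphere.prod (.volumeIoiPow (Module.finrank ℝ E - 1)) := by
      simpa using μ.measurePreserving_homeomorphUnitSphereProd.lintegral_comp
        (f := f ∘ Subtype.val ∘ Prod.snd) (by fun_prop)
    _ = μ.toSphere Set.univ * ∫⁻ x : Set.Ioi (0 : ℝ), f x
          ∂.volumeIoiPow (Module.finrank ℝ E - 1) := by
      have := lintegral_prod_mul (μ := μ.toSphere)
        (ν := Measure.volumeIoiPow (Module.finrank ℝ E - 1)) (f := fun _ => 1)
        (g := fun x => f x.1) (by fun_prop) (by fun_prop)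
      simpa using this
    _ = _ := by
      rw [μ.toSphere_apply_univ, Measure.volumeIoiPow,
        lintegral_withDensity_eq_lintegral_mul _ (by fun_prop) (by fun_prop)]
      congr 1
      exact lintegral_subtype_comap measurableSet_Ioi
        (fun r => ENNReal.ofReal (r ^ (Module.finrank ℝ E - 1)) * f r)

/-- The substitution `s = r²`. -/
lemma lintegral_pow_mul_comp_sq (m : ℕ) (F : ℝ → ℝ≥0∞) :
    ∫⁻ r in Set.Ioi (0 : ℝ), ENNReal.ofReal (r ^ (m + 1)) * F (r ^ 2) =
      2⁻¹ * ∫⁻ s in Set.Ioi (0 : ℝ), ENNReal.ofReal (s ^ ((m : ℝ) / 2)) * F s := by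
  have himg : (fun r : ℝ => r ^ 2) '' Set.Ioi 0 = Set.Ioi 0 := by
    ext s
    constructor
    · rintro ⟨r, hr, rfl⟩
      exact pow_pos (Set.mem_Ioi.1 hr) 2
    · intro hs
      exact ⟨√s, Real.sqrt_pos.2 hs, Real.sq_sqrt (le_of_lt hs)⟩
  have h := lintegral_image_eq_lintegral_abs_deriv_mul (s := Set.Ioi (0 : ℝ))
    (f := fun r => r ^ 2) (f' := fun r => 2 * r) measurableSet_Ioi
    (fun x _ => by simpa using (hasDerivAt_pow 2 x).hasDerivWithinAt)
    (fun x hx y hy hxy => (pow_left_inj₀ (le_of_lt hx) (le_of_lt hy) two_ne_zero).1 hxy)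
    (fun s => ENNReal.ofReal (s ^ ((m : ℝ) / 2)) * F s)
  rw [himg] at h
  rw [h, ← lintegral_const_mul' _ _ (by simp)]
  refine setLIntegral_congr_fun measurableSet_Ioi fun r hr => ?_
  have hr0 : (0 : ℝ) < r := hr
  rw [abs_of_pos (by positivity), ← mul_assoc, ← mul_assoc]
  congr 1
  rw [show (2⁻¹ : ℝ≥0∞) = ENNReal.ofReal 2⁻¹ by
    rw [ENNReal.ofReal_inv_of_pos two_pos, ENNReal.ofReal_ofNat],
    ← ENNReal.ofReal_mul (by positivity), ← ENNReal.ofReal_mul (by positivity)]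
  congr 1
  rw [← Real.rpow_natCast r 2, ← Real.rpow_mul hr0.le,
    show ((2 : ℕ) : ℝ) * ((m : ℝ) / 2) = (m : ℝ) by push_cast; ring, Real.rpow_natCast]
  ring

/-- The substitution `α = cos θ`. -/
lemma lintegral_sin_pow_mul_comp_cos (m : ℕ) (F : ℝ → ℝ≥0∞) :
    ∫⁻ θ in Set.Ioo (0 : ℝ) Real.pi, ENNReal.ofReal (Real.sin θ ^ m) * F (Real.cos θ) =
      ∫⁻ α in Set.Ioo (-1 : ℝ) 1, ENNReal.ofReal ((1 - α ^ 2) ^ (((m : ℝ) - 1) / 2)) * F α := by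
  have himg : Real.cos '' Set.Ioo 0 Real.pi = Set.Ioo (-1) 1 := by
    ext α
    constructor
    · rintro ⟨θ, hθ, rfl⟩
      have hs := Real.sin_pos_of_pos_of_lt_pi hθ.1 hθ.2
      have := Real.sin_sq_add_cos_sq θ
      constructor <;> nlinarith
    · intro hα
      refine ⟨Real.arccos α, ⟨Real.arccos_pos.2 hα.2, ?_⟩, Real.cos_arccos hα.1.le hα.2.le⟩
      refine lt_of_le_of_ne (Real.arccos_le_pi α) fun h => ?_
      rw [Real.arccos_eq_pi] at h
      exact absurd hα.1 (not_lt.2 h)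
  have h := lintegral_image_eq_lintegral_abs_deriv_mul (s := Set.Ioo (0 : ℝ) Real.pi)
    (f := Real.cos) (f' := fun θ => -Real.sin θ) measurableSet_Ioo
    (fun x _ => (Real.hasDerivAt_cos x).hasDerivWithinAt)
    (Real.injOn_cos.mono Set.Ioo_subset_Icc_self)
    (fun α => ENNReal.ofReal ((1 - α ^ 2) ^ (((m : ℝ) - 1) / 2)) * F α)
  rw [himg] at h
  rw [h]
  refine setLIntegral_congr_fun measurableSet_Ioo fun θ hθ => ?_
  have hs := Real.sin_pos_of_pos_of_lt_pi hθ.1 hθ.2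
  rw [abs_neg, abs_of_pos hs, ← mul_assoc, ← ENNReal.ofReal_mul hs.le]
  congr 2
  rw [← Real.sin_sq, ← Real.rpow_natCast _ 2, ← Real.rpow_mul hs.le,
    show ((2 : ℕ) : ℝ) * (((m : ℝ) - 1) / 2) = (m : ℝ) - 1 by push_cast; ring,
    Real.rpow_sub_one hs.ne', Real.rpow_natCast]
  field_simp

/-- Half-plane polar coordinates. -/
lemma lintegral_half_plane (m : ℕ) {F : ℝ → ℝ → ℝ≥0∞} (hF : Measurable (Function.uncurry F)) :
    ∫⁻ u : ℝ, ∫⁻ ρ in Set.Ioi (0 : ℝ), ENNReal.ofReal (ρ ^ m) *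
        F (u ^ 2 + ρ ^ 2) (u / √(u ^ 2 + ρ ^ 2)) =
      2⁻¹ * ∫⁻ t in Set.Ioi (0 : ℝ), ENNReal.ofReal (t ^ ((m : ℝ) / 2)) *
        ∫⁻ α in Set.Ioo (-1 : ℝ) 1, ENNReal.ofReal ((1 - α ^ 2) ^ (((m : ℝ) - 1) / 2)) *
          F t α := by
  have hF' : ∀ {a b : ℝ × ℝ → ℝ}, Measurable a → Measurable b →
      Measurable fun p => F (a p) (b p) := fun ha hb => hF.comp (ha.prodMk hb)
  -- Extending by zero to the lower half-plane permits full polar coordinates; only angles in `(0,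
  -- π)` then contribute.
  set g : ℝ × ℝ → ℝ≥0∞ := fun p => (Set.univ ×ˢ Set.Ioi (0 : ℝ)).indicator
    (fun p => ENNReal.ofReal (p.2 ^ m) * F (p.1 ^ 2 + p.2 ^ 2) (p.1 / √(p.1 ^ 2 + p.2 ^ 2))) p
  have hgm : Measurable g := by
    refine Measurable.indicator ?_ (MeasurableSet.univ.prod measurableSet_Ioi)
    exact Measurable.mul (by fun_prop) (hF' (by fun_prop) (by fun_prop))
  have h1 : ∫⁻ u : ℝ, ∫⁻ ρ in Set.Ioi (0 : ℝ), ENNReal.ofReal (ρ ^ m) *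
        F (u ^ 2 + ρ ^ 2) (u / √(u ^ 2 + ρ ^ 2)) = ∫⁻ p, g p := by
    rw [Measure.volume_eq_prod, lintegral_prod _ hgm.aemeasurable]
    refine lintegral_congr fun u => ?_
    rw [← lintegral_indicator measurableSet_Ioi]
    refine lintegral_congr fun ρ => ?_
    by_cases h : 0 < ρ <;> simp [g, Set.indicator, h]
  have h2 : polarCoord.target = Set.Ioi (0 : ℝ) ×ˢ Set.Ioo (-Real.pi) Real.pi := rfl
  rw [h1, ← lintegral_comp_polarCoord_symm, h2, Measure.volume_eq_prod,
    ← Measure.prod_restrict, lintegral_prod]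
  · rw [← lintegral_pow_mul_comp_sq]
    refine setLIntegral_congr_fun measurableSet_Ioi fun r hr => ?_
    have hr0 : (0 : ℝ) < r := hr
    simp only
    rw [← lintegral_sin_pow_mul_comp_cos, ← lintegral_const_mul' _ _ ENNReal.ofReal_ne_top,
      ← lintegral_indicator measurableSet_Ioo, ← lintegral_indicator measurableSet_Ioo]
    refine lintegral_congr fun θ => ?_
    have hsq : (r * Real.cos θ) ^ 2 + (r * Real.sin θ) ^ 2 = r ^ 2 := by
      have := Real.sin_sq_add_cos_sq θ
      linear_combination r ^ 2 * this
    by_cases hθ : θ ∈ Set.Ioo 0 Real.pi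
    · have hs := Real.sin_pos_of_pos_of_lt_pi hθ.1 hθ.2
      have hθ' : θ ∈ Set.Ioo (-Real.pi) Real.pi := ⟨by linarith [hθ.1, Real.pi_pos], hθ.2⟩
      rw [Set.indicator_of_mem hθ, Set.indicator_of_mem hθ']
      simp only [g, polarCoord_symm_apply]
      rw [Set.indicator_of_mem (by simpa using mul_pos hr0 hs)]
      simp only [hsq]
      rw [Real.sqrt_sq hr0.le, mul_div_cancel_left₀ _ hr0.ne', smul_eq_mul, ← mul_assoc,
        ← mul_assoc, ← ENNReal.ofReal_mul hr0.le, ← ENNReal.ofReal_mul (by positivity)]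
      congr 2
      ring
    · rw [Set.indicator_of_notMem hθ]
      by_cases hθ' : θ ∈ Set.Ioo (-Real.pi) Real.pi
      · rw [Set.indicator_of_mem hθ']
        have hs : Real.sin θ ≤ 0 := by
          refine Real.sin_nonpos_of_nonpos_of_neg_pi_le ?_ hθ'.1.le
          by_contra h
          exact hθ ⟨not_le.1 h, hθ'.2⟩
        have : ¬ 0 < r * Real.sin θ := not_lt.2 (mul_nonpos_of_nonneg_of_nonpos hr0.le hs)
        simp [g, polarCoord_symm_apply, this]
      · rw [Set.indicator_of_notMem hθ']
  · refine Measurable.aemeasurable ?_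
    simp only [polarCoord_symm_apply, smul_eq_mul]
    exact Measurable.mul (by fun_prop) (hgm.comp (by fun_prop))

/-- The volume of the unit sphere in `k` dimensions, `k` times the volume of the unit ball. -/
noncomputable def sphereVolume (k : ℕ) : ℝ≥0∞ :=
  k * volume (Metric.ball (0 : EuclideanSpace ℝ (Fin k)) 1)

lemma sphereVolume_ne_top (k : ℕ) : sphereVolume k ≠ ∞ :=
  ENNReal.mul_ne_top (ENNReal.natCast_ne_top _) measure_ball_lt_top.ne

lemma lintegral_normSq_euclidean (m : ℕ) {F : ℝ → ℝ≥0∞} (hF : Measurable F) :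
    ∫⁻ x : EuclideanSpace ℝ (Fin (m + 2)), F (‖x‖ ^ 2) = sphereVolume (m + 2) * (2⁻¹ *
      ∫⁻ s in Set.Ioi (0 : ℝ), ENNReal.ofReal (s ^ ((m : ℝ) / 2)) * F s) := by
  rw [lintegral_fun_norm_addHaar volume (f := fun r => F (r ^ 2)) (hF.comp (by fun_prop)),
    finrank_euclideanSpace_fin, ← lintegral_pow_mul_comp_sq]
  rfl

/-- Splitting off coordinate `0` leaves `m + 1` coordinates. Polar integration over these gives the
weight `ρ ^ m` on a half-plane, where `lintegral_half_plane` applies. -/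
lemma lintegral_first_coordinate (m : ℕ) {F : ℝ → ℝ → ℝ≥0∞}
    (hF : Measurable (Function.uncurry F)) :
    ∫⁻ y : EuclideanSpace ℝ (Fin (m + 2)), F (‖y‖ ^ 2) (y 0 / ‖y‖) =
      sphereVolume (m + 1) * (2⁻¹ * ∫⁻ t in Set.Ioi (0 : ℝ), ENNReal.ofReal (t ^ ((m : ℝ) / 2)) *
        ∫⁻ α in Set.Ioo (-1 : ℝ) 1, ENNReal.ofReal ((1 - α ^ 2) ^ (((m : ℝ) - 1) / 2)) *
          F t α) := by
  have hF' : ∀ {ι : Type} [MeasurableSpace ι] {a b : ι → ℝ}, Measurable a → Measurable b →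
      Measurable fun p => F (a p) (b p) := fun ha hb => hF.comp (ha.prodMk hb)
  have e1 := (PiLp.volume_preserving_toLp (Fin (m + 2))).lintegral_comp
    (f := fun y : EuclideanSpace ℝ (Fin (m + 2)) => F (‖y‖ ^ 2) (y 0 / ‖y‖))
    (hF' (by fun_prop) (by fun_prop))
  have e2 := ((volume_preserving_piFinSuccAbove (fun _ : Fin (m + 2) => ℝ) 0).symm).lintegral_comp
    (f := fun y : Fin (m + 2) → ℝ => F (‖WithLp.toLp 2 y‖ ^ 2) (y 0 / ‖WithLp.toLp 2 y‖))
    (hF' (by fun_prop) (by fun_prop))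
  have hnorm : ∀ p : ℝ × (Fin (m + 1) → ℝ), ‖WithLp.toLp 2 ((MeasurableEquiv.piFinSuccAbove
      (fun _ : Fin (m + 2) => ℝ) 0).symm p)‖ ^ 2 = p.1 ^ 2 + ‖WithLp.toLp 2 p.2‖ ^ 2 := by
    intro p
    rw [EuclideanSpace.norm_sq_eq, EuclideanSpace.norm_sq_eq, Fin.sum_univ_succ]
    simp [MeasurableEquiv.piFinSuccAbove]
  have hzero : ∀ p : ℝ × (Fin (m + 1) → ℝ), (MeasurableEquiv.piFinSuccAbove
      (fun _ : Fin (m + 2) => ℝ) 0).symm p 0 = p.1 := by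
    intro p
    simp [MeasurableEquiv.piFinSuccAbove]
  have hnorm' : ∀ p : ℝ × (Fin (m + 1) → ℝ), ‖WithLp.toLp 2 ((MeasurableEquiv.piFinSuccAbove
      (fun _ : Fin (m + 2) => ℝ) 0).symm p)‖ = √(p.1 ^ 2 + ‖WithLp.toLp 2 p.2‖ ^ 2) := by
    intro p
    rw [← hnorm, Real.sqrt_sq (norm_nonneg _)]
  have hmeas : Measurable fun p : ℝ × EuclideanSpace ℝ (Fin (m + 1)) =>
      F (p.1 ^ 2 + ‖p.2‖ ^ 2) (p.1 / √(p.1 ^ 2 + ‖p.2‖ ^ 2)) := hF' (by fun_prop) (by fun_prop)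
  rw [← e1, ← e2]
  have hsq : ∀ p : ℝ × (Fin (m + 1) → ℝ), √(p.1 ^ 2 + ‖WithLp.toLp 2 p.2‖ ^ 2) ^ 2 =
      p.1 ^ 2 + ‖WithLp.toLp 2 p.2‖ ^ 2 := fun p => Real.sq_sqrt (by positivity)
  simp only [hzero, hnorm', hsq]
  rw [Measure.volume_eq_prod, lintegral_prod _ (hF' (by fun_prop) (by fun_prop)).aemeasurable,
    ← lintegral_half_plane m hF, ← lintegral_const_mul' _ _ (sphereVolume_ne_top _)]
  refine lintegral_congr fun u => ?_
  simp only
  have e3 := (PiLp.volume_preserving_toLp (Fin (m + 1))).lintegral_comp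
    (f := fun z : EuclideanSpace ℝ (Fin (m + 1)) =>
      F (u ^ 2 + ‖z‖ ^ 2) (u / √(u ^ 2 + ‖z‖ ^ 2))) (hF' (by fun_prop) (by fun_prop))
  rw [e3, lintegral_fun_norm_addHaar volume (f := fun ρ => F (u ^ 2 + ρ ^ 2)
    (u / √(u ^ 2 + ρ ^ 2))) (hF' (by fun_prop) (by fun_prop)), finrank_euclideanSpace_fin]
  rfl

/-- By rotation invariance, `e` may be taken to be the first vector of an orthonormal basis. -/
lemma lintegral_direction (m : ℕ) {e : EuclideanSpace ℝ (Fin (m + 2))} (he : ‖e‖ = 1)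
    {F : ℝ → ℝ → ℝ≥0∞} (hF : Measurable (Function.uncurry F)) :
    ∫⁻ y : EuclideanSpace ℝ (Fin (m + 2)), F (‖y‖ ^ 2) (⟪e, y⟫ / ‖y‖) =
      sphereVolume (m + 1) * (2⁻¹ * ∫⁻ t in Set.Ioi (0 : ℝ), ENNReal.ofReal (t ^ ((m : ℝ) / 2)) *
        ∫⁻ α in Set.Ioo (-1 : ℝ) 1, ENNReal.ofReal ((1 - α ^ 2) ^ (((m : ℝ) - 1) / 2)) *
          F t α) := by
  have hF' : ∀ {ι : Type} [MeasurableSpace ι] {a b : ι → ℝ}, Measurable a → Measurable b →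
      Measurable fun p => F (a p) (b p) := fun ha hb => hF.comp (ha.prodMk hb)
  obtain ⟨b, hb⟩ := Orthonormal.exists_orthonormalBasis_extension_of_card_eq (𝕜 := ℝ)
    (E := EuclideanSpace ℝ (Fin (m + 2))) (ι := Fin (m + 2)) (by simp) (v := fun _ => e)
    (s := {0}) (by
      refine ⟨fun i => he, fun i j hij => absurd (Subsingleton.elim i j) hij⟩)
  have hb0 : b 0 = e := hb 0 rfl
  rw [← lintegral_first_coordinate m hF, ← b.measurePreserving_repr.lintegral_comp
    (f := fun y : EuclideanSpace ℝ (Fin (m + 2)) => F (‖y‖ ^ 2) (y 0 / ‖y‖))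
    (hF' (by fun_prop) (by fun_prop))]
  refine lintegral_congr fun y => ?_
  rw [LinearIsometryEquiv.norm_map, b.repr_apply_apply, hb0]

/-- Integration of a function of the Gram matrix of a pair of vectors. -/
theorem lintegral_gram (m : ℕ) {F : ℝ × ℝ × ℝ → ℝ≥0∞} (hF : Measurable F) :
    ∫⁻ p : EuclideanSpace ℝ (Fin (m + 2)) × EuclideanSpace ℝ (Fin (m + 2)),
      F (‖p.1‖ ^ 2, ‖p.2‖ ^ 2, ⟪p.1, p.2⟫ / (‖p.1‖ * ‖p.2‖)) =
    sphereVolume (m + 2) * (2⁻¹ * (sphereVolume (m + 1) * 2⁻¹)) *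
      ∫⁻ s in Set.Ioi (0 : ℝ), ENNReal.ofReal (s ^ ((m : ℝ) / 2)) *
        ∫⁻ t in Set.Ioi (0 : ℝ), ENNReal.ofReal (t ^ ((m : ℝ) / 2)) *
          ∫⁻ α in Set.Ioo (-1 : ℝ) 1, ENNReal.ofReal ((1 - α ^ 2) ^ (((m : ℝ) - 1) / 2)) *
            F (s, t, α) := by
  set J : ℝ → ℝ≥0∞ := fun s => ∫⁻ t in Set.Ioi (0 : ℝ), ENNReal.ofReal (t ^ ((m : ℝ) / 2)) *
          ∫⁻ α in Set.Ioo (-1 : ℝ) 1, ENNReal.ofReal ((1 - α ^ 2) ^ (((m : ℝ) - 1) / 2)) *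
            F (s, t, α) with hJ
  have hJm : Measurable J := by
    refine Measurable.lintegral_prod_right' (f := fun p : ℝ × ℝ => ENNReal.ofReal
      (p.2 ^ ((m : ℝ) / 2)) * ∫⁻ α in Set.Ioo (-1 : ℝ) 1, ENNReal.ofReal ((1 - α ^ 2) ^
        (((m : ℝ) - 1) / 2)) * F (p.1, p.2, α)) ?_
    refine Measurable.mul (by fun_prop) ?_
    refine Measurable.lintegral_prod_right' (f := fun q : (ℝ × ℝ) × ℝ => ENNReal.ofReal
      ((1 - q.2 ^ 2) ^ (((m : ℝ) - 1) / 2)) * F (q.1.1, q.1.2, q.2)) ?_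
    exact Measurable.mul (by fun_prop) (hF.comp (by fun_prop))
  rw [Measure.volume_eq_prod, lintegral_prod _ (by
    refine Measurable.aemeasurable (hF.comp ?_)
    fun_prop)]
  have h1 : ∀ᵐ x : EuclideanSpace ℝ (Fin (m + 2)), ∫⁻ y : EuclideanSpace ℝ (Fin (m + 2)),
      F (‖x‖ ^ 2, ‖y‖ ^ 2, ⟪x, y⟫ / (‖x‖ * ‖y‖)) =
        (sphereVolume (m + 1) * 2⁻¹) * J (‖x‖ ^ 2) := by
    -- For fixed `x` the vector `y` is integrated relative to the direction of `x`, which exists off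
    -- a null set.
    have h0 : ∀ᵐ x : EuclideanSpace ℝ (Fin (m + 2)), x ≠ 0 := by
      simp [ae_iff]
    refine h0.mono fun x hx => ?_
    have hx' : ‖x‖ ≠ 0 := norm_ne_zero_iff.2 hx
    rw [mul_assoc, hJ, ← lintegral_direction m (e := ‖x‖⁻¹ • x) (by
      rw [norm_smul, norm_inv, norm_norm, inv_mul_cancel₀ hx'])
      (F := fun t α => F (‖x‖ ^ 2, t, α)) (hF.comp (by fun_prop))]
    refine lintegral_congr fun y => ?_
    rw [real_inner_smul_left]
    congr 3
    rw [div_mul_eq_div_div, div_eq_inv_mul _ ‖x‖]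
  rw [lintegral_congr_ae h1, lintegral_const_mul' _ _
    (ENNReal.mul_ne_top (sphereVolume_ne_top _) (by simp)),
    lintegral_normSq_euclidean m hJm]
  ring

end PolarIntegration

/-! ### The push-forward of Lebesgue measure under Gram coordinates. -/

section GramTriple

open scoped ENNReal RealInnerProductSpace

/-- The real and the imaginary part of a complex vector, as Euclidean vectors. -/
noncomputable def reImPair {n : ℕ} (φ : Fin n → ℂ) :
    EuclideanSpace ℝ (Fin n) × EuclideanSpace ℝ (Fin n) :=
  (WithLp.toLp 2 fun i => (φ i).re, WithLp.toLp 2 fun i => (φ i).im)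

lemma measurePreserving_reImPair (n : ℕ) :
    MeasurePreserving (reImPair : (Fin n → ℂ) → _) volume volume := by
  have h1 : MeasurePreserving (fun (φ : Fin n → ℂ) i => Complex.measurableEquivRealProd (φ i))
      volume volume :=
    volume_preserving_pi fun _ => Complex.volume_preserving_equiv_real_prod
  have h2 := volume_measurePreserving_arrowProdEquivProdArrow ℝ ℝ (Fin n)
  have h3 := (PiLp.volume_preserving_toLp (Fin n)).prod (PiLp.volume_preserving_toLp (Fin n))
  exact (h3.comp (h2.comp h1))

/-- The squared norms of the real and imaginary part of a vector, and the cosine of their angle. -/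
noncomputable def gramTriple {n : ℕ} (φ : Fin n → ℂ) : ℝ × ℝ × ℝ :=
  (‖(reImPair φ).1‖ ^ 2, ‖(reImPair φ).2‖ ^ 2,
    ⟪(reImPair φ).1, (reImPair φ).2⟫ / (‖(reImPair φ).1‖ * ‖(reImPair φ).2‖))

lemma measurable_gramTriple (n : ℕ) : Measurable (gramTriple : (Fin n → ℂ) → _) := by
  have := (measurePreserving_reImPair n).measurable
  unfold gramTriple
  fun_prop

/-- The measure `s ^ (m / 2) ds` on the positive half-line. -/
noncomputable def radialMeasure (m : ℕ) : Measure ℝ :=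
  (volume.restrict (Set.Ioi 0)).withDensity fun s => ENNReal.ofReal (s ^ ((m : ℝ) / 2))

/-- The measure `(1 - α ^ 2) ^ ((m - 1) / 2) dα` on `(-1, 1)`. -/
noncomputable def angularMeasure (m : ℕ) : Measure ℝ :=
  (volume.restrict (Set.Ioo (-1) 1)).withDensity
    fun α => ENNReal.ofReal ((1 - α ^ 2) ^ (((m : ℝ) - 1) / 2))

instance (m : ℕ) : SFinite (radialMeasure m) := by unfold radialMeasure; infer_instance
instance (m : ℕ) : SFinite (angularMeasure m) := by unfold angularMeasure; infer_instance

lemma lintegral_radialMeasure (m : ℕ) {f : ℝ → ℝ≥0∞} (hf : Measurable f) :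
    ∫⁻ s, f s ∂radialMeasure m =
      ∫⁻ s in Set.Ioi 0, ENNReal.ofReal (s ^ ((m : ℝ) / 2)) * f s := by
  rw [radialMeasure, lintegral_withDensity_eq_lintegral_mul _ (by fun_prop) hf]
  rfl

lemma lintegral_angularMeasure (m : ℕ) {f : ℝ → ℝ≥0∞} (hf : Measurable f) :
    ∫⁻ α, f α ∂angularMeasure m =
      ∫⁻ α in Set.Ioo (-1) 1, ENNReal.ofReal ((1 - α ^ 2) ^ (((m : ℝ) - 1) / 2)) * f α := by
  rw [angularMeasure, lintegral_withDensity_eq_lintegral_mul _ (by fun_prop) hf]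
  rfl

lemma integral_radialMeasure (m : ℕ) (f : ℝ → ℂ) :
    ∫ s, f s ∂radialMeasure m = ∫ s in Set.Ioi 0, ((s ^ ((m : ℝ) / 2) : ℝ) : ℂ) * f s := by
  rw [radialMeasure, integral_withDensity_eq_integral_toReal_smul (by fun_prop) (by simp)]
  refine setIntegral_congr_fun measurableSet_Ioi fun s hs => ?_
  simp only [Set.mem_Ioi] at hs
  rw [ENNReal.toReal_ofReal (by positivity), Complex.real_smul]

lemma integral_angularMeasure (m : ℕ) (f : ℝ → ℂ) :
    ∫ α, f α ∂angularMeasure m =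
      ∫ α in Set.Ioo (-1) 1, (((1 - α ^ 2) ^ (((m : ℝ) - 1) / 2) : ℝ) : ℂ) * f α := by
  rw [angularMeasure, integral_withDensity_eq_integral_toReal_smul (by fun_prop) (by simp)]
  refine setIntegral_congr_fun measurableSet_Ioo fun α hα => ?_
  have : 0 < 1 - α ^ 2 := by nlinarith [hα.1, hα.2]
  rw [ENNReal.toReal_ofReal (by positivity), Complex.real_smul]

/-- The total angular mass of pairs of vectors in `ℝ ^ (m + 2)`, in the coordinates of
`gramTriple`. -/
noncomputable def gramConstant (m : ℕ) : ℝ≥0∞ :=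
  sphereVolume (m + 2) * (2⁻¹ * (sphereVolume (m + 1) * 2⁻¹))

lemma map_gramTriple (m : ℕ) :
    (volume : Measure (Fin (m + 2) → ℂ)).map gramTriple = gramConstant m •
      (radialMeasure m).prod ((radialMeasure m).prod (angularMeasure m)) := by
  refine Measure.ext_of_lintegral _ fun F hF => ?_
  rw [lintegral_map hF (measurable_gramTriple _), lintegral_smul_measure, smul_eq_mul,
    lintegral_prod _ hF.aemeasurable]
  refine ((measurePreserving_reImPair (m + 2)).lintegral_comp
    (f := fun p => F (‖p.1‖ ^ 2, ‖p.2‖ ^ 2, ⟪p.1, p.2⟫ / (‖p.1‖ * ‖p.2‖))) ?_).trans ?_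
  · fun_prop
  rw [lintegral_gram m hF, gramConstant]
  congr 1
  rw [lintegral_radialMeasure m (hF.lintegral_prod_right')]
  refine lintegral_congr fun s => ?_
  congr 1
  have hFs : Measurable fun q : ℝ × ℝ => F (s, q) := hF.comp (by fun_prop)
  rw [lintegral_prod _ hFs.aemeasurable, lintegral_radialMeasure m (hFs.lintegral_prod_right')]
  refine lintegral_congr fun t => ?_
  congr 1
  exact (lintegral_angularMeasure m (hFs.comp (by fun_prop : Measurable fun α => (t, α)))).symm

lemma gramConstant_ne_top (m : ℕ) : gramConstant m ≠ ⊤ := by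
  have := sphereVolume_ne_top (m + 2)
  have := sphereVolume_ne_top (m + 1)
  unfold gramConstant
  finiteness

/-- A function of the Gram matrix of the real and imaginary part is integrated by an iterated
integral. -/
theorem integral_comp_gramTriple (m : ℕ) {F : ℝ × ℝ × ℝ → ℂ} (hF : Measurable F)
    (hi : Integrable fun φ : Fin (m + 2) → ℂ => F (gramTriple φ)) :
    ∫ φ : Fin (m + 2) → ℂ, F (gramTriple φ) = ((gramConstant m).toReal : ℂ) *
      ∫ s in Set.Ioi (0 : ℝ), ∫ t in Set.Ioi (0 : ℝ), ∫ α in Set.Ioo (-1 : ℝ) 1,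
        ((s ^ ((m : ℝ) / 2) : ℝ) : ℂ) * ((t ^ ((m : ℝ) / 2) : ℝ) : ℂ) *
          (((1 - α ^ 2) ^ (((m : ℝ) - 1) / 2) : ℝ) : ℂ) * F (s, t, α) := by
  -- Integrability can be transferred through a scaled measure only when the scalar is nonzero; if
  -- it were zero, both sides would vanish.
  by_cases hC : gramConstant m = 0
  · have h0 : (volume : Measure (Fin (m + 2) → ℂ)).map gramTriple = 0 := by
      rw [map_gramTriple, hC, zero_smul]
    rw [← integral_map (measurable_gramTriple _).aemeasurable hF.aestronglyMeasurable, h0, hC]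
    simp
  have hi' : Integrable F ((radialMeasure m).prod ((radialMeasure m).prod (angularMeasure m))) := by
    rw [← integrable_smul_measure hC (gramConstant_ne_top m), ← map_gramTriple]
    exact (integrable_map_measure hF.aestronglyMeasurable
      (measurable_gramTriple _).aemeasurable).2 hi
  rw [← integral_map (measurable_gramTriple _).aemeasurable hF.aestronglyMeasurable,
    map_gramTriple, integral_smul_measure, Complex.real_smul]
  congr 1
  rw [integral_prod _ hi', integral_radialMeasure]
  have hae : ∀ᵐ s ∂radialMeasure m, ∫ q, F (s, q) ∂(radialMeasure m).prod (angularMeasure m) =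
      ∫ t, ∫ α, F (s, t, α) ∂angularMeasure m ∂radialMeasure m := by
    filter_upwards [hi'.prod_right_ae] with s hs using integral_prod _ hs
  rw [← integral_radialMeasure, integral_congr_ae hae, integral_radialMeasure]
  refine integral_congr_ae (.of_forall fun s => ?_)
  dsimp only
  rw [integral_radialMeasure, ← integral_const_mul]
  refine integral_congr_ae (.of_forall fun t => ?_)
  dsimp only
  rw [integral_angularMeasure, ← integral_const_mul, ← integral_const_mul]
  refine integral_congr_ae (.of_forall fun α => ?_)
  dsimp only
  ring

lemma toReal_sphereVolume (k : ℕ) : (sphereVolume (k + 1)).toReal =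
    2 * √Real.pi ^ (k + 1) / Real.Gamma (((k : ℝ) + 1) / 2) := by
  have hG : Real.Gamma (((k : ℝ) + 1) / 2) ≠ 0 := (Real.Gamma_pos_of_pos (by positivity)).ne'
  have h0 : ((k : ℝ) + 1) / 2 ≠ 0 := by positivity
  rw [sphereVolume, EuclideanSpace.volume_ball, ENNReal.ofReal_one, one_pow, one_mul,
    Fintype.card_fin, ENNReal.toReal_mul, ENNReal.toReal_natCast, ENNReal.toReal_ofReal (by
      have := Real.Gamma_pos_of_pos (s := ((k + 1 : ℕ) : ℝ) / 2 + 1) (by positivity)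
      positivity)]
  push_cast
  rw [Real.Gamma_add_one h0]
  field_simp

/-- The areas of the spheres in dimensions `m + 2` and `m + 1` involve Gamma values at arguments
half a unit apart, which Legendre's duplication formula merges into `m!`. -/
lemma toReal_gramConstant (m : ℕ) :
    (gramConstant m).toReal = Real.pi ^ (m + 1) * 2 ^ m / m.factorial := by
  have h := Real.Gamma_mul_Gamma_add_half (((m : ℝ) + 1) / 2)
  have e1 : ((m : ℝ) + 1) / 2 + 1 / 2 = (((m + 1 : ℕ) : ℝ) + 1) / 2 := by push_cast; ring
  have e2 : 2 * (((m : ℝ) + 1) / 2) = m + 1 := by ring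
  have e3 : (2 : ℝ) ^ (1 - ((m : ℝ) + 1)) = (2 ^ m)⁻¹ := by
    rw [show 1 - ((m : ℝ) + 1) = -(m : ℝ) by ring, Real.rpow_neg zero_le_two, Real.rpow_natCast]
  rw [e1, e2, e3, Real.Gamma_nat_eq_factorial] at h
  have hG : Real.Gamma (((m : ℝ) + 1) / 2) ≠ 0 := (Real.Gamma_pos_of_pos (by positivity)).ne'
  have hG' : Real.Gamma ((((m + 1 : ℕ) : ℝ) + 1) / 2) ≠ 0 :=
    (Real.Gamma_pos_of_pos (by positivity)).ne'
  have hm : (m.factorial : ℝ) ≠ 0 := by positivity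
  have hp : √Real.pi ≠ 0 := by positivity
  rw [gramConstant, ENNReal.toReal_mul, ENNReal.toReal_mul, ENNReal.toReal_mul,
    toReal_sphereVolume, toReal_sphereVolume, ENNReal.toReal_inv, ENNReal.toReal_ofNat]
  have hpi : Real.pi ^ (m + 1) * √Real.pi = √Real.pi ^ (m + 1 + 1) * √Real.pi ^ (m + 1) := by
    nth_rewrite 1 [← Real.sq_sqrt Real.pi_pos.le]
    ring
  field_simp at h ⊢
  linear_combination -(m.factorial : ℝ) * hpi - Real.pi ^ (m + 1) * h

end GramTriple

/-! ### The averaged integrand in Gram coordinates. -/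

section GramIntegrand

open scoped RealInnerProductSpace

variable {n : ℕ}

lemma sqNorm_gramTriple (φ : Fin n → ℂ) :
    sqNorm φ = ((gramTriple φ).1 : ℂ) + ((gramTriple φ).2.1 : ℂ) := by
  simp only [sqNorm, gramTriple, reImPair, EuclideanSpace.norm_sq_eq, Complex.normSq_apply,
    Real.norm_eq_abs, sq_abs]
  push_cast
  rw [← Finset.sum_add_distrib]
  exact Finset.sum_congr rfl fun i _ => by ring

lemma dotProduct_self_gramTriple (φ : Fin n → ℂ) :
    φ ⬝ᵥ φ = ((gramTriple φ).1 : ℂ) - ((gramTriple φ).2.1 : ℂ) +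
      2 * (⟪(reImPair φ).1, (reImPair φ).2⟫ : ℂ) * Complex.I := by
  simp only [dotProduct, gramTriple, reImPair, EuclideanSpace.norm_sq_eq,
    Real.norm_eq_abs, sq_abs, PiLp.inner_apply, RCLike.inner_apply, conj_trivial]
  push_cast
  rw [← Finset.sum_sub_distrib, Finset.mul_sum, Finset.sum_mul, ← Finset.sum_add_distrib]
  refine Finset.sum_congr rfl fun i _ => ?_
  nth_rewrite 1 2 [← Complex.re_add_im (φ i)]
  linear_combination ((φ i).im : ℂ) ^ 2 * Complex.I_sq

lemma inner_sq_gramTriple (φ : Fin n → ℂ) :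
    ⟪(reImPair φ).1, (reImPair φ).2⟫ ^ 2 =
      (gramTriple φ).1 * (gramTriple φ).2.1 * (gramTriple φ).2.2 ^ 2 := by
  simp only [gramTriple]
  -- If either vector vanishes, the cosine is a division by zero, but both sides are zero.
  by_cases hx : (reImPair φ).1 = 0
  · simp [hx]
  by_cases hy : (reImPair φ).2 = 0
  · simp [hy]
  have hx' := norm_ne_zero_iff.2 hx
  have hy' := norm_ne_zero_iff.2 hy
  field_simp

/-- With `φ = x + iy` one has `φᵀφ = s - t + 2i⟨x, y⟩`, so its squared modulus is `(s - t)² +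
4stα²`. -/
lemma dotProduct_star_mul_gramTriple (φ : Fin n → ℂ) :
    (star φ ⬝ᵥ star φ) * (φ ⬝ᵥ φ) = (((gramTriple φ).1 : ℂ) + ((gramTriple φ).2.1 : ℂ)) ^ 2 -
      4 * ((gramTriple φ).1 : ℂ) * ((gramTriple φ).2.1 : ℂ) *
        (1 - ((gramTriple φ).2.2 : ℂ) ^ 2) := by
  have h := congrArg (fun x : ℝ => (x : ℂ)) (inner_sq_gramTriple φ)
  push_cast at h
  have hs : star φ ⬝ᵥ star φ = star (φ ⬝ᵥ φ) := by simp [dotProduct]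
  rw [hs, dotProduct_self_gramTriple]
  simp only [star_add, star_sub, star_mul', Complex.star_def, Complex.conj_ofReal, Complex.conj_I,
    map_ofNat]
  linear_combination 4 * h - 4 * (⟪(reImPair φ).1, (reImPair φ).2⟫ : ℂ) ^ 2 * Complex.I_sq

/-- `averagedIntegrand` in the coordinates of `gramTriple`. -/
noncomputable def gramIntegrand (N : ℕ) (r : ℝ) (a : ℂ) (p : ℝ × ℝ × ℝ) : ℂ :=
  Complex.exp (-((N : ℂ) * Complex.I * a) * ((p.1 : ℂ) + (p.2.1 : ℂ))) *
    (Complex.exp (-((N : ℂ) / 2) * (((p.1 : ℂ) + (p.2.1 : ℂ)) ^ 2 + (1 - (r : ℂ)) *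
      (((p.1 : ℂ) + (p.2.1 : ℂ)) ^ 2 - 4 * (p.1 : ℂ) * (p.2.1 : ℂ) * (1 - (p.2.2 : ℂ) ^ 2)))) *
    averagedDet N (Complex.I * a) ((2 - (r : ℂ)) * ((p.1 : ℂ) + (p.2.1 : ℂ)))
      ((1 - (r : ℂ)) * (4 * (p.1 : ℂ) * (p.2.1 : ℂ) * (1 - (p.2.2 : ℂ) ^ 2))))

lemma averagedIntegrand_eq_gramIntegrand (r : ℝ) (a : ℂ) (φ : Fin n → ℂ) :
    averagedIntegrand n r a φ = gramIntegrand n r a (gramTriple φ) := by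
  unfold averagedIntegrand gramIntegrand averagedWeight
  rw [mul_assoc (1 - (r : ℂ)) (star φ ⬝ᵥ star φ), dotProduct_star_mul_gramTriple,
    sqNorm_gramTriple]
  congr 3
  ring

lemma continuous_gramIntegrand (N : ℕ) (r : ℝ) (a : ℂ) : Continuous (gramIntegrand N r a) := by
  unfold gramIntegrand averagedDet
  fun_prop

end GramIntegrand

/-! ### Matching the four-fold integral with the integral over `φ`. -/

section FourfoldIntegral

/-- The density of the polar coordinates `s`, `t` and `α`. -/
noncomputable def polarDensity (m : ℕ) (s t α : ℝ) : ℂ :=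
  ((s ^ ((m : ℝ) / 2) : ℝ) : ℂ) * ((t ^ ((m : ℝ) / 2) : ℝ) : ℂ) *
    (((1 - α ^ 2) ^ (((m : ℝ) - 1) / 2) : ℝ) : ℂ)

/-- The exponential factors of `gramIntegrand` and of the four-fold integrand that depend on
`s`, `t` and `α` only. -/
noncomputable def polarWeight (N : ℕ) (r : ℝ) (s t α : ℝ) : ℂ :=
  Complex.exp (-((N : ℂ) / 2) * (((s : ℂ) + (t : ℂ)) ^ 2 + (1 - (r : ℂ)) *
    (((s : ℂ) + (t : ℂ)) ^ 2 - 4 * (s : ℂ) * (t : ℂ) * (1 - (α : ℂ) ^ 2))))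

lemma cexp_half_mul_log (m : ℕ) {x : ℝ} (hx : 0 < x) :
    Complex.exp (((m + 2 : ℕ) : ℂ) * ((1 / 2) * (Real.log x : ℂ))) =
      ((x ^ ((m : ℝ) / 2) : ℝ) : ℂ) * (x : ℂ) := by
  rw [← Complex.ofReal_mul, ← Real.rpow_add_one hx.ne', Real.rpow_def_of_pos hx,
    Complex.ofReal_exp]
  congr 1
  push_cast
  ring

/-- Exponentiated logarithms become powers. With `N = m + 2`, the prefactors reduce `s^(N/2)` and
`t^(N/2)` to exponent `m/2`, bring `1 - α²` to exponent `(m-1)/2`, and leave a pole of order `m + 1`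
in `z`. -/
lemma unitIntegrand_eq (m : ℕ) (r : ℝ) (a : ℂ) {s t α : ℝ} (hs : 0 < s) (ht : 0 < t)
    (hα : α ∈ Set.Ioo (-1 : ℝ) 1) {z : ℂ} (hz : z ≠ 0) :
    unitIntegrand (m + 2) r a s t α z = polarDensity m s t α *
      Complex.exp (-(((m + 2 : ℕ) : ℂ) * Complex.I * a) * ((s : ℂ) + (t : ℂ))) *
      polarWeight (m + 2) r s t α *
      (bracketFactor (m + 2) r a s t α z * contourWeight (m + 2) (Complex.I * a) z /
        z ^ (m + 1)) := by
  have hα' : 0 < 1 - α ^ 2 := by nlinarith [hα.1, hα.2]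
  have hsc : (s : ℂ) ≠ 0 := by exact_mod_cast hs.ne'
  have htc : (t : ℂ) ≠ 0 := by exact_mod_cast ht.ne'
  have e1 : Complex.exp (((m + 2 : ℕ) : ℂ) * Complex.log z) = z * z ^ (m + 1) := by
    rw [Complex.exp_nat_mul, Complex.exp_log hz]
    ring
  have e2 : (((1 - α ^ 2) ^ (-(3 / 2) : ℝ) : ℝ) : ℂ) *
      (((1 - α ^ 2) ^ ((m : ℝ) / 2) : ℝ) : ℂ) * ((1 - α ^ 2 : ℝ) : ℂ) =
      (((1 - α ^ 2) ^ (((m : ℝ) - 1) / 2) : ℝ) : ℂ) := by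
    rw [← Complex.ofReal_mul, ← Complex.ofReal_mul, ← Real.rpow_add hα',
      ← Real.rpow_add_one hα'.ne']
    congr 2
    ring
  have h1 : Complex.exp (-((m + 2 : ℕ) : ℂ) * (Complex.I * a * ((s : ℂ) + (t : ℂ))
      + (1 - (r : ℂ) / 2) * ((s : ℂ) ^ 2 + (t : ℂ) ^ 2) + (r : ℂ) * (s : ℂ) * (t : ℂ)
      - (1 / 2) * (Real.log s : ℂ) - (1 / 2) * (Real.log t : ℂ))) =
      Complex.exp (-(((m + 2 : ℕ) : ℂ) * Complex.I * a) * ((s : ℂ) + (t : ℂ))) *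
      Complex.exp (-((m + 2 : ℕ) : ℂ) * ((1 - (r : ℂ) / 2) * ((s : ℂ) ^ 2 + (t : ℂ) ^ 2)
        + (r : ℂ) * (s : ℂ) * (t : ℂ))) *
      Complex.exp (((m + 2 : ℕ) : ℂ) * ((1 / 2) * (Real.log s : ℂ))) *
      Complex.exp (((m + 2 : ℕ) : ℂ) * ((1 / 2) * (Real.log t : ℂ))) := by
    rw [← Complex.exp_add, ← Complex.exp_add, ← Complex.exp_add]
    congr 1
    ring
  have h2 : Complex.exp (-((m + 2 : ℕ) : ℂ) *
      (Complex.I * a * z - (1 / 2) * z ^ 2 + Complex.log z)) =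
      contourWeight (m + 2) (Complex.I * a) z / (z * z ^ (m + 1)) := by
    rw [← e1, contourWeight, ← Complex.exp_sub]
    congr 1
    ring
  have h3 : Complex.exp (-((m + 2 : ℕ) : ℂ) * (2 * (1 - (r : ℂ)) * (s : ℂ) * (t : ℂ) *
      (α : ℂ) ^ 2 - (1 / 2) * (Real.log (1 - α ^ 2) : ℂ))) =
      Complex.exp (-((m + 2 : ℕ) : ℂ) * (2 * (1 - (r : ℂ)) * (s : ℂ) * (t : ℂ) *
        (α : ℂ) ^ 2)) *
      Complex.exp (((m + 2 : ℕ) : ℂ) * ((1 / 2) * (Real.log (1 - α ^ 2) : ℂ))) := by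
    rw [← Complex.exp_add]
    congr 1
    ring
  have h4 : polarWeight (m + 2) r s t α =
      Complex.exp (-((m + 2 : ℕ) : ℂ) * ((1 - (r : ℂ) / 2) * ((s : ℂ) ^ 2 + (t : ℂ) ^ 2)
        + (r : ℂ) * (s : ℂ) * (t : ℂ))) *
      Complex.exp (-((m + 2 : ℕ) : ℂ) * (2 * (1 - (r : ℂ)) * (s : ℂ) * (t : ℂ) *
        (α : ℂ) ^ 2)) := by
    rw [polarWeight, ← Complex.exp_add]
    congr 1
    ring
  rw [unitIntegrand, expFactor, h1, h2, h3, h4, cexp_half_mul_log m hs, cexp_half_mul_log m ht,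
    cexp_half_mul_log m hα', polarDensity, ← e2]
  -- With all powers and exponentials treated as free variables, only the cancellation of `z` and `s
  -- * t` remains.
  have key : ∀ p q X B A A₁ A₂ V W Z D : ℂ, Z ≠ 0 →
      z * (1 / ((s : ℂ) * t)) * X * B *
        (A * A₁ * (p * s) * (q * t) * (W / (z * Z)) * (A₂ * (V * D))) =
      p * q * (X * V * D) * A * (A₁ * A₂) * (B * W / Z) := by
    intro p q X B A A₁ A₂ V W Z D hZ
    have h : z * (W / (z * Z)) = W / Z := by rw [← mul_div_assoc, mul_div_mul_left _ _ hz]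
    have h' : 1 / ((s : ℂ) * t) * (s * t) = 1 := one_div_mul_cancel (mul_ne_zero hsc htc)
    linear_combination (X * B * A * A₁ * p * q * A₂ * V * D) *
      (h * (1 / ((s : ℂ) * t) * (s * t)) + (W / Z) * h')
  exact key _ _ _ _ _ _ _ _ _ _ _ (pow_ne_zero _ hz)

lemma traceIntegrand_eq (N : ℕ) (r : ℝ) (a : ℂ) (s t α : ℝ) (z : ℂ) :
    traceIntegrand N r a s t α z = ((s : ℂ) + (t : ℂ)) * unitIntegrand N r a s t α z := by
  unfold traceIntegrand unitIntegrand
  ring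

variable {γ : ℝ → ℂ}

lemma IsContourAboutZero.integral_unitIntegrand (hγ : IsContourAboutZero γ) (m : ℕ) (r : ℝ)
    (a : ℂ) {s t α : ℝ} (hs : 0 < s) (ht : 0 < t) (hα : α ∈ Set.Ioo (-1 : ℝ) 1) :
    ∫ u in (0 : ℝ)..1, unitIntegrand (m + 2) r a s t α (γ u) * deriv γ u =
      2 * Real.pi * Complex.I * ((-((m + 2 : ℕ) : ℂ)) ^ m / (m.factorial : ℂ)) *
        (polarDensity m s t α * gramIntegrand (m + 2) r a (s, t, α)) := by
  have h1 : ∀ u ∈ Set.uIcc (0 : ℝ) 1, unitIntegrand (m + 2) r a s t α (γ u) * deriv γ u =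
      polarDensity m s t α *
      Complex.exp (-(((m + 2 : ℕ) : ℂ) * Complex.I * a) * ((s : ℂ) + (t : ℂ))) *
      polarWeight (m + 2) r s t α *
      (bracketFactor (m + 2) r a s t α (γ u) * contourWeight (m + 2) (Complex.I * a) (γ u) /
        γ u ^ (m + 1) * deriv γ u) := by
    intro u hu
    rw [Set.uIcc_of_le zero_le_one] at hu
    rw [unitIntegrand_eq m r a hs ht hα (hγ.ne_zero u hu)]
    ring
  rw [intervalIntegral.integral_congr h1, intervalIntegral.integral_const_mul]
  have h2 := contourMoment_quadratic hγ (N := m + 2) (by omega) (Complex.I * a)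
    ((2 - (r : ℂ)) * ((s : ℂ) + (t : ℂ)))
    ((1 - (r : ℂ)) * (4 * (s : ℂ) * (t : ℂ) * (1 - (α : ℂ) ^ 2)))
  have h3 : (fun z : ℂ => 1 / ((m + 2 : ℕ) : ℂ) + (z - Complex.I * a) ^ 2 -
      ((2 - (r : ℂ)) * ((s : ℂ) + (t : ℂ))) * (z - Complex.I * a) +
      (1 - (r : ℂ)) * (4 * (s : ℂ) * (t : ℂ) * (1 - (α : ℂ) ^ 2))) =
      bracketFactor (m + 2) r a s t α := by
    funext z
    unfold bracketFactor
    ring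
  rw [h3] at h2
  change _ * contourMoment γ (m + 2) (Complex.I * a) (bracketFactor (m + 2) r a s t α) (m + 1) = _
  change contourMoment γ (m + 2) (Complex.I * a) (bracketFactor (m + 2) r a s t α) (m + 1) =
    2 * Real.pi * Complex.I * ((-((m + 2 : ℕ) : ℂ)) ^ m / (m.factorial : ℂ)) *
      averagedDet (m + 2) _ _ _ at h2
  rw [h2, gramIntegrand, polarWeight]
  ring

theorem IsContourAboutZero.prefactor_mul_fourfoldIntegral (hγ : IsContourAboutZero γ) (m : ℕ)
    (r : ℝ) (a : ℂ) {w : ℝ × ℝ × ℝ → ℂ} (hw : Measurable w)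
    (hi : Integrable fun φ : Fin (m + 2) → ℂ =>
      w (gramTriple φ) * averagedIntegrand (m + 2) r a φ) :
    prefactor (m + 2) * fourfoldIntegral γ
        (fun s t α z => w (s, t, α) * unitIntegrand (m + 2) r a s t α z) =
      Complex.I * (((m + 2 : ℕ) : ℂ) / Real.pi) ^ (m + 2) *
        ∫ φ : Fin (m + 2) → ℂ, w (gramTriple φ) * averagedIntegrand (m + 2) r a φ := by
  simp only [averagedIntegrand_eq_gramIntegrand] at hi ⊢
  rw [integral_comp_gramTriple m (F := fun p => w p * gramIntegrand (m + 2) r a p)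
    (hw.mul (continuous_gramIntegrand _ r a).measurable) hi, toReal_gramConstant]
  have h1 : fourfoldIntegral γ
        (fun s t α z => w (s, t, α) * unitIntegrand (m + 2) r a s t α z) =
      2 * Real.pi * Complex.I * ((-((m + 2 : ℕ) : ℂ)) ^ m / (m.factorial : ℂ)) *
      ∫ s in Set.Ioi (0 : ℝ), ∫ t in Set.Ioi (0 : ℝ), ∫ α in Set.Ioo (-1 : ℝ) 1,
        ((s ^ ((m : ℝ) / 2) : ℝ) : ℂ) * ((t ^ ((m : ℝ) / 2) : ℝ) : ℂ) *
          (((1 - α ^ 2) ^ (((m : ℝ) - 1) / 2) : ℝ) : ℂ) *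
            (w (s, t, α) * gramIntegrand (m + 2) r a (s, t, α)) := by
    rw [fourfoldIntegral, ← integral_const_mul]
    refine setIntegral_congr_fun measurableSet_Ioi fun s hs => ?_
    rw [← integral_const_mul]
    refine setIntegral_congr_fun measurableSet_Ioi fun t ht => ?_
    rw [← integral_const_mul, intervalIntegral.integral_of_le (by norm_num),
      integral_Ioc_eq_integral_Ioo]
    refine setIntegral_congr_fun measurableSet_Ioo fun α hα => ?_
    simp only [mul_assoc (w (s, t, α))]
    rw [intervalIntegral.integral_const_mul, hγ.integral_unitIntegrand m r a hs ht hα,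
      polarDensity]
    ring
  rw [h1, prefactor]
  have hp : (Real.pi : ℂ) ≠ 0 := by exact_mod_cast Real.pi_ne_zero
  have hm : (m.factorial : ℂ) ≠ 0 := by exact_mod_cast m.factorial_ne_zero
  generalize (∫ s in Set.Ioi (0 : ℝ), (_ : ℂ)) = J
  have hsgn : ((-1 : ℂ) ^ m) * (-1) ^ m = 1 := by rw [← mul_pow]; simp
  rw [neg_pow ((m + 2 : ℕ) : ℂ) m, div_pow]
  push_cast
  field_simp
  linear_combination 8 * 2 ^ m * ((m : ℂ) + 2) ^ (m + 2) * Real.pi ^ (m + 2) * J * hsgn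

end FourfoldIntegral

/-! ### Absolute convergence of the four-fold integrals. -/

section AbsoluteConvergence

lemma integrableOn_pow_mul_rpow_mul_cexp (k m : ℕ) {c : ℂ} (hc : 0 < c.re) :
    IntegrableOn (fun s : ℝ => (s : ℂ) ^ k * ((s ^ ((m : ℝ) / 2) : ℝ) : ℂ) *
      Complex.exp (-c * s)) (Set.Ioi 0) := by
  have h := integrableOn_rpow_mul_exp_neg_mul_rpow (p := 1) (s := (k : ℝ) + (m : ℝ) / 2)
    (b := c.re) (by have : (0 : ℝ) ≤ (k : ℝ) + (m : ℝ) / 2 := by positivity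
                    linarith) one_pos hc
  refine h.mono' (by fun_prop) ?_
  refine (ae_restrict_iff' measurableSet_Ioi).2 (.of_forall fun s hs => ?_)
  have hs' : (0 : ℝ) < s := hs
  rw [norm_mul, norm_mul, norm_pow, Complex.norm_real, Complex.norm_real, Complex.norm_exp,
    Real.norm_of_nonneg hs'.le, Real.norm_of_nonneg (by positivity), Real.rpow_add hs',
    Real.rpow_natCast, Real.rpow_one]
  simp

/-- The worst case is `m = 0`, with exponent `-1/2`: this is the derivative of the bounded function
`arcsin`, and it dominates the others since `1 - α² ≤ 1`. -/
lemma integrableOn_one_sub_sq_rpow (m : ℕ) :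
    IntegrableOn (fun α : ℝ => (((1 - α ^ 2) ^ (((m : ℝ) - 1) / 2) : ℝ) : ℂ))
      (Set.Ioo (-1) 1) := by
  have h : IntegrableOn (fun α : ℝ => 1 / √(1 - α ^ 2)) (Set.Ioo (-1) 1) := by
    refine (intervalIntegral.integrableOn_deriv_of_nonneg Real.continuous_arcsin.continuousOn
      (fun x hx => Real.hasDerivAt_arcsin hx.1.ne' hx.2.ne)
      (fun x _ => by positivity)).mono_set Set.Ioo_subset_Ioc_self
  have hmeas : Measurable fun α : ℝ => (1 - α ^ 2) ^ (((m : ℝ) - 1) / 2) := by fun_prop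
  refine h.mono' (Complex.measurable_ofReal.comp hmeas).aestronglyMeasurable ?_
  refine (ae_restrict_iff' measurableSet_Ioo).2 (.of_forall fun α hα => ?_)
  have hα' : 0 < 1 - α ^ 2 := by nlinarith [hα.1, hα.2]
  rw [Complex.norm_real, Real.norm_of_nonneg (by positivity), Real.sqrt_eq_rpow,
    one_div ((1 - α ^ 2) ^ _), ← Real.rpow_neg hα'.le]
  refine Real.rpow_le_rpow_of_exponent_ge hα' (by nlinarith [sq_nonneg α]) ?_
  have : (0 : ℝ) ≤ m := by positivity
  linarith

/-- The exponent is real and nonpositive, because `(s + t)² - 4st(1 - α²) = (s - t)² + 4stα²`. -/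
lemma norm_polarWeight_le_one (N : ℕ) {r : ℝ} (hr : r ≤ 1) {s t : ℝ} (hs : 0 ≤ s) (ht : 0 ≤ t)
    (α : ℝ) : ‖polarWeight N r s t α‖ ≤ 1 := by
  have e : -((N : ℂ) / 2) * (((s : ℂ) + (t : ℂ)) ^ 2 + (1 - (r : ℂ)) *
    (((s : ℂ) + (t : ℂ)) ^ 2 - 4 * (s : ℂ) * (t : ℂ) * (1 - (α : ℂ) ^ 2))) =
    ((-((N : ℝ) / 2 * ((s + t) ^ 2 + (1 - r) * ((s - t) ^ 2 + 4 * (s * t) * α ^ 2))) : ℝ) : ℂ) := by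
    push_cast
    ring
  rw [polarWeight, e, Complex.norm_exp, Complex.ofReal_re, Real.exp_le_one_iff, neg_nonpos]
  have : 0 ≤ 1 - r := by linarith
  positivity

variable {γ : ℝ → ℂ}

/-- The weight and `p` are bounded, and what remains is a product of four one-variable integrable
functions. Decay in `s` and `t` comes only from `Re c > 0`, that is, from `Im a < 0` in the
application. -/
lemma IsContourAboutZero.fourfoldIntegrable_monomial (hγ : IsContourAboutZero γ) (m k l : ℕ)
    {r : ℝ} (hr : r ≤ 1) {c : ℂ} (hc : 0 < c.re) {p : ℝ → ℂ} (hp : Continuous p)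
    {g : ℂ → ℂ} (hg : ContinuousOn g {0}ᶜ) :
    FourfoldIntegrable γ fun s t α z => p α * polarWeight (m + 2) r s t α *
      ((s : ℂ) ^ k * (t : ℂ) ^ l * polarDensity m s t α *
        Complex.exp (-c * ((s : ℂ) + (t : ℂ))) * g z) := by
  obtain ⟨C, hC⟩ := isCompact_Icc.exists_bound_of_continuousOn
    (hp.continuousOn (s := Set.Icc (-1 : ℝ) 1))
  have hu : IntegrableOn (fun u => g (γ u) * deriv γ u) (Set.Ioo 0 1) :=
    (intervalIntegrable_iff_integrableOn_Ioo_of_le zero_le_one).1 (hγ.intervalIntegrable hg)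
  have h := (integrableOn_pow_mul_rpow_mul_cexp k m hc).integrable.mul_prod
    ((integrableOn_pow_mul_rpow_mul_cexp l m hc).integrable.mul_prod
      ((integrableOn_one_sub_sq_rpow m).integrable.mul_prod hu.integrable))
  have hb := h.bdd_mul (c := C)
    (f := fun q : ℝ × ℝ × ℝ × ℝ => p q.2.2.1 * polarWeight (m + 2) r q.1 q.2.1 q.2.2.1)
    (Continuous.aestronglyMeasurable (by unfold polarWeight; fun_prop)) ?_
  · rw [FourfoldIntegrable, IntegrableOn, Measure.volume_eq_prod, ← Measure.prod_restrict,
      Measure.volume_eq_prod, ← Measure.prod_restrict,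
      Measure.volume_eq_prod, ← Measure.prod_restrict]
    refine hb.congr (.of_forall fun q => ?_)
    dsimp only
    rw [mul_add, Complex.exp_add, polarDensity]
    ring
  · rw [Measure.prod_restrict, Measure.prod_restrict, Measure.prod_restrict]
    refine (ae_restrict_iff' (by measurability)).2 (.of_forall fun q hq => ?_)
    obtain ⟨hs, ht, hα, -⟩ := hq
    rw [norm_mul]
    have h1 := hC q.2.2.1 (Set.Ioo_subset_Icc_self hα)
    have h2 := norm_polarWeight_le_one (m + 2) hr (le_of_lt hs) (le_of_lt ht) q.2.2.1
    nlinarith [norm_nonneg (p q.2.2.1),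
      norm_nonneg (polarWeight (m + 2) r q.1 q.2.1 q.2.2.1)]

lemma FourfoldIntegrable.add {F G : ℝ → ℝ → ℝ → ℂ → ℂ} (hF : FourfoldIntegrable γ F)
    (hG : FourfoldIntegrable γ G) : FourfoldIntegrable γ fun s t α z => F s t α z + G s t α z := by
  refine (Integrable.add hF hG).congr (.of_forall fun q => ?_)
  simp [add_mul]

lemma FourfoldIntegrable.congr {F G : ℝ → ℝ → ℝ → ℂ → ℂ} (hF : FourfoldIntegrable γ F)
    (h : ∀ s t α u : ℝ, 0 < s → 0 < t → α ∈ Set.Ioo (-1 : ℝ) 1 → u ∈ Set.Ioo (0 : ℝ) 1 →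
      F s t α (γ u) = G s t α (γ u)) : FourfoldIntegrable γ G := by
  refine IntegrableOn.congr_fun hF (fun q hq => ?_) (by measurability)
  obtain ⟨hs, ht, hα, hu⟩ := hq
  rw [h _ _ _ _ hs ht hα hu]

theorem IsContourAboutZero.fourfoldIntegrable_monomial_mul_unitIntegrand
    (hγ : IsContourAboutZero γ) (m k l : ℕ) {r : ℝ} (hr : r ≤ 1) {a : ℂ} (ha : a.im < 0) :
    FourfoldIntegrable γ fun s t α z =>
      (s : ℂ) ^ k * (t : ℂ) ^ l * unitIntegrand (m + 2) r a s t α z := by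
  set W := contourWeight (m + 2) (Complex.I * a)
  have hW : Continuous W := (differentiable_contourWeight _ _).continuous
  have hpow : ∀ {f : ℂ → ℂ}, Continuous f → ContinuousOn (fun z => f z * W z / z ^ (m + 1)) {0}ᶜ :=
    fun hf => (hf.mul hW).continuousOn.div (by fun_prop) fun z hz => pow_ne_zero _ hz
  have hc : 0 < (((m + 2 : ℕ) : ℂ) * Complex.I * a).re := by
    simp only [Complex.mul_re, Complex.natCast_re, Complex.I_re, Complex.natCast_im, Complex.I_im,
      Complex.mul_im]
    have : (0 : ℝ) < ((m + 2 : ℕ) : ℝ) := by positivity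
    nlinarith
  -- The bracket is split by its dependence on `s` and `t` into multiples of `1`, `s`, `t` and `s *
  -- t`.
  have h0 := hγ.fourfoldIntegrable_monomial m k l hr hc (p := fun _ => 1) (by fun_prop)
    (hpow (f := fun z => 1 / ((m + 2 : ℕ) : ℂ) + (z - Complex.I * a) ^ 2) (by fun_prop))
  have h1 := hγ.fourfoldIntegrable_monomial m (k + 1) l hr hc (p := fun _ => 1) (by fun_prop)
    (hpow (f := fun z => -(2 - (r : ℂ)) * (z - Complex.I * a)) (by fun_prop))
  have h2 := hγ.fourfoldIntegrable_monomial m k (l + 1) hr hc (p := fun _ => 1) (by fun_prop)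
    (hpow (f := fun z => -(2 - (r : ℂ)) * (z - Complex.I * a)) (by fun_prop))
  have h3 := hγ.fourfoldIntegrable_monomial m (k + 1) (l + 1) hr hc
    (p := fun α => 4 * (1 - (r : ℂ)) * (1 - (α : ℂ) ^ 2)) (by fun_prop)
    (hpow (f := fun _ => 1) (by fun_prop))
  refine (((h0.add h1).add h2).add h3).congr fun s t α u hs ht hα hu => ?_
  rw [unitIntegrand_eq m r a hs ht hα (hγ.ne_zero u (Set.Ioo_subset_Icc_self hu)), bracketFactor]
  simp only [W]
  ring

end AbsoluteConvergence

/-! ### Passing to the law of the entries and assembling the two formulas. -/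

section Conclusion

lemma IsInterpolatingEnsemble.isEnsembleLaw {Ω : Type*} [MeasurableSpace Ω] {N : ℕ} {r : ℝ}
    {μ : Measure Ω} {H : Ω → Matrix (Fin N) (Fin N) ℂ} (hH : IsInterpolatingEnsemble N r μ H) :
    IsEnsembleLaw r (μ.map fun ω (p : Fin N × Fin N) => H ω p.1 p.2) := by
  have hm : AEMeasurable (fun ω (p : Fin N × Fin N) => H ω p.1 p.2) μ := hH.gaussian.aemeasurable
  refine ⟨hH.gaussian.isGaussian_map, ?_, fun p => ?_, fun i j k l => ?_⟩
  · rw [ae_map_iff hm]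
    · exact hH.hermitian
    · have : {x : Fin N × Fin N → ℂ | (entryMatrix x).IsHermitian} =
          ⋂ i, ⋂ j, {x | star (x (j, i)) = x (i, j)} := by
        ext x
        simp [Matrix.IsHermitian.ext_iff, entryMatrix]
      rw [this]
      exact MeasurableSet.iInter fun i => MeasurableSet.iInter fun j =>
        measurableSet_eq_fun (by fun_prop) (by fun_prop)
  · rw [integral_map hm (by exact (measurable_pi_apply p).aestronglyMeasurable)]
    exact hH.centered p.1 p.2
  · rw [integral_map hm (by fun_prop)]
    exact hH.covariance i j k l

theorem lemma3 (N : ℕ) (hN : 2 ≤ N) (r : ℝ) (hr0 : 0 ≤ r) (hr1 : r ≤ 1)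
    (E ε : ℝ) (hε : 0 < ε)
    {Ω : Type*} [MeasurableSpace Ω] (μ : Measure Ω) (H : Ω → Matrix (Fin N) (Fin N) ℂ)
    (hH : IsInterpolatingEnsemble N r μ H)
    (γ : ℝ → ℂ) (hγ : IsContourAboutZero γ) :
    (Integrable (fun ω => (resolventMatrix (H ω) (specParam E ε)).trace) μ ∧
      FourfoldIntegrable γ (traceIntegrand N r (specParam E ε)) ∧
      (1 / (N : ℂ)) * ∫ ω, (resolventMatrix (H ω) (specParam E ε)).trace ∂μ =
        prefactor N * fourfoldIntegral γ (traceIntegrand N r (specParam E ε))) ∧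
    (FourfoldIntegrable γ (unitIntegrand N r (specParam E ε)) ∧
      Complex.I =
        prefactor N * fourfoldIntegral γ (unitIntegrand N r (specParam E ε))) := by
  obtain ⟨m, rfl⟩ := Nat.exists_eq_add_of_le' hN
  have hm : AEMeasurable (fun ω (p : Fin (m + 2) × Fin (m + 2)) => H ω p.1 p.2) μ :=
    hH.gaussian.aemeasurable
  have ha : (specParam E ε).im < 0 := by simpa [specParam] using hε
  have hν := hH.isEnsembleLaw
  set a := specParam E ε
  obtain ⟨hi1, he1⟩ := hν.integral_averagedIntegrand hN ha
  obtain ⟨hi2, ht2, he2⟩ := hν.integral_trace_resolvent hN ha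
  have htr : ∀ ω, (resolventMatrix (H ω) a).trace =
      ((a • 1 - entryMatrix fun p : Fin (m + 2) × Fin (m + 2) => H ω p.1 p.2)⁻¹).trace :=
    fun _ => rfl
  have hcancel : (((m + 2 : ℕ) : ℂ) / Real.pi) ^ (m + 2) *
      ((Real.pi : ℂ) / ((m + 2 : ℕ) : ℂ)) ^ (m + 2) = 1 := by
    have hp : (Real.pi : ℂ) ≠ 0 := by exact_mod_cast Real.pi_ne_zero
    have hn : ((m + 2 : ℕ) : ℂ) ≠ 0 := by exact_mod_cast Nat.succ_ne_zero (m + 1)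
    rw [← mul_pow, div_mul_div_cancel₀ hp, div_self hn, one_pow]
  -- The two formulas differ only by the weight `s + t`, which is `φ†φ` in Gram coordinates; one
  -- change-of-variables theorem serves both, with `w = s + t` and `w = 1`.
  have hT : traceIntegrand (m + 2) r a = fun s t α z =>
      (fun p : ℝ × ℝ × ℝ => (p.1 : ℂ) + (p.2.1 : ℂ)) (s, t, α) *
        unitIntegrand (m + 2) r a s t α z := by
    funext s t α z
    exact traceIntegrand_eq _ _ _ _ _ _ _
  refine ⟨⟨?_, ?_, ?_⟩, ?_, ?_⟩
  · exact ht2.comp_aemeasurable hm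
  · refine ((hγ.fourfoldIntegrable_monomial_mul_unitIntegrand m 1 0 hr1 ha).add
      (hγ.fourfoldIntegrable_monomial_mul_unitIntegrand m 0 1 hr1 ha)).congr
      fun s t α u _ _ _ _ => ?_
    rw [traceIntegrand_eq]
    ring
  · simp only [sqNorm_gramTriple] at hi2 he2
    rw [hT, hγ.prefactor_mul_fourfoldIntegral m r a
      (w := fun p : ℝ × ℝ × ℝ => (p.1 : ℂ) + (p.2.1 : ℂ)) (by fun_prop) hi2, he2,
      integral_map hm ht2.aestronglyMeasurable]
    simp only [htr]
    generalize (∫ ω, (_ : ℂ) ∂μ) = J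
    rw [one_div]
    linear_combination (-(((m + 2 : ℕ) : ℂ)⁻¹ * J)) * hcancel +
      (((m + 2 : ℕ) : ℂ) / Real.pi) ^ (m + 2) * ((Real.pi : ℂ) / ((m + 2 : ℕ) : ℂ)) ^ (m + 2) *
        (((m + 2 : ℕ) : ℂ)⁻¹ * J) * Complex.I_sq
  · refine (hγ.fourfoldIntegrable_monomial_mul_unitIntegrand m 0 0 hr1 ha).congr
      fun s t α u _ _ _ _ => ?_
    ring
  · have h := hγ.prefactor_mul_fourfoldIntegral m r a (w := fun _ => 1) (by fun_prop)
      (by simpa only [one_mul] using hi1)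
    simp only [one_mul] at h
    rw [h, he1, mul_assoc, hcancel, mul_one]

end Conclusion
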